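/- For integers $n,j,k,l\ge 0$ put $S_{njkl}=\min\{n,j,k,l\}+1$. A \emph{stationary state} with parameters $(\lambda,\omega)\in\mathbb{R}^2$ is a real sequence $A=(A_n)_{n\ge0}\in\ell^2(\mathbb{N})$ with $\sum_{n\ge 0}(n+1)^2A_n^2<\infty$ such that, for every $n\ge0$, $$(n+1)(\lambda-n\omega)A_n=\sum_{j=0}^{\infty}\ \sum_{k=0}^{n+j}S_{njk,n+j-k}\,A_jA_kA_{n+j-k},$$ where the series over $j$ converges absolutely. Let $e_N=(\delta_{nN})_{n\ge0}$; it is a stationary state for every $\omega$ when $\lambda=1+N\omega$. For $N\in\{0,1\}$, $\omega_*\in\mathbb{R}$ and indices $p,q$, consider the following statement. $\mathcal{B}(N,\omega_*,p,q)$: \emph{the stationary states with $\lambda-N\omega=1$ bifurcating from $e_N$ at $\omega=\omega_*$ form exactly three branches (the third one up to reflection).} That is, there are $\delta,C>0$, functions $(\varepsilon,\mu)\mapsto(\omega^{(i)}(\varepsilon,\mu),A^{(i)}(\varepsilon,\mu))\in\mathbb{R}\times\ell^2(\mathbb{N})$, $i=1,2,3$, which are $C^\infty$ for $|\varepsilon|,|\mu|<\delta$,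 and a $C^\infty$ function $m:(-\delta,0)\to(0,\delta)$ with $|m(\varepsilon)-2|\varepsilon|^{3/2}|\le C\varepsilon^2$, such that, with the curves \begin{itemize} \item[(i)] $\Gamma_1=\{\varepsilon=0,\ 0<|\mu|<\delta\}$, \item[(ii)] $\Gamma_2=\{0<|\varepsilon|<\delta,\ \mu=0\}$, \item[(iii)] $\Gamma_3=\{-\delta<\varepsilon<0,\ \mu=m(\varepsilon)\}$, \end{itemize} the following holds. \begin{itemize} \item For each $i$ and $(\varepsilon,\mu)\in\Gamma_i$, the sequence $A=A^{(i)}(\varepsilon,\mu)$ is a stationary state with $\omega=\omega^{(i)}(\varepsilon,\mu)$ and $\lambda=1+N\omega$; it satisfies $A_p=\varepsilon$, $A_q=\mu$ and $$|\omega-\omega_*|+\sup_{n\ge0}|A_n-\delta_{nN}-\varepsilon\delta_{np}-\mu\delta_{nq}|\le C(\varepsilon^2+\mu^2).$$ \item For $(\varepsilon,\mu)\in\Gamma_3$, the reflection $(-1)^{\lfloor n/(N+1)\rfloor}A^{(3)}_n(\varepsilon,\mu)$ is also a stationary state with the same $(\lambda,\omega)$, and its entries with indices $p$ and $q$ are $\varepsilon$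 and $-\mu$. \item There is $\eta>0$ such that every stationary state $A$ with parameters $(1+N\omega,\omega)$, $|\omega-\omega_*|<\eta$ and $\|A-e_N\|_{\ell^2}<\eta$ is either $e_N$, or one of $(\omega,A)=(\omega^{(i)},A^{(i)})(\varepsilon,\mu)$ with $i\in\{1,2,3\}$ and $(\varepsilon,\mu)\in\Gamma_i$, or the reflection of $A^{(3)}(\varepsilon,\mu)$ with $\omega=\omega^{(3)}(\varepsilon,\mu)$ and $(\varepsilon,\mu)\in\Gamma_3$. \end{itemize} \textbf{Theorem.} There are branches $(\omega^{(i)},A^{(i)})$, $i=1,2,3$, and a function $m$ as in $\mathcal{B}(0,\tfrac16,2,3)$ (the lowest eigenmode) whose images under the map $u(z)\mapsto z\,u(z^2)$ of generating functions $u(z)=\sum_n A_nz^n$, that is $$\tilde\omega^{(i)}=\tfrac12\,\omega^{(i)},\qquad \tilde A^{(i)}_{2k+1}=A^{(i)}_k,\qquad \tilde A^{(i)}_{2k}=0\qquad(k\ge0),$$ together with the same $m$, are branches as in $\mathcal{B}(1,\tfrac1{12},5,7)$. In particular, at the double point $\omega_*=\omega_5=\omega_7=\tfrac1{12}$ of the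 second eigenmode ($\lambda-\omega=1$) exactly three branches bifurcate: $\varepsilon=0$; $\mu=0$; and $\varepsilon<0$ with $|\mu-2|\varepsilon|^{3/2}|\lesssim\varepsilon^2$, the last one unique up to the reflection $\mu\mapsto-\mu$; and they arise from the branches of the lowest eigenmode at $\tfrac16$ by $z\,u(z^2)$. -/

import Mathlib

namespace ConformalFlow

/-- Real square-summable sequences indexed by `ℕ`, with the `ℓ²` norm. -/
abbrev SeqL2 : Type := lp (fun _ : ℕ => ℝ) 2

/-- The interaction coefficient `S_{njkl} = min (n, j, k, l) + 1`. -/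
def interaction (n j k l : ℕ) : ℝ := ((min (min n j) (min k l) + 1 : ℕ) : ℝ)

/-- `A` is a real stationary state with parameters `lam, ω`: it has finite energy
`∑ (n+1)² A_n²`, and for each `n` the series
`∑_j ∑_{k ≤ n+j} S_{n,j,k,n+j-k} A_j A_k A_{n+j-k}` converges to `(n+1) (lam - n ω) A_n`. -/
def IsStationary (lam ω : ℝ) (A : SeqL2) : Prop :=
  (Summable fun n : ℕ => ((n : ℝ) + 1) ^ 2 * A n ^ 2) ∧
  ∀ n : ℕ, HasSum
    (fun j : ℕ => ∑ k ∈ Finset.range (n + j + 1),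
      interaction n j k (n + j - k) * A j * A k * A (n + j - k))
    (((n : ℝ) + 1) * (lam - n * ω) * A n)

/-- The single-mode state `A_n = δ_{nN}`. -/
noncomputable def mode (N : ℕ) : SeqL2 := lp.single 2 N (1 : ℝ)

theorem memlp_reflect (N : ℕ) (A : SeqL2) :
    Memℓp (fun n : ℕ => (-1 : ℝ) ^ (n / (N + 1)) * A n) 2 := by
  have hA : Summable fun n : ℕ => ‖A n‖ ^ (2 : ENNReal).toReal :=
    (memℓp_gen_iff (by norm_num)).1 (lp.memℓp A)
  refine (memℓp_gen_iff (by norm_num)).2 (hA.congr fun n => ?_)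
  rw [norm_mul, norm_pow, norm_neg, norm_one, one_pow, one_mul]

/-- The reflection `A_n ↦ (-1)^⌊n/(N+1)⌋ A_n`. For `N = 0` this is `A_n ↦ (-1)^n A_n`; on sequences
supported on odd indices and for `N = 1` it is `A_{2k+1} ↦ (-1)^k A_{2k+1}`. -/
def reflect (N : ℕ) (A : SeqL2) : SeqL2 :=
  ⟨fun n : ℕ => (-1 : ℝ) ^ (n / (N + 1)) * A n, memlp_reflect N A⟩

theorem memlp_zLift (A : SeqL2) :
    Memℓp (fun n : ℕ => if n % 2 = 1 then A (n / 2) else (0 : ℝ)) 2 := by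
  have hA : Summable fun n : ℕ => ‖A n‖ ^ (2 : ENNReal).toReal :=
    (memℓp_gen_iff (by norm_num)).1 (lp.memℓp A)
  refine (memℓp_gen_iff (by norm_num)).2 ?_
  have hinj : Function.Injective fun m : ℕ => 2 * m + 1 := fun a b h => by
    simp only at h; omega
  refine (hinj.summable_iff ?_).1 ?_
  · intro n hn
    have : n % 2 ≠ 1 := fun h => hn ⟨n / 2, by simp only; omega⟩
    simp [this]
  · refine hA.congr fun m => ?_
    have h1 : (2 * m + 1) % 2 = 1 := by omega
    have h2 : (2 * m + 1) / 2 = m := by omega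
    simp [Function.comp, h1, h2]

/-- The map `u(z) ↦ z u(z²)` on coefficient sequences: `A_m` is moved to position `2m+1`, and the
entries at even positions are zero. -/
def zLift (A : SeqL2) : SeqL2 :=
  ⟨fun n : ℕ => if n % 2 = 1 then A (n / 2) else (0 : ℝ), memlp_zLift A⟩

/-- The parameter curves `(ε, μ)` of the three branches:
`ε = 0, μ ≠ 0`; then `ε ≠ 0, μ = 0`; then `ε < 0, μ = m ε`. -/
def branchCurve (m : ℝ → ℝ) (δ : ℝ) : Fin 3 → Set (ℝ × ℝ)
  | 0 => {x | x.1 = 0 ∧ x.2 ≠ 0 ∧ |x.2| < δ}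
  | 1 => {x | x.2 = 0 ∧ x.1 ≠ 0 ∧ |x.1| < δ}
  | 2 => {x | -δ < x.1 ∧ x.1 < 0 ∧ x.2 = m x.1}

/-- The stationary states with `lam - N ω = 1` that bifurcate from the `N`-th single-mode state at
`ω = ωs`, with kernel modes `p` and `q`, are exactly the three branches
`(W i (ε, μ), A i (ε, μ))`, where `(ε, μ)` runs through `branchCurve m δ i`, together with the
reflection of the third one. -/
def IsBranchTriple (N : ℕ) (ωs : ℝ) (p q : ℕ)
    (W : Fin 3 → ℝ × ℝ → ℝ) (A : Fin 3 → ℝ × ℝ → SeqL2) (m : ℝ → ℝ) : Prop :=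
  ∃ δ > 0, ∃ C : ℝ,
    -- smooth dependence on the two parameters
    (∀ i, ContDiffOn ℝ ((⊤ : ℕ∞) : WithTop ℕ∞) (W i) (Metric.ball 0 δ) ∧
      ContDiffOn ℝ ((⊤ : ℕ∞) : WithTop ℕ∞) (A i) (Metric.ball 0 δ)) ∧
    -- the curve of the third branch
    ContDiffOn ℝ ((⊤ : ℕ∞) : WithTop ℕ∞) m (Set.Ioo (-δ) 0) ∧
    (∀ ε ∈ Set.Ioo (-δ) 0,
      0 < m ε ∧ m ε < δ ∧ |m ε - 2 * |ε| ^ (3 / 2 : ℝ)| ≤ C * ε ^ 2) ∧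
    -- the branches consist of solutions, `ε` and `μ` are the amplitudes of the modes `p` and `q`,
    -- and the solutions are quadratically close to the linear approximation
    (∀ i, ∀ x ∈ branchCurve m δ i,
      IsStationary (1 + N * W i x) (W i x) (A i x) ∧
      A i x p = x.1 ∧ A i x q = x.2 ∧
      ∀ n : ℕ, |W i x - ωs| + |A i x n - mode N n - x.1 * mode p n - x.2 * mode q n|
        ≤ C * (x.1 ^ 2 + x.2 ^ 2)) ∧
    -- the reflection of the third branch
    (∀ x ∈ branchCurve m δ 2,
      IsStationary (1 + N * W 2 x) (W 2 x) (reflect N (A 2 x)) ∧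
      reflect N (A 2 x) p = x.1 ∧ reflect N (A 2 x) q = -x.2) ∧
    -- there are no other solutions near the bifurcation point
    ∃ η > 0, ∀ (ω : ℝ) (B : SeqL2), |ω - ωs| < η → ‖B - mode N‖ < η →
      IsStationary (1 + N * ω) ω B →
      B = mode N ∨
      (∃ i, ∃ x ∈ branchCurve m δ i, ω = W i x ∧ B = A i x) ∨
      (∃ x ∈ branchCurve m δ 2, ω = W 2 x ∧ B = reflect N (A 2 x))

end ConformalFlow

/-! ### Absolutely summable sequences. -/

namespace ConformalFlow

open Filter Topology

set_option maxSynthPendingDepth 4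

/-! At the lowest mode the linearization is diagonal, with eigenvalue `-2` at index 0 and `1 - nω -
2/(n+1)` at `n ≥ 1`. For `ω = 1/6` it vanishes exactly at the indices 2 and 3, so a Lyapunov–Schmidt
reduction leaves two scalar equations in the amplitudes `ε`, `μ` and `Ω = ω - 1/6`.

The form of these equations is decisive. A product `A_j A_k A_l` enters equation `n` only if `k + l
= n + j`, which respects parity and divisibility by 3. Write `A_n = ε^a μ^b x_n`, with `a = 0` if 3
divides `n` and `a = 1` otherwise, and with `b = n mod 2`. Every term of equation `n` then contains
the factor `ε^a μ^b`, and the surplus power of `μ` is even. After rescaling, the equations are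
polynomial in `ε`, `ν = μ²`, `Ω`, and the two remaining ones read `ε K₂(ε, μ², Ω) = 0` and `μ K₃(ε,
μ², Ω) = 0` with analytic `K₂`, `K₃` (`exists_reduced_family`, `exists_state_family`). The
derivatives of `K₂`, `K₃` in `(ν, Ω)` form an invertible matrix with nonzero `Ω`-entries. The
implicit function theorem therefore gives three families: `ε = 0`; `μ = 0`; and `μ² = ν(ε)` with `ν`
analytic (`exists_branch_functions`).

The expansion `ν = -4ε³ + O(ε⁴)` is not computed perturbatively. It is read off from explicit
solutions `A_n = (b + gn)pⁿ` with `p = -√q`, for which `ε ≈ -q` and `μ ≈ 2q^{3/2}`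
(`hasSum_geometric_cubic`, `exists_geometric_coefficients`, `exists_solution_of_neg_amplitude`).
These cover only `ε < 0`, but by analyticity the estimate extends to `ε > 0`
(`analyticAt_isBigO_pow_of_left`). There `ν < 0`, so the third branch has no real points with `ε >
0`.

For the second mode, `u(z) ↦ z u(z²)` doubles both the interaction coefficient and the factor `n +
1`, hence maps solutions to solutions (`cubic_oddLift`). Conversely, the even part of a solution
near `e_1` solves a small perturbation of an invertible linear system and vanishes
(`Solves.apply_even_eq_zero`).

The analysis takes place in `ℓ¹`, where the cubic term divided by `n + 1` is a bounded trilinear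
form. The `ℓ²` neighbourhoods of the statement are reached through `norm_le_norm_toL2_of_solves`. -/

/-- Real absolutely summable sequences indexed by `ℕ`. -/
abbrev SeqL1 : Type := lp (fun _ : ℕ => ℝ) 1

/-- The coordinate sequences of `ℓ¹`. -/
noncomputable def unit (n : ℕ) : SeqL1 := lp.single 1 n (1 : ℝ)

theorem unit_apply (n m : ℕ) : unit n m = if m = n then 1 else 0 := by
  simp [unit, lp.single_apply, Pi.single_apply]

theorem norm_unit (n : ℕ) : ‖unit n‖ = 1 := by
  rw [unit, lp.norm_single (by norm_num)]; simp

namespace SeqL1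

theorem hasSum_abs (x : SeqL1) : HasSum (fun n => |x n|) ‖x‖ := by
  simpa using lp.hasSum_norm (p := 1) (by norm_num) x

theorem summable_abs (x : SeqL1) : Summable fun n => |x n| := x.hasSum_abs.summable

theorem abs_apply_le (x : SeqL1) (n : ℕ) : |x n| ≤ ‖x‖ := by
  simpa using lp.norm_apply_le_norm (p := 1) (by norm_num) x n

/-- The element of `ℓ¹` with prescribed absolutely summable coordinates. -/
def ofSummable (f : ℕ → ℝ) (hf : Summable fun n => |f n|) : SeqL1 :=
  ⟨f, (memℓp_gen_iff (by norm_num)).2 (by simpa using hf)⟩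

@[simp] theorem ofSummable_apply (f : ℕ → ℝ) (hf : Summable fun n => |f n|) (n : ℕ) :
    ofSummable f hf n = f n := rfl

theorem norm_le_of_abs_le {x y : SeqL1} (h : ∀ n, |x n| ≤ |y n|) : ‖x‖ ≤ ‖y‖ :=
  hasSum_le h x.hasSum_abs y.hasSum_abs

theorem norm_le_mul_of_abs_le {x y : SeqL1} {c : ℝ} (h : ∀ n, |x n| ≤ c * |y n|) :
    ‖x‖ ≤ c * ‖y‖ :=
  hasSum_le h x.hasSum_abs (y.hasSum_abs.mul_left c)

theorem hasSum_unit (x : SeqL1) : HasSum (fun n => x n • unit n) x := by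
  have h := lp.hasSum_single (p := 1) (by norm_num) x
  refine h.congr_fun fun n => ?_
  ext m
  by_cases hm : m = n
  · subst hm; simp [unit_apply]
  · simp [unit_apply, hm, lp.single_apply]

section Lift

variable {X : Type*} [NormedAddCommGroup X] [NormedSpace ℝ X]

theorem hasSum_map (T : SeqL1 →L[ℝ] X) (x : SeqL1) :
    HasSum (fun n => x n • T (unit n)) (T x) := by
  simpa using x.hasSum_unit.mapL T

/-- Used one slot at a time, this reduces identities between multilinear forms on `ℓ¹` to identities
between indices. -/
theorem clm_ext {T S : SeqL1 →L[ℝ] X} (h : ∀ n, T (unit n) = S (unit n)) : T = S := by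
  ext x
  have h1 := hasSum_map T x
  simp only [h] at h1
  exact h1.unique (hasSum_map S x)

theorem norm_map_le (T : SeqL1 →L[ℝ] X) {M : ℝ} (hM : ∀ n, ‖T (unit n)‖ ≤ M) (x : SeqL1) :
    ‖T x‖ ≤ M * ‖x‖ := by
  have hs : HasSum (fun n => M * |x n|) (M * ‖x‖) := x.hasSum_abs.mul_left M
  rw [← (hasSum_map T x).tsum_eq]
  refine tsum_of_norm_bounded hs fun n => ?_
  rw [norm_smul, Real.norm_eq_abs, mul_comm]
  exact mul_le_mul_of_nonneg_right (hM n) (abs_nonneg _)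

variable [CompleteSpace X]

theorem summable_smul_of_bounded (b : ℕ → X) {M : ℝ} (hb : ∀ n, ‖b n‖ ≤ M) (x : SeqL1) :
    Summable fun n => x n • b n := by
  refine Summable.of_norm_bounded (x.summable_abs.mul_right M) fun n => ?_
  rw [norm_smul, Real.norm_eq_abs]
  exact mul_le_mul_of_nonneg_left (hb n) (abs_nonneg _)

/-- The continuous linear map on `ℓ¹` which sends the coordinate sequences to a bounded family. -/
noncomputable def lift (b : ℕ → X) (M : ℝ) (hb : ∀ n, ‖b n‖ ≤ M) : SeqL1 →L[ℝ] X :=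
  LinearMap.mkContinuous
    { toFun := fun x => ∑' n, x n • b n
      map_add' := fun x y => by
        rw [← (summable_smul_of_bounded b hb x).tsum_add (summable_smul_of_bounded b hb y)]
        simp [add_smul]
      map_smul' := fun c x => by
        rw [RingHom.id_apply, ← (summable_smul_of_bounded b hb x).tsum_const_smul c]
        simp [mul_smul] } M (fun x => by
      refine tsum_of_norm_bounded (x.hasSum_abs.mul_left M) fun n => ?_
      rw [norm_smul, Real.norm_eq_abs, mul_comm]
      exact mul_le_mul_of_nonneg_right (hb n) (abs_nonneg _))

@[simp] theorem lift_unit (b : ℕ → X) (M : ℝ) (hb : ∀ n, ‖b n‖ ≤ M) (n : ℕ) :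
    lift b M hb (unit n) = b n := by
  change ∑' m, unit n m • b m = b n
  rw [tsum_eq_single n]
  · simp [unit_apply]
  · intro m hm
    simp [unit_apply, hm]

theorem norm_lift_le (b : ℕ → X) (M : ℝ) (hb : ∀ n, ‖b n‖ ≤ M) : ‖lift b M hb‖ ≤ M :=
  LinearMap.mkContinuous_norm_le _ ((norm_nonneg _).trans (hb 0)) _

end Lift

/-- Coordinate evaluation. -/
noncomputable def coord (n : ℕ) : SeqL1 →L[ℝ] ℝ := lp.evalCLM ℝ (fun _ : ℕ => ℝ) 1 n

@[simp] theorem coord_apply (n : ℕ) (x : SeqL1) : coord n x = x n := rfl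

@[simp] theorem add_apply' (x y : SeqL1) (n : ℕ) : (x + y) n = x n + y n := rfl
@[simp] theorem sub_apply' (x y : SeqL1) (n : ℕ) : (x - y) n = x n - y n := rfl
@[simp] theorem neg_apply' (x : SeqL1) (n : ℕ) : (-x) n = -x n := rfl
@[simp] theorem smul_apply' (c : ℝ) (x : SeqL1) (n : ℕ) : (c • x) n = c * x n := rfl
@[simp] theorem zero_apply' (n : ℕ) : (0 : SeqL1) n = 0 := rfl

/-- Multiplication by a bounded sequence. -/
noncomputable def diag (d : ℕ → ℝ) (M : ℝ) (hd : ∀ n, |d n| ≤ M) : SeqL1 →L[ℝ] SeqL1 :=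
  lift (fun n => d n • unit n) M fun n => by rw [norm_smul, norm_unit, mul_one]; exact hd n

theorem diag_apply (d : ℕ → ℝ) (M : ℝ) (hd : ∀ n, |d n| ≤ M) (x : SeqL1) (n : ℕ) :
    diag d M hd x n = d n * x n := by
  have : (coord n).comp (diag d M hd) = d n • coord n := by
    refine clm_ext fun m => ?_
    by_cases h : n = m
    · subst h; simp [diag]
    · simp [diag, unit_apply, h]
  exact DFunLike.congr_fun this x

/-- The inclusion `ℓ¹ ⊆ ℓ²`. -/
noncomputable def toL2 : SeqL1 →L[ℝ] SeqL2 :=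
  lift (fun n => mode n) 1 fun n => by
    rw [mode, lp.norm_single (by norm_num)]; simp

theorem _root_.ConformalFlow.mode_apply (n m : ℕ) : mode n m = if m = n then 1 else 0 := by
  simp [mode, lp.single_apply, Pi.single_apply]

@[simp] theorem toL2_apply (x : SeqL1) (n : ℕ) : toL2 x n = x n := by
  have : (lp.evalCLM ℝ (fun _ : ℕ => ℝ) 2 n).comp toL2 = coord n := by
    refine clm_ext fun m => ?_
    change toL2 (unit m) n = unit m n
    simp [toL2, mode_apply, unit_apply]
  exact DFunLike.congr_fun this x

theorem toL2_unit (n : ℕ) : toL2 (unit n) = mode n := by simp [toL2]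

end SeqL1

namespace SeqL2

theorem hasSum_sq (x : SeqL2) : HasSum (fun n => x n ^ 2) (‖x‖ ^ 2) := by
  have := lp.hasSum_norm (p := 2) (by norm_num) x
  simpa using this

@[simp] theorem sub_apply' (x y : SeqL2) (n : ℕ) : (x - y) n = x n - y n := rfl

/-- A sequence dominated by an injective rearrangement of part of `x` has norm at most `‖x‖`. -/
theorem norm_le_of_injOn {x y : SeqL2} (s : Set ℕ) (f : ℕ → ℕ) (hf : Set.InjOn f s)
    (h : ∀ n ∈ s, |y n| ≤ |x (f n)|) (h0 : ∀ n ∉ s, y n = 0) : ‖y‖ ≤ ‖x‖ := by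
  refine abs_le_of_sq_le_sq' ?_ (norm_nonneg _) |>.2
  have hinj : Function.Injective fun n : s => f n := fun a b hab =>
    Subtype.ext (hf a.2 b.2 hab)
  have h1 : Summable fun n : s => x (f n) ^ 2 := x.hasSum_sq.summable.comp_injective hinj
  have h2 : ∑' n : s, x (f n) ^ 2 ≤ ‖x‖ ^ 2 := by
    rw [← x.hasSum_sq.tsum_eq]
    exact tsum_comp_le_tsum_of_inj x.hasSum_sq.summable (fun n => sq_nonneg _) hinj
  have h3 : HasSum (fun n : s => y n ^ 2) (‖y‖ ^ 2) := by
    refine (hasSum_subtype_iff_of_support_subset (f := fun n => y n ^ 2) ?_).2 y.hasSum_sq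
    intro n hn
    by_contra hns
    exact hn (by simp [h0 n hns])
  refine (hasSum_le (fun n => ?_) h3 h1.hasSum).trans h2
  exact sq_le_sq.2 (h n n.2)

end SeqL2

/-! ### Trilinear forms with bounded coefficients. -/

/-- Bounded coefficients of a trilinear form `(x, y, z) ↦ ∑ c_{jkl} x_j y_k z_l δ_{k+l-j}`. -/
structure Kernel where
  coef : ℕ → ℕ → ℕ → ℝ
  abs_le : ∀ j k l, |coef j k l| ≤ 1
  vanish : ∀ j k l, k + l < j → coef j k l = 0

namespace Kernel

open SeqL1

variable (c : Kernel)

theorem norm_coef_smul_unit_le (j k l : ℕ) : ‖c.coef j k l • unit (k + l - j)‖ ≤ 1 := by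
  rw [norm_smul, norm_unit, mul_one]; exact c.abs_le j k l

/-- The trilinear form on `ℓ¹` with given bounded coefficients. -/
noncomputable def tri : SeqL1 →L[ℝ] SeqL1 →L[ℝ] SeqL1 →L[ℝ] SeqL1 :=
  lift (fun j => lift (fun k => lift (fun l => c.coef j k l • unit (k + l - j)) 1
    (c.norm_coef_smul_unit_le j k)) 1 fun _ => norm_lift_le _ _ _) 1 fun _ => norm_lift_le _ _ _

theorem tri_unit (j k l : ℕ) :
    c.tri (unit j) (unit k) (unit l) = c.coef j k l • unit (k + l - j) := by
  simp [tri]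

theorem norm_tri_le (x y z : SeqL1) : ‖c.tri x y z‖ ≤ ‖x‖ * ‖y‖ * ‖z‖ := by
  have h : ‖c.tri‖ ≤ 1 := norm_lift_le _ _ _
  calc ‖c.tri x y z‖ ≤ ‖c.tri x y‖ * ‖z‖ := (c.tri x y).le_opNorm z
    _ ≤ ‖c.tri x‖ * ‖y‖ * ‖z‖ := by gcongr; exact (c.tri x).le_opNorm y
    _ ≤ ‖c.tri‖ * ‖x‖ * ‖y‖ * ‖z‖ := by gcongr; exact c.tri.le_opNorm x
    _ ≤ 1 * ‖x‖ * ‖y‖ * ‖z‖ := by gcongr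
    _ = _ := by ring

/-- With two slots at coordinate vectors, the form only moves coordinates injectively and weights
them. This and the two companions below serve both for explicit linearizations and for the `ℓ²`
bounds. -/
theorem tri_unit_unit_apply (j k : ℕ) (z : SeqL1) (n : ℕ) :
    c.tri (unit j) (unit k) z n =
      if k ≤ n + j then c.coef j k (n + j - k) * z (n + j - k) else 0 := by
  have : (coord n).comp (c.tri (unit j) (unit k)) =
      (if k ≤ n + j then c.coef j k (n + j - k) else 0) • coord (n + j - k) := by
    refine clm_ext fun m => ?_
    simp only [ContinuousLinearMap.comp_apply, smul_apply, coord_apply,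
      tri_unit, smul_apply', unit_apply, smul_eq_mul]
    -- Here the truncated difference `k + m - j` is 0 and would hit index 0 wrongly; the field
    -- `vanish` removes these terms.
    by_cases hv : k + m < j
    · rw [c.vanish _ _ _ hv]
      by_cases h1 : k ≤ n + j
      · by_cases h2 : n + j - k = m
        · rw [h2, c.vanish _ _ _ hv]; simp
        · simp [h2]
      · simp [h1]
    · by_cases hm : n = k + m - j
      · have h1 : k ≤ n + j := by omega
        have h2 : n + j - k = m := by omega
        simp [hm.symm, h1, h2]
      · by_cases h1 : k ≤ n + j
        · have h2 : n + j - k ≠ m := by omega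
          simp [hm, h2]
        · simp [hm, h1]
  have h := DFunLike.congr_fun this z
  simp only [ContinuousLinearMap.comp_apply, smul_apply, coord_apply,
    smul_eq_mul] at h
  rw [h]
  split_ifs <;> simp

theorem tri_unit_mid_apply (j l : ℕ) (y : SeqL1) (n : ℕ) :
    c.tri (unit j) y (unit l) n =
      if l ≤ n + j then c.coef j (n + j - l) l * y (n + j - l) else 0 := by
  have : (coord n).comp ((c.tri (unit j)).flip (unit l)) =
      (if l ≤ n + j then c.coef j (n + j - l) l else 0) • coord (n + j - l) := by
    refine clm_ext fun m => ?_
    simp only [ContinuousLinearMap.comp_apply, smul_apply, coord_apply,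
      ContinuousLinearMap.flip_apply, tri_unit, smul_apply', unit_apply, smul_eq_mul]
    by_cases hv : m + l < j
    · rw [c.vanish _ _ _ hv]
      by_cases h1 : l ≤ n + j
      · by_cases h2 : n + j - l = m
        · rw [h2, c.vanish _ _ _ hv]; simp
        · simp [h2]
      · simp [h1]
    · by_cases hm : n = m + l - j
      · have h1 : l ≤ n + j := by omega
        have h2 : n + j - l = m := by omega
        simp [hm.symm, h1, h2]
      · by_cases h1 : l ≤ n + j
        · have h2 : n + j - l ≠ m := by omega
          simp [hm, h2]
        · simp [hm, h1]
  have h := DFunLike.congr_fun this y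
  simp only [ContinuousLinearMap.comp_apply, smul_apply, coord_apply,
    ContinuousLinearMap.flip_apply, smul_eq_mul] at h
  rw [h]
  split_ifs <;> simp

theorem tri_mid_unit_unit_apply (k l : ℕ) (x : SeqL1) (n : ℕ) :
    c.tri x (unit k) (unit l) n =
      if n ≤ k + l then c.coef (k + l - n) k l * x (k + l - n) else 0 := by
  have : (coord n).comp ((c.tri.flip (unit k)).flip (unit l)) =
      (if n ≤ k + l then c.coef (k + l - n) k l else 0) • coord (k + l - n) := by
    refine clm_ext fun m => ?_
    simp only [ContinuousLinearMap.comp_apply, smul_apply, coord_apply,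
      ContinuousLinearMap.flip_apply, tri_unit, smul_apply', unit_apply, smul_eq_mul]
    by_cases hv : k + l < m
    · rw [c.vanish _ _ _ hv]
      by_cases h1 : n ≤ k + l
      · by_cases h2 : k + l - n = m
        · rw [h2, c.vanish _ _ _ hv]; simp
        · simp [h2]
      · simp [h1]
    · by_cases hm : n = k + l - m
      · have h1 : n ≤ k + l := by omega
        have h2 : k + l - n = m := by omega
        simp [hm.symm, h1, h2]
      · by_cases h1 : n ≤ k + l
        · have h2 : k + l - n ≠ m := by omega
          simp [hm, h2]
        · simp [hm, h1]
  have h := DFunLike.congr_fun this x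
  simp only [ContinuousLinearMap.comp_apply, smul_apply, coord_apply,
    ContinuousLinearMap.flip_apply, smul_eq_mul] at h
  rw [h]
  split_ifs <;> simp

/-- Coordinates of the trilinear form as a convergent series. -/
theorem hasSum_tri_apply (x y z : SeqL1) (n : ℕ) :
    HasSum (fun j => ∑ k ∈ Finset.range (n + j + 1),
      c.coef j k (n + j - k) * x j * y k * z (n + j - k)) (c.tri x y z n) := by
  have h1 := hasSum_map ((coord n).comp ((c.tri.flip y).flip z)) x
  simp only [ContinuousLinearMap.comp_apply, ContinuousLinearMap.flip_apply, coord_apply,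
    smul_eq_mul] at h1
  refine h1.congr_fun fun j => ?_
  have h2 := hasSum_map ((coord n).comp ((c.tri (unit j)).flip z)) y
  simp only [ContinuousLinearMap.comp_apply, ContinuousLinearMap.flip_apply, coord_apply,
    smul_eq_mul, tri_unit_unit_apply] at h2
  have h3 : HasSum (fun k => y k *
      if k ≤ n + j then c.coef j k (n + j - k) * z (n + j - k) else 0)
      (∑ k ∈ Finset.range (n + j + 1), y k *
        if k ≤ n + j then c.coef j k (n + j - k) * z (n + j - k) else 0) :=
    hasSum_sum_of_ne_finset_zero fun k hk => by
      rw [Finset.mem_range] at hk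
      rw [if_neg (by omega), mul_zero]
  rw [h2.unique h3, Finset.mul_sum]
  refine Finset.sum_congr rfl fun k hk => ?_
  rw [if_pos (by rw [Finset.mem_range] at hk; omega)]
  ring

theorem norm_toL2_tri_unit_unit_le (j k : ℕ) (z : SeqL1) :
    ‖toL2 (c.tri (unit j) (unit k) z)‖ ≤ ‖toL2 z‖ := by
  refine SeqL2.norm_le_of_injOn {n | k ≤ n + j} (fun n => n + j - k) ?_ ?_ ?_
  · intro a ha b hb hab
    simp only [Set.mem_ofPred_eq] at ha hb hab; omega
  · intro n hn
    simp only [Set.mem_ofPred_eq] at hn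
    rw [toL2_apply, toL2_apply, tri_unit_unit_apply, if_pos hn, abs_mul]
    exact mul_le_of_le_one_left (abs_nonneg _) (c.abs_le _ _ _)
  · intro n hn
    simp only [Set.mem_ofPred_eq] at hn
    rw [toL2_apply, tri_unit_unit_apply, if_neg hn]

theorem norm_toL2_tri_unit_mid_le (j l : ℕ) (y : SeqL1) :
    ‖toL2 (c.tri (unit j) y (unit l))‖ ≤ ‖toL2 y‖ := by
  refine SeqL2.norm_le_of_injOn {n | l ≤ n + j} (fun n => n + j - l) ?_ ?_ ?_
  · intro a ha b hb hab
    simp only [Set.mem_ofPred_eq] at ha hb hab; omega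
  · intro n hn
    simp only [Set.mem_ofPred_eq] at hn
    rw [toL2_apply, toL2_apply, tri_unit_mid_apply, if_pos hn, abs_mul]
    exact mul_le_of_le_one_left (abs_nonneg _) (c.abs_le _ _ _)
  · intro n hn
    simp only [Set.mem_ofPred_eq] at hn
    rw [toL2_apply, tri_unit_mid_apply, if_neg hn]

theorem norm_toL2_tri_mid_unit_unit_le (k l : ℕ) (x : SeqL1) :
    ‖toL2 (c.tri x (unit k) (unit l))‖ ≤ ‖toL2 x‖ := by
  refine SeqL2.norm_le_of_injOn {n | n ≤ k + l} (fun n => k + l - n) ?_ ?_ ?_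
  · intro a ha b hb hab
    simp only [Set.mem_ofPred_eq] at ha hb hab; omega
  · intro n hn
    simp only [Set.mem_ofPred_eq] at hn
    rw [toL2_apply, toL2_apply, tri_mid_unit_unit_apply, if_pos hn, abs_mul]
    exact mul_le_of_le_one_left (abs_nonneg _) (c.abs_le _ _ _)
  · intro n hn
    simp only [Set.mem_ofPred_eq] at hn
    rw [toL2_apply, tri_mid_unit_unit_apply, if_neg hn]

/-- Weighted injections of coordinates with weights at most 1 are `ℓ²` contractions. Summing over
the coordinate expansions of the other two arguments costs only their `ℓ¹` norms. The next two
lemmas put the `ℓ²` norm in the other slots. -/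
theorem norm_toL2_tri_le_right (x y z : SeqL1) :
    ‖toL2 (c.tri x y z)‖ ≤ ‖x‖ * ‖y‖ * ‖toL2 z‖ := by
  have h1 : ∀ j, ‖toL2 (c.tri (unit j) y z)‖ ≤ ‖toL2 z‖ * ‖y‖ := fun j =>
    norm_map_le (toL2.comp ((c.tri (unit j)).flip z))
      (fun k => c.norm_toL2_tri_unit_unit_le j k z) y
  have h2 := norm_map_le (toL2.comp ((c.tri.flip y).flip z)) h1 x
  calc _ ≤ _ := h2
    _ = _ := by ring

theorem norm_toL2_tri_le_mid (x y z : SeqL1) :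
    ‖toL2 (c.tri x y z)‖ ≤ ‖x‖ * ‖toL2 y‖ * ‖z‖ := by
  have h1 : ∀ j, ‖toL2 (c.tri (unit j) y z)‖ ≤ ‖toL2 y‖ * ‖z‖ := fun j =>
    norm_map_le (toL2.comp (c.tri (unit j) y))
      (fun k => c.norm_toL2_tri_unit_mid_le j k y) z
  have h2 := norm_map_le (toL2.comp ((c.tri.flip y).flip z)) h1 x
  calc _ ≤ _ := h2
    _ = _ := by ring

theorem norm_toL2_tri_le_left (x y z : SeqL1) :
    ‖toL2 (c.tri x y z)‖ ≤ ‖toL2 x‖ * ‖y‖ * ‖z‖ := by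
  have h1 : ∀ k, ‖toL2 (c.tri x (unit k) z)‖ ≤ ‖toL2 x‖ * ‖z‖ := fun k =>
    norm_map_le (toL2.comp (c.tri x (unit k)))
      (fun l => c.norm_toL2_tri_mid_unit_unit_le k l x) z
  have h2 := norm_map_le (toL2.comp ((c.tri x).flip z)) h1 y
  calc _ ≤ _ := h2
    _ = _ := by ring

end Kernel

end ConformalFlow

/-! ### The cubic nonlinearity, and the passage from `ℓ²` to `ℓ¹`. -/

namespace ConformalFlow

open Filter Topology SeqL1

set_option maxSynthPendingDepth 4

theorem interaction_le (n j k l : ℕ) : interaction n j k l ≤ (n : ℝ) + 1 := by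
  unfold interaction
  exact_mod_cast Nat.add_le_add_right ((min_le_left _ _).trans (min_le_left _ _)) 1

theorem interaction_nonneg (n j k l : ℕ) : 0 ≤ interaction n j k l := Nat.cast_nonneg _

/-- The coefficients `S_{njkl} / (n + 1)`, `n = k + l - j`. -/
noncomputable def fullKernel : Kernel where
  coef j k l := if k + l < j then 0 else
    interaction (k + l - j) j k l / (((k + l - j : ℕ) : ℝ) + 1)
  abs_le j k l := by
    split_ifs
    · simp
    · rw [abs_of_nonneg (div_nonneg (interaction_nonneg _ _ _ _) (by positivity)),
        div_le_one (by positivity)]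
      exact interaction_le _ _ _ _
  vanish j k l h := if_pos h

theorem fullKernel_coef (n j k : ℕ) (h : k ≤ n + j) :
    fullKernel.coef j k (n + j - k) = interaction n j k (n + j - k) / ((n : ℝ) + 1) := by
  have h1 : ¬ k + (n + j - k) < j := by omega
  have h2 : k + (n + j - k) - j = n := by omega
  simp [fullKernel, h1, h2]

/-- The cubic nonlinearity, divided by `n + 1`. -/
noncomputable def cubic (x : SeqL1) : SeqL1 := fullKernel.tri x x x

theorem hasSum_cubic (x : SeqL1) (n : ℕ) :
    HasSum (fun j : ℕ => ∑ k ∈ Finset.range (n + j + 1),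
      interaction n j k (n + j - k) * x j * x k * x (n + j - k))
      (((n : ℝ) + 1) * cubic x n) := by
  refine ((fullKernel.hasSum_tri_apply x x x n).mul_left ((n : ℝ) + 1)).congr_fun fun j => ?_
  rw [Finset.mul_sum]
  refine Finset.sum_congr rfl fun k hk => ?_
  rw [fullKernel_coef n j k (by rw [Finset.mem_range] at hk; omega)]
  have : (n : ℝ) + 1 ≠ 0 := by positivity
  field_simp

/-- The equations of a stationary state for a summable sequence. -/
def Solves (lam ω : ℝ) (x : SeqL1) : Prop := ∀ n : ℕ, (lam - n * ω) * x n = cubic x n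

theorem IsStationary.solves {lam ω : ℝ} {x : SeqL1} (h : IsStationary lam ω (toL2 x)) :
    Solves lam ω x := fun n => by
  have h1 := h.2 n
  simp only [toL2_apply] at h1
  have h2 := h1.unique (hasSum_cubic x n)
  have : (n : ℝ) + 1 ≠ 0 := by positivity
  rw [mul_assoc] at h2
  exact mul_left_cancel₀ this h2

theorem Solves.isStationary {lam ω : ℝ} (hω : ω ≠ 0) {x : SeqL1} (h : Solves lam ω x) :
    IsStationary lam ω (toL2 x) := by
  refine ⟨?_, fun n => ?_⟩
  -- Finite energy is automatic: solving the equation for `n x_n` shows that `(n+1) x_n` is the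
  -- sequence written here, which is summable and so square-summable. This needs `ω ≠ 0`.
  · refine (toL2 ((lam / ω + 1) • x - ω⁻¹ • cubic x)).hasSum_sq.summable.congr fun n => ?_
    rw [toL2_apply, toL2_apply, sub_apply', smul_apply', smul_apply', ← h n, ← mul_pow]
    congr 1
    field_simp
    ring
  · simp only [toL2_apply]
    rw [mul_assoc, h n]
    exact hasSum_cubic x n

theorem IsStationary.exists_toL2 {lam ω : ℝ} {A : SeqL2} (h : IsStationary lam ω A) :
    ∃ x : SeqL1, A = toL2 x := by
  have h2 : Summable fun n : ℕ => 1 / ((n : ℝ) + 1) ^ 2 := by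
    have := (summable_nat_add_iff 1).2 (Real.summable_one_div_nat_pow.2 one_lt_two)
    simpa using this
  have hs : Summable fun n => |A n| := by
    refine Summable.of_nonneg_of_le (fun n => abs_nonneg _) (fun n => ?_)
      ((h.1.add h2).div_const 2)
    have hn : (0 : ℝ) < (n : ℝ) + 1 := by positivity
    have h3 := two_mul_le_add_sq (((n : ℝ) + 1) * |A n|) (1 / ((n : ℝ) + 1))
    rw [mul_pow, sq_abs, div_pow, one_pow] at h3
    have h4 : 2 * (((n : ℝ) + 1) * |A n|) * (1 / ((n : ℝ) + 1)) = 2 * |A n| := by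
      field_simp
    linarith
  exact ⟨ofSummable A hs, by ext n; simp⟩

theorem solves_unit (N : ℕ) (ω : ℝ) : Solves (1 + N * ω) ω (unit N) := fun n => by
  have h : fullKernel.coef N N N = 1 := by
    have : (N : ℝ) + 1 ≠ 0 := by positivity
    simp [fullKernel, interaction, this]
  simp only [cubic, fullKernel.tri_unit, h, one_smul, Nat.add_sub_cancel, unit_apply]
  by_cases hn : n = N
  · subst hn; simp
  · simp [hn]

/-- Since `t² + (n+1)² ≥ (t+n+1)²/2`, each term is at most `2/((t+n)(t+n+1))`, which telescopes. -/
theorem sum_inv_sq_add_sq_le {t : ℝ} (ht : 0 < t) (M : ℕ) :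
    ∑ n ∈ Finset.range M, 1 / (t ^ 2 + ((n : ℝ) + 1) ^ 2) ≤ 2 / t := by
  have key : ∀ M : ℕ, ∑ n ∈ Finset.range M, 1 / (t ^ 2 + ((n : ℝ) + 1) ^ 2)
      ≤ 2 / t - 2 / (t + M) := by
    intro M
    induction M with
    | zero => simp
    | succ M ih =>
      rw [Finset.sum_range_succ]
      have h1 : 1 / (t ^ 2 + ((M : ℝ) + 1) ^ 2) ≤ 2 / (t + M) - 2 / (t + (M + 1 : ℕ)) := by
        have : 2 / (t + M) - 2 / (t + (M + 1 : ℕ)) = 2 / ((t + M) * (t + M + 1)) := by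
          push_cast
          field_simp
          ring
        rw [this, div_le_div_iff₀ (by positivity) (by positivity)]
        nlinarith [sq_nonneg (t - (M + 1)), Nat.cast_nonneg (α := ℝ) M]
      linarith
  have : 0 ≤ 2 / (t + M) := by positivity
  linarith [key M]

/-- A discrete Carlson inequality. -/
theorem norm_sq_le_of_weighted (x : SeqL1) {t Y : ℝ} (ht : 0 < t)
    (hY : ∀ M, ∑ n ∈ Finset.range M, ((n : ℝ) + 1) ^ 2 * x n ^ 2 ≤ Y) :
    ‖x‖ ^ 2 ≤ 2 / t * (t ^ 2 * ‖toL2 x‖ ^ 2 + Y) := by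
  have h1 : Tendsto (fun M => (∑ n ∈ Finset.range M, |x n|) ^ 2) atTop (𝓝 (‖x‖ ^ 2)) :=
    x.hasSum_abs.tendsto_sum_nat.pow 2
  refine le_of_tendsto' h1 fun M => ?_
  have hY0 : 0 ≤ Y := by simpa using hY 0
  -- Cauchy–Schwarz with the weight `t² + (n+1)²`; the parameter `t` stays free so that it can
  -- balance the plain and the weighted norm.
  calc (∑ n ∈ Finset.range M, |x n|) ^ 2
      ≤ (∑ n ∈ Finset.range M, 1 / (t ^ 2 + ((n : ℝ) + 1) ^ 2)) *
        ∑ n ∈ Finset.range M, (t ^ 2 + ((n : ℝ) + 1) ^ 2) * x n ^ 2 := by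
        refine Finset.sum_sq_le_sum_mul_sum_of_sq_le_mul _ (fun _ _ => by positivity)
          (fun _ _ => by positivity) fun n _ => ?_
        rw [sq_abs]
        have : t ^ 2 + ((n : ℝ) + 1) ^ 2 ≠ 0 := by positivity
        refine le_of_eq ?_
        field_simp
    _ ≤ 2 / t * (t ^ 2 * ‖toL2 x‖ ^ 2 + Y) := by
        refine mul_le_mul (sum_inv_sq_add_sq_le ht M) ?_
          (Finset.sum_nonneg fun _ _ => by positivity) (by positivity)
        simp only [add_mul, Finset.sum_add_distrib]
        refine add_le_add ?_ (hY M)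
        rw [← Finset.mul_sum]
        refine mul_le_mul_of_nonneg_left ?_ (by positivity)
        have := (toL2 x).hasSum_sq
        simp only [toL2_apply] at this
        exact sum_le_hasSum _ (fun _ _ => sq_nonneg _) this

/-- The equation expresses `(n+1) a_n`, where `a = x - e_N`, through `a_n` and the difference of the
cubic terms, whose `ℓ²` norm is linear in that of `a`. Carlson's inequality turns this gain of one
weight into an `ℓ¹` bound that is only linear in `1 + ‖a‖`, so it closes when the `ℓ²` norm is
small. The bound `ω ≥ 1/20` covers neighbourhoods of both `1/6` and `1/12`. -/
theorem norm_le_mul_of_solves (N : ℕ) : ∃ C > 0, ∀ (ω : ℝ) (x : SeqL1), 1 / 20 ≤ ω →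
    Solves (1 + N * ω) ω x →
    ‖x - unit N‖ ≤ C * ‖toL2 (x - unit N)‖ * (1 + ‖x - unit N‖) := by
  -- `ω⁻¹ ≤ 20` gives `N + 21` and `800 = 2·20²`; then `7200 = 800·3²`, the 3 coming from the three
  -- slots of the cubic term.
  set K : ℝ := Real.sqrt (2 * ((N : ℝ) + 21) ^ 2 + 7200) with hK
  have hKpos : 0 < K := Real.sqrt_pos.2 (by positivity)
  have hKsq : K ^ 2 = 2 * ((N : ℝ) + 21) ^ 2 + 7200 := Real.sq_sqrt (by positivity)
  refine ⟨2 * Real.sqrt K, by positivity, fun ω x hω hx => ?_⟩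
  set a := x - unit N with ha
  set X := ‖a‖ with hX
  set α := ‖toL2 a‖ with hα
  have hX0 : 0 ≤ X := norm_nonneg _
  have hα0 : 0 ≤ α := norm_nonneg _
  set d := cubic x - cubic (unit N) with hd
  have hda : ∀ n : ℕ, (1 + N * ω - n * ω) * a n = d n := fun n => by
    rw [ha, hd, sub_apply', sub_apply', mul_sub, hx n, solves_unit N ω n]
  have hxnorm : ‖x‖ ≤ 1 + X := by
    have : x = unit N + a := by rw [ha]; abel
    rw [this]
    exact (norm_add_le _ _).trans (by rw [norm_unit])
  have hdsum : d = fullKernel.tri a x x + fullKernel.tri (unit N) a x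
      + fullKernel.tri (unit N) (unit N) a := by
    simp only [hd, ha, cubic, map_sub, sub_apply]
    abel
  have hdnorm : ‖toL2 d‖ ≤ 3 * α * (1 + X) ^ 2 := by
    rw [hdsum, map_add, map_add]
    have h1 := fullKernel.norm_toL2_tri_le_left a x x
    have h2 := fullKernel.norm_toL2_tri_le_mid (unit N) a x
    have h3 := fullKernel.norm_toL2_tri_le_right (unit N) (unit N) a
    rw [norm_unit] at h2 h3
    have h4 : ‖x‖ * ‖x‖ ≤ (1 + X) * (1 + X) :=
      mul_le_mul hxnorm hxnorm (norm_nonneg _) (by positivity)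
    have h5 : α * (‖x‖ * ‖x‖) ≤ α * ((1 + X) * (1 + X)) := mul_le_mul_of_nonneg_left h4 hα0
    have h6 : α * ‖x‖ ≤ α * (1 + X) := mul_le_mul_of_nonneg_left hxnorm hα0
    have h7 : 0 ≤ α * X := mul_nonneg hα0 hX0
    have h8 : 0 ≤ α * X * X := mul_nonneg h7 hX0
    refine (norm_add₃_le ..).trans ?_
    nlinarith
  have hpt : ∀ n : ℕ, (((n : ℝ) + 1) * a n) ^ 2
      ≤ 2 * ((N : ℝ) + 21) ^ 2 * a n ^ 2 + 800 * d n ^ 2 := by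
    intro n
    have hω0 : 0 < ω := by linarith
    set w := ω⁻¹ with hw
    have hw1 : w * ω = 1 := inv_mul_cancel₀ hω0.ne'
    have hw0 : 0 < w := inv_pos.2 hω0
    have hw20 : w ≤ 20 := by nlinarith
    -- The equation `(1 + (N - n)ω) a_n = d_n` divided by `ω`.
    have e1 : ((n : ℝ) + 1) * a n = (N + 1 + w) * a n - w * d n := by
      rw [← hda n]
      linear_combination ((N : ℝ) - n) * a n * hw1
    rw [e1]
    have hN : (0 : ℝ) ≤ N := Nat.cast_nonneg _
    have f1 : ((N + 1 + w) * a n - w * d n) ^ 2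
        ≤ 2 * ((N + 1 + w) ^ 2 * a n ^ 2) + 2 * (w ^ 2 * d n ^ 2) := by
      nlinarith [sq_nonneg ((N + 1 + w) * a n + w * d n)]
    have f2 : (N + 1 + w) ^ 2 ≤ ((N : ℝ) + 21) ^ 2 := by
      apply pow_le_pow_left₀ (by positivity); linarith
    have f3 : w ^ 2 ≤ 400 := by nlinarith
    have f4 := mul_le_mul_of_nonneg_right f2 (sq_nonneg (a n))
    have f5 := mul_le_mul_of_nonneg_right f3 (sq_nonneg (d n))
    linarith
  have hsum : ∀ M, ∑ n ∈ Finset.range M, ((n : ℝ) + 1) ^ 2 * a n ^ 2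
      ≤ (K * (1 + X) ^ 2) ^ 2 * α ^ 2 := by
    intro M
    have s1 := (toL2 a).hasSum_sq
    have s2 := (toL2 d).hasSum_sq
    simp only [toL2_apply] at s1 s2
    have s3 : ∑ n ∈ Finset.range M, a n ^ 2 ≤ α ^ 2 := sum_le_hasSum _ (fun _ _ => sq_nonneg _) s1
    have s4 : ∑ n ∈ Finset.range M, d n ^ 2 ≤ ‖toL2 d‖ ^ 2 :=
      sum_le_hasSum _ (fun _ _ => sq_nonneg _) s2
    have s5 : ‖toL2 d‖ ^ 2 ≤ (3 * α * (1 + X) ^ 2) ^ 2 :=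
      pow_le_pow_left₀ (norm_nonneg _) hdnorm 2
    calc ∑ n ∈ Finset.range M, ((n : ℝ) + 1) ^ 2 * a n ^ 2
        ≤ ∑ n ∈ Finset.range M, (2 * ((N : ℝ) + 21) ^ 2 * a n ^ 2 + 800 * d n ^ 2) :=
          Finset.sum_le_sum fun n _ => by rw [← mul_pow]; exact hpt n
      _ = 2 * ((N : ℝ) + 21) ^ 2 * ∑ n ∈ Finset.range M, a n ^ 2
          + 800 * ∑ n ∈ Finset.range M, d n ^ 2 := by
          rw [Finset.sum_add_distrib, Finset.mul_sum, Finset.mul_sum]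
      _ ≤ 2 * ((N : ℝ) + 21) ^ 2 * α ^ 2 + 800 * (3 * α * (1 + X) ^ 2) ^ 2 := by
          gcongr
          exact s4.trans s5
      _ ≤ (K * (1 + X) ^ 2) ^ 2 * α ^ 2 := by
          have h1 : (1 : ℝ) ≤ ((1 + X) ^ 2) ^ 2 := by
            have : (1 : ℝ) ≤ 1 + X := by linarith
            exact one_le_pow₀ (one_le_pow₀ this)
          have h2 : 2 * ((N : ℝ) + 21) ^ 2 * α ^ 2 * 1
              ≤ 2 * ((N : ℝ) + 21) ^ 2 * α ^ 2 * ((1 + X) ^ 2) ^ 2 :=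
            mul_le_mul_of_nonneg_left h1 (by positivity)
          rw [mul_pow K, hKsq]
          linarith
  have ht : 0 < K * (1 + X) ^ 2 := by positivity
  -- With `t = K(1+X)²` both terms of Carlson's inequality equal `t²α²`, and the bound becomes `X² ≤
  -- 4tα²`.
  have hmain := norm_sq_le_of_weighted a ht hsum
  have hfin : X ^ 2 ≤ (2 * Real.sqrt K * α * (1 + X)) ^ 2 := by
    refine hmain.trans (le_of_eq ?_)
    have hs : (2 * Real.sqrt K * α * (1 + X)) ^ 2 = 4 * K * α ^ 2 * (1 + X) ^ 2 := by
      linear_combination 4 * α ^ 2 * (1 + X) ^ 2 * Real.sq_sqrt hKpos.le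
    rw [hs, ← hα]
    field_simp
    ring
  exact le_of_sq_le_sq hfin (by positivity)

/-- Near a single-mode state, the `ℓ²` distance controls the `ℓ¹` distance of a solution. -/
theorem norm_le_norm_toL2_of_solves (N : ℕ) : ∃ C > 0, ∃ η > 0, ∀ (ω : ℝ) (x : SeqL1), 1 / 20 ≤ ω →
    Solves (1 + N * ω) ω x → ‖toL2 (x - unit N)‖ < η →
    ‖x - unit N‖ ≤ C * ‖toL2 (x - unit N)‖ := by
  obtain ⟨C, hC, h⟩ := norm_le_mul_of_solves N
  refine ⟨2 * C, by positivity, 1 / (2 * C), by positivity, fun ω x hω hx hη => ?_⟩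
  have h1 := h ω x hω hx
  have h2 : C * ‖toL2 (x - unit N)‖ ≤ 1 / 2 := by
    rw [lt_div_iff₀ (by positivity)] at hη
    linarith
  nlinarith [norm_nonneg (x - unit N), mul_le_mul_of_nonneg_right h2 (norm_nonneg (x - unit N))]

/-! ### Absence of even entries near the second eigenmode. -/

theorem Kernel.tri_apply_eq_zero (c : Kernel) {x y z : SeqL1} {n : ℕ}
    (h : ∀ j k l, k + l = n + j → x j ≠ 0 → y k ≠ 0 → z l ≠ 0 → c.coef j k l = 0) :
    c.tri x y z n = 0 := by
  refine (c.hasSum_tri_apply x y z n).unique ?_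
  convert hasSum_zero with j
  refine Finset.sum_eq_zero fun k hk => ?_
  rw [Finset.mem_range] at hk
  by_cases h1 : x j = 0
  · simp [h1]
  by_cases h2 : y k = 0
  · simp [h2]
  by_cases h3 : z (n + j - k) = 0
  · simp [h3]
  rw [h j k (n + j - k) (by omega) h1 h2 h3]
  simp

namespace SeqL1

/-- Restriction of a sequence to a set of indices. -/
noncomputable def restr (s : Set ℕ) : SeqL1 →L[ℝ] SeqL1 :=
  diag (s.indicator 1) 1 fun n => by by_cases h : n ∈ s <;> simp [h]

theorem restr_apply_mem {s : Set ℕ} {n : ℕ} (h : n ∈ s) (x : SeqL1) : restr s x n = x n := by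
  simp [restr, diag_apply, h]

theorem restr_apply_notMem {s : Set ℕ} {n : ℕ} (h : n ∉ s) (x : SeqL1) : restr s x n = 0 := by
  simp [restr, diag_apply, h]

theorem norm_restr_le (s : Set ℕ) (x : SeqL1) : ‖restr s x‖ ≤ ‖x‖ :=
  norm_le_of_abs_le fun n => by
    by_cases h : n ∈ s
    · rw [restr_apply_mem h]
    · rw [restr_apply_notMem h, abs_zero]; exact abs_nonneg _

end SeqL1

/-- The derivative of the cubic nonlinearity. -/
noncomputable def cubicDeriv (e h : SeqL1) : SeqL1 :=
  fullKernel.tri h e e + fullKernel.tri e h e + fullKernel.tri e e h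

/-- After expansion, every remaining product contains `P` and a factor of size `O(δ)`; the six terms
contribute `6 + 2 + 3 + 2 + 2 + 1 = 16`. The derivative is taken at `e` rather than at `Q`, so that
explicit eigenvalues can be used. -/
theorem norm_cubic_add_sub_le {e Q P : SeqL1} {δ : ℝ} (he : ‖e‖ ≤ 1) (hQ : ‖Q - e‖ ≤ δ)
    (hP : ‖P‖ ≤ δ) (hδ : δ ≤ 1) :
    ‖cubic (Q + P) - cubic Q - cubicDeriv e P‖ ≤ 16 * δ * ‖P‖ := by
  set v := Q - e with hv
  have hQe : Q = e + v := by rw [hv]; abel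
  have hδ0 : 0 ≤ δ := (norm_nonneg _).trans hQ
  have hid : cubic (Q + P) - cubic Q - cubicDeriv e P =
      fullKernel.tri P (v + P) (e + v + P) + fullKernel.tri P e (v + P) +
      (fullKernel.tri v P (e + v + P) + fullKernel.tri e P (v + P)) +
      (fullKernel.tri v (e + v) P + fullKernel.tri e v P) := by
    rw [hQe]
    simp only [cubic, cubicDeriv, map_add, add_apply]
    abel
  rw [hid]
  have n1 : ‖v + P‖ ≤ 2 * δ := (norm_add_le _ _).trans (by linarith)
  have n2 : ‖e + v + P‖ ≤ 3 := (norm_add₃_le ..).trans (by linarith)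
  have n3 : ‖e + v‖ ≤ 2 := (norm_add_le _ _).trans (by linarith)
  have t : ∀ (a b d : SeqL1) (A B D : ℝ), ‖a‖ ≤ A → ‖b‖ ≤ B → ‖d‖ ≤ D →
      ‖fullKernel.tri a b d‖ ≤ A * B * D := fun a b d A B D ha hb hd =>
    (fullKernel.norm_tri_le a b d).trans (by
      have := norm_nonneg a; have := norm_nonneg b; have := norm_nonneg d
      gcongr
      · exact mul_nonneg (by linarith) (by linarith)
      · linarith)
  have h1 := t _ _ _ _ _ _ (le_refl ‖P‖) n1 n2
  have h2 := t _ _ _ _ _ _ (le_refl ‖P‖) he n1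
  have h3 := t _ _ _ _ _ _ hQ (le_refl ‖P‖) n2
  have h4 := t _ _ _ _ _ _ he (le_refl ‖P‖) n1
  have h5 := t _ _ _ _ _ _ hQ n3 (le_refl ‖P‖)
  have h6 := t _ _ _ _ _ _ he hQ (le_refl ‖P‖)
  refine (norm_add₃_le ..).trans ?_
  have g1 := norm_add_le (fullKernel.tri P (v + P) (e + v + P)) (fullKernel.tri P e (v + P))
  have g2 := norm_add_le (fullKernel.tri v P (e + v + P)) (fullKernel.tri e P (v + P))
  have g3 := norm_add_le (fullKernel.tri v (e + v) P) (fullKernel.tri e v P)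
  linarith

theorem fullKernel_coef_eq (n j k l : ℕ) (h : k + l = n + j) :
    fullKernel.coef j k l = interaction n j k l / ((n : ℝ) + 1) := by
  have h1 : l = n + j - k := by omega
  rw [h1, fullKernel_coef n j k (by omega)]

/-- At `e_1` the term with the perturbation in the first slot sends index `n` to `2 - n`. Hence the
entries 0 and 2 form a coupled block, while from index 3 on the linearization is diagonal. -/
theorem cubicDeriv_unit_one_apply_zero (h : SeqL1) :
    cubicDeriv (unit 1) h 0 = 2 * h 0 + h 2 := by
  simp only [cubicDeriv, add_apply', fullKernel.tri_mid_unit_unit_apply,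
    fullKernel.tri_unit_mid_apply, fullKernel.tri_unit_unit_apply]
  norm_num [fullKernel, interaction]
  ring

theorem cubicDeriv_unit_one_apply_two (h : SeqL1) :
    cubicDeriv (unit 1) h 2 = 4 / 3 * h 2 + h 0 / 3 := by
  simp only [cubicDeriv, add_apply', fullKernel.tri_mid_unit_unit_apply,
    fullKernel.tri_unit_mid_apply, fullKernel.tri_unit_unit_apply]
  norm_num [fullKernel, interaction]
  ring

theorem cubicDeriv_unit_one_apply {n : ℕ} (hn : 3 ≤ n) (h : SeqL1) :
    cubicDeriv (unit 1) h n = 4 / ((n : ℝ) + 1) * h n := by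
  have h1 : ¬ n ≤ 1 + 1 := by omega
  have h2 : 1 ≤ n + 1 := by omega
  simp only [cubicDeriv, add_apply', fullKernel.tri_mid_unit_unit_apply,
    fullKernel.tri_unit_mid_apply, fullKernel.tri_unit_unit_apply, h1, h2, if_true, if_false,
    Nat.add_sub_cancel]
  rw [fullKernel_coef_eq n 1 n 1 rfl, fullKernel_coef_eq n 1 1 n (by omega)]
  have h3 : min (min n 1) (min n 1) = 1 := by omega
  have h4 : min (min n 1) (min 1 n) = 1 := by omega
  simp only [interaction, h3, h4]
  push_cast
  ring

/-- At `ω = 1/12` the coefficient is `-(n-5)(n-7)/(12(n+1))`. Its zeros 5 and 7 are odd; the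
critical even index is 6, the only one with a positive value, namely `1/84`. -/
theorem linear_coefficient_lower_bound {n : ℕ} (hn : 4 ≤ n) (he : n % 2 = 0) {ω : ℝ}
    (hω : |ω - 1 / 12| < 1 / 2000) :
    1 / 200 ≤ |1 + ω - n * ω - 4 / ((n : ℝ) + 1)| := by
  rw [abs_lt] at hω
  have hn1 : (0 : ℝ) < (n : ℝ) + 1 := by positivity
  rcases Nat.lt_or_ge n 8 with h | h
  · have : n = 4 ∨ n = 6 := by omega
    rcases this with rfl | rfl
    · rw [abs_of_neg] <;> norm_num <;> linarith
    · rw [abs_of_pos] <;> norm_num <;> linarith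
  · have h8 : (8 : ℝ) ≤ n := by exact_mod_cast h
    have key : 1 + ω - n * ω - 4 / ((n : ℝ) + 1) ≤ -(1 / 200) := by
      have e : 1 + ω - n * ω - 4 / ((n : ℝ) + 1)
          = ((n - 3) - (n ^ 2 - 1) * ω) / ((n : ℝ) + 1) := by
        field_simp
        ring
      rw [e, div_le_iff₀ hn1]
      nlinarith
    rw [abs_of_neg (by linarith)]
    linarith

/-- Solutions near the second single-mode state at `ω ≈ 1/12` have no even entries. -/
theorem Solves.apply_even_eq_zero {ω : ℝ} {x : SeqL1} (hω : |ω - 1 / 12| < 1 / 2000)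
    (hx : Solves (1 + ω) ω x) (hx1 : ‖x - unit 1‖ < 1 / 10000) {n : ℕ} (hn : n % 2 = 0) :
    x n = 0 := by
  set s : Set ℕ := {n | n % 2 = 0} with hs
  have hmem : ∀ m, m ∈ s ↔ m % 2 = 0 := fun m => Iff.rfl
  set P := restr s x with hP
  set Q := x - P with hQ
  have hQodd : ∀ m, m % 2 = 0 → Q m = 0 := fun m hm => by
    rw [hQ, sub_apply', hP, restr_apply_mem ((hmem m).2 hm), sub_self]
  have hxQP : x = Q + P := by rw [hQ]; abel
  set a := x - unit 1 with ha
  have hPa : P = restr s a := by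
    rw [ha, map_sub, hP]
    ext m
    by_cases hm : m ∈ s
    · have : m ≠ 1 := by rw [hmem] at hm; omega
      simp [restr_apply_mem hm, unit_apply, this]
    · simp [restr_apply_notMem hm]
  have hPnorm : ‖P‖ ≤ ‖a‖ := hPa ▸ norm_restr_le s a
  have hQnorm : ‖Q - unit 1‖ ≤ ‖a‖ := by
    have : Q - unit 1 = a - P := by rw [hQ, ha]; abel
    rw [this, hPa]
    refine norm_le_of_abs_le fun m => ?_
    by_cases hm : m ∈ s
    · simp [restr_apply_mem hm]
    · simp [restr_apply_notMem hm]
  set r := cubic (Q + P) - cubic Q - cubicDeriv (unit 1) P with hr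
  have hrnorm : ‖r‖ ≤ 16 * ‖a‖ * ‖P‖ :=
    norm_cubic_add_sub_le (norm_unit 1).le hQnorm hPnorm (by linarith)
  -- If `j`, `k`, `l` are odd, so is `k + l - j`; the odd part therefore creates no even entries.
  have hQcubic : ∀ m, m % 2 = 0 → cubic Q m = 0 := fun m hm => by
    refine fullKernel.tri_apply_eq_zero fun j k l hjkl hj hk hl => ?_
    exfalso
    have h1 : j % 2 ≠ 0 := fun h => hj (hQodd j h)
    have h2 : k % 2 ≠ 0 := fun h => hk (hQodd k h)
    have h3 : l % 2 ≠ 0 := fun h => hl (hQodd l h)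
    omega
  have heq : ∀ m, m % 2 = 0 → (1 + ω - m * ω) * P m = r m + cubicDeriv (unit 1) P m := by
    intro m hm
    have h1 := hx m
    rw [hP, restr_apply_mem ((hmem m).2 hm), h1, hr, sub_apply', sub_apply', hQcubic m hm, ← hxQP]
    ring
  have hP0 : |P 0| + |P 2| ≤ 100 * ‖r‖ := by
    have e0 := heq 0 rfl
    have e2 := heq 2 rfl
    rw [cubicDeriv_unit_one_apply_zero] at e0
    rw [cubicDeriv_unit_one_apply_two] at e2
    have b0 := abs_le.1 (r.abs_apply_le 0)
    have b2 := abs_le.1 (r.abs_apply_le 2)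
    push_cast at e0 e2
    rw [abs_lt] at hω
    have hωpos : 0 < ω := by linarith
    -- Elimination of `P 2` from the block of entries 0 and 2; up to sign, the left factor is its
    -- determinant.
    have hc : ω * (2 / 3 - ω) * P 0 = r 2 - (1 / 3 + ω) * r 0 := by
      linear_combination e2 - (1 / 3 + ω) * e0
    have hc0 : 1 / 25 ≤ ω * (2 / 3 - ω) := by nlinarith
    have hP0 : |P 0| ≤ 36 * ‖r‖ := by
      have h1 : |ω * (2 / 3 - ω) * P 0| ≤ 1.42 * ‖r‖ := by
        rw [hc, abs_le]
        constructor <;> nlinarith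
      rw [abs_mul, abs_of_pos (by linarith)] at h1
      nlinarith [abs_nonneg (P 0)]
    have hP2 : |P 2| ≤ |P 0| + ‖r‖ := by
      have h1 : P 2 = (ω - 1) * P 0 - r 0 := by linear_combination -e0
      rw [h1]
      refine (abs_sub _ _).trans (add_le_add ?_ (r.abs_apply_le 0))
      rw [abs_mul]
      exact mul_le_of_le_one_left (abs_nonneg _) (by rw [abs_le]; constructor <;> linarith)
    linarith [norm_nonneg r]
  have hPtail : ‖P - P 0 • unit 0 - P 2 • unit 2‖ ≤ 200 * ‖r‖ := by
    refine norm_le_mul_of_abs_le fun m => ?_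
    simp only [sub_apply', smul_apply', unit_apply]
    by_cases h0 : m = 0
    · subst h0; simp
    by_cases h2 : m = 2
    · subst h2; simp
    simp only [h0, h2, if_false, mul_zero, sub_zero]
    by_cases hm : m % 2 = 0
    · have h3 : 4 ≤ m := by omega
      have h4 := heq m hm
      rw [cubicDeriv_unit_one_apply (by omega)] at h4
      have h5 : r m = (1 + ω - m * ω - 4 / ((m : ℝ) + 1)) * P m := by linear_combination -h4
      rw [h5, abs_mul]
      nlinarith [linear_coefficient_lower_bound h3 hm hω, abs_nonneg (P m)]
    · rw [hP, restr_apply_notMem (fun h => hm ((hmem m).1 h)), abs_zero]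
      positivity
  have hPle : ‖P‖ ≤ 300 * ‖r‖ := by
    have h1 : P = (P - P 0 • unit 0 - P 2 • unit 2) + P 0 • unit 0 + P 2 • unit 2 := by abel
    calc ‖P‖ = ‖(P - P 0 • unit 0 - P 2 • unit 2) + P 0 • unit 0 + P 2 • unit 2‖ := by rw [← h1]
      _ ≤ _ := norm_add₃_le ..
      _ ≤ 300 * ‖r‖ := by
        rw [norm_smul, norm_smul, norm_unit, norm_unit, Real.norm_eq_abs, Real.norm_eq_abs]
        linarith
  -- `‖P‖ ≤ 300·16·‖a‖·‖P‖` with `300·16/10000 < 1`.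
  have hPzero : ‖P‖ = 0 := by
    have h0 := norm_nonneg P
    nlinarith [norm_nonneg a]
  have : P = 0 := norm_eq_zero.1 hPzero
  rw [← restr_apply_mem ((hmem n).2 hn) x, ← hP, this]
  rfl

/-! ### The map `u(z) ↦ z u(z²)` -/

namespace SeqL1

/-- The map `u(z) ↦ z u(z²)` on summable sequences. -/
noncomputable def oddLift : SeqL1 →L[ℝ] SeqL1 :=
  lift (fun n => unit (2 * n + 1)) 1 fun _ => (norm_unit _).le

theorem oddLift_apply (x : SeqL1) (n : ℕ) :
    oddLift x n = if n % 2 = 1 then x (n / 2) else 0 := by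
  have : (coord n).comp oddLift = (if n % 2 = 1 then (1 : ℝ) else 0) • coord (n / 2) := by
    refine clm_ext fun m => ?_
    simp only [oddLift, ContinuousLinearMap.comp_apply, lift_unit, coord_apply, smul_apply,
      unit_apply, smul_eq_mul]
    by_cases h : n = 2 * m + 1
    · have h1 : n % 2 = 1 := by omega
      have h2 : n / 2 = m := by omega
      simp [h, Nat.add_mod, show (2 * m + 1) / 2 = m by omega]
    · by_cases h1 : n % 2 = 1
      · have h2 : n / 2 ≠ m := by omega
        simp [h, h1, h2]
      · simp [h, h1]
  have h := DFunLike.congr_fun this x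
  simp only [ContinuousLinearMap.comp_apply, coord_apply, smul_apply, smul_eq_mul] at h
  rw [h]
  split_ifs <;> simp

theorem toL2_oddLift (x : SeqL1) : toL2 (oddLift x) = zLift (toL2 x) := by
  ext n
  rw [toL2_apply, oddLift_apply]
  change _ = if n % 2 = 1 then toL2 x (n / 2) else (0 : ℝ)
  rw [toL2_apply]

/-- Under `n ↦ 2n + 1` the relation `k + l = n + j` is preserved, and both `min + 1` and `n + 1`
double, so the quotient that forms the kernel is unchanged. The identity is checked on coordinate
vectors and extended slot by slot. -/
theorem cubic_oddLift (x : SeqL1) : cubic (oddLift x) = oddLift (cubic x) := by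
  have hu : ∀ j k l, fullKernel.tri (oddLift (unit j)) (oddLift (unit k)) (oddLift (unit l)) =
      oddLift (fullKernel.tri (unit j) (unit k) (unit l)) := by
    intro j k l
    simp only [oddLift, lift_unit, fullKernel.tri_unit, map_smul]
    by_cases h : k + l < j
    · rw [fullKernel.vanish _ _ _ h, fullKernel.vanish _ _ _ (by omega), zero_smul, zero_smul]
    · obtain ⟨n, hn⟩ : ∃ n, k + l = n + j := ⟨k + l - j, by omega⟩
      rw [fullKernel_coef_eq n j k l hn, fullKernel_coef_eq (2 * n + 1) _ _ _ (by omega)]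
      have h1 : 2 * k + 1 + (2 * l + 1) - (2 * j + 1) = 2 * (k + l - j) + 1 := by omega
      rw [h1]
      congr 1
      have h2 : min (min (2 * n + 1) (2 * j + 1)) (min (2 * k + 1) (2 * l + 1)) =
          2 * min (min n j) (min k l) + 1 := by omega
      simp only [interaction, h2]
      push_cast
      field_simp
      ring
  have h1 : ∀ j k z, fullKernel.tri (oddLift (unit j)) (oddLift (unit k)) (oddLift z) =
      oddLift (fullKernel.tri (unit j) (unit k) z) := fun j k z =>
    DFunLike.congr_fun (clm_ext (T := (fullKernel.tri (oddLift (unit j)) (oddLift (unit k))).comp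
      oddLift) (S := oddLift.comp (fullKernel.tri (unit j) (unit k))) fun l => hu j k l) z
  have h2 : ∀ j y z, fullKernel.tri (oddLift (unit j)) (oddLift y) (oddLift z) =
      oddLift (fullKernel.tri (unit j) y z) := fun j y z =>
    DFunLike.congr_fun (clm_ext (T := ((fullKernel.tri (oddLift (unit j))).flip (oddLift z)).comp
      oddLift) (S := oddLift.comp ((fullKernel.tri (unit j)).flip z)) fun k => h1 j k z) y
  exact DFunLike.congr_fun (clm_ext
    (T := ((fullKernel.tri.flip (oddLift x)).flip (oddLift x)).comp oddLift)
    (S := oddLift.comp ((fullKernel.tri.flip x).flip x)) fun j => h2 j x x) x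

/-- The reflection `x_n ↦ (-1)^n x_n`. -/
noncomputable def alternate : SeqL1 →L[ℝ] SeqL1 :=
  diag (fun n => (-1) ^ n) 1 fun n => by simp

theorem alternate_apply (x : SeqL1) (n : ℕ) : alternate x n = (-1) ^ n * x n := diag_apply _ _ _ _ _

theorem toL2_alternate (x : SeqL1) : toL2 (alternate x) = reflect 0 (toL2 x) := by
  ext n
  rw [toL2_apply, alternate_apply]
  change _ = (-1 : ℝ) ^ (n / (0 + 1)) * toL2 x n
  rw [toL2_apply, zero_add, Nat.div_one]

theorem cubic_alternate_apply (x : SeqL1) (n : ℕ) :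
    cubic (alternate x) n = (-1) ^ n * cubic x n := by
  refine (fullKernel.hasSum_tri_apply (alternate x) (alternate x) (alternate x) n).unique ?_
  refine ((fullKernel.hasSum_tri_apply x x x n).mul_left ((-1) ^ n)).congr_fun fun j => ?_
  rw [Finset.mul_sum]
  refine Finset.sum_congr rfl fun k hk => ?_
  rw [Finset.mem_range] at hk
  have h : (-1 : ℝ) ^ n = (-1) ^ j * (-1) ^ k * (-1) ^ (n + j - k) := by
    rw [mul_assoc, ← pow_add, show k + (n + j - k) = n + j by omega, pow_add, mul_comm, mul_assoc,
      ← mul_pow]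
    simp
  rw [alternate_apply, alternate_apply, alternate_apply, h]
  ring

end SeqL1

theorem Solves.alternate {lam ω : ℝ} {x : SeqL1} (h : Solves lam ω x) :
    Solves lam ω (alternate x) := fun n => by
  rw [cubic_alternate_apply, alternate_apply, ← h n]
  ring

/-- At index `2n + 1` the linear factor is `1 + ω/2 - (2n+1)ω/2 = 1 - nω`, which explains the halved
frequency. -/
theorem solves_oddLift_iff {ω : ℝ} {x : SeqL1} :
    Solves (1 + ω / 2) (ω / 2) (oddLift x) ↔ Solves 1 ω x := by
  constructor
  · intro h n
    have h1 := h (2 * n + 1)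
    rw [cubic_oddLift, oddLift_apply, oddLift_apply, if_pos (by omega), if_pos (by omega),
      show (2 * n + 1) / 2 = n by omega] at h1
    rw [← h1]
    push_cast
    ring
  · intro h n
    rw [cubic_oddLift, oddLift_apply, oddLift_apply]
    split_ifs with hn
    · rw [← h (n / 2)]
      have : (n : ℝ) = 2 * ((n / 2 : ℕ) : ℝ) + 1 := by
        exact_mod_cast (by omega : n = 2 * (n / 2) + 1)
      rw [this]
      ring
    · simp

theorem exists_oddLift_eq {x : SeqL1} (h : ∀ n, n % 2 = 0 → x n = 0) : ∃ y, x = oddLift y := by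
  have hinj : Function.Injective fun n : ℕ => 2 * n + 1 := fun a b hab => by
    simp only at hab; omega
  refine ⟨ofSummable (fun n => x (2 * n + 1)) (x.summable_abs.comp_injective hinj), ?_⟩
  ext n
  rw [oddLift_apply]
  split_ifs with hn
  · rw [ofSummable_apply, show 2 * (n / 2) + 1 = n by omega]
  · exact h n (by omega)

/-! ### Properties of the maps on `ℓ²` -/

theorem zLift_apply (A : SeqL2) (n : ℕ) : zLift A n = if n % 2 = 1 then A (n / 2) else 0 := rfl

theorem reflect_apply (N : ℕ) (A : SeqL2) (n : ℕ) :
    reflect N A n = (-1 : ℝ) ^ (n / (N + 1)) * A n := rfl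

theorem reflect_one_zLift (A : SeqL2) : reflect 1 (zLift A) = zLift (reflect 0 A) := by
  ext n
  rw [reflect_apply, zLift_apply, zLift_apply, reflect_apply]
  split_ifs <;> simp

/-- The map `u(z) ↦ z u(z²)` as a continuous linear map. -/
noncomputable def zLiftL : SeqL2 →L[ℝ] SeqL2 :=
  LinearMap.mkContinuous
    { toFun := zLift
      map_add' := fun A B => by
        ext n
        change zLift (A + B) n = zLift A n + zLift B n
        simp only [zLift_apply]
        split_ifs <;> simp
      map_smul' := fun c A => by
        ext n
        change zLift (c • A) n = c * zLift A n
        simp only [zLift_apply]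
        split_ifs <;> simp } 1 fun A => by
    rw [one_mul]
    refine SeqL2.norm_le_of_injOn {n | n % 2 = 1} (fun n => n / 2) ?_ ?_ ?_
    · intro a ha b hb hab
      simp only [Set.mem_ofPred_eq] at ha hb hab; omega
    · intro n hn
      change |zLift A n| ≤ _
      have hn' : n % 2 = 1 := hn
      rw [zLift_apply, if_pos hn']
    · intro n hn
      exact if_neg hn

theorem zLift_mode_zero : zLift (mode 0) = mode 1 := by
  ext n
  rw [zLift_apply, mode_apply, mode_apply]
  by_cases h : n % 2 = 1
  · by_cases h1 : n = 1
    · simp [h1]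
    · simp [h, h1]; omega
  · have : n ≠ 1 := by omega
    simp [h, this]

theorem norm_sub_mode_zero_le (A : SeqL2) : ‖A - mode 0‖ ≤ ‖zLift A - mode 1‖ := by
  refine SeqL2.norm_le_of_injOn Set.univ (fun n => 2 * n + 1) (fun a _ b _ hab => by
    simp only at hab; omega) (fun n _ => ?_) fun n hn => absurd (Set.mem_univ n) hn
  rw [SeqL2.sub_apply', SeqL2.sub_apply', zLift_apply, if_pos (by omega), mode_apply, mode_apply,
    show (2 * n + 1) / 2 = n by omega]
  simp

/-! ### The linearization at the lowest eigenmode. -/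

theorem cubicDeriv_unit_zero_apply_zero (h : SeqL1) : cubicDeriv (unit 0) h 0 = 3 * h 0 := by
  simp only [cubicDeriv, add_apply', fullKernel.tri_mid_unit_unit_apply,
    fullKernel.tri_unit_mid_apply, fullKernel.tri_unit_unit_apply]
  norm_num [fullKernel, interaction]
  ring

theorem cubicDeriv_unit_zero_apply {n : ℕ} (hn : n ≠ 0) (h : SeqL1) :
    cubicDeriv (unit 0) h n = 2 / ((n : ℝ) + 1) * h n := by
  have h1 : ¬ n ≤ 0 + 0 := by omega
  simp only [cubicDeriv, add_apply', fullKernel.tri_mid_unit_unit_apply,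
    fullKernel.tri_unit_mid_apply, fullKernel.tri_unit_unit_apply, h1, if_false, Nat.zero_le,
    if_true, Nat.add_zero, Nat.sub_zero]
  rw [fullKernel_coef_eq n 0 n 0 rfl, fullKernel_coef_eq n 0 0 n (by omega)]
  simp only [interaction, Nat.min_zero, Nat.zero_min]
  push_cast
  ring

/-- The eigenvalues of the linearization at the lowest single-mode state. -/
noncomputable def eigenvalue (ω : ℝ) (n : ℕ) : ℝ :=
  if n = 0 then -2 else 1 - n * ω - 2 / ((n : ℝ) + 1)

theorem linear_sub_cubicDeriv (ω : ℝ) (h : SeqL1) (n : ℕ) :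
    (1 - n * ω) * h n - cubicDeriv (unit 0) h n = eigenvalue ω n * h n := by
  by_cases hn : n = 0
  · subst hn
    rw [cubicDeriv_unit_zero_apply_zero]
    simp [eigenvalue]
    ring
  · rw [cubicDeriv_unit_zero_apply hn, eigenvalue, if_neg hn]
    ring

/-- At `ω = 1/6` the eigenvalue for `n ≥ 1` is `-(n-2)(n-3)/(6(n+1))`, so the smallest modulus off
the kernel is `1/15`, at `n = 4`; half of it survives the perturbation of `ω`. -/
theorem le_abs_eigenvalue {ω : ℝ} (hω : |ω - 1 / 6| < 1 / 1000) {n : ℕ} (h2 : n ≠ 2)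
    (h3 : n ≠ 3) : 1 / 30 ≤ |eigenvalue ω n| := by
  rw [abs_lt] at hω
  unfold eigenvalue
  split_ifs with h0
  · norm_num
  by_cases h1 : n = 1
  · subst h1
    rw [abs_of_neg] <;> norm_num <;> linarith
  have h4 : (4 : ℝ) ≤ n := by exact_mod_cast (by omega : 4 ≤ n)
  have hn1 : (0 : ℝ) < (n : ℝ) + 1 := by positivity
  have key : 1 - n * ω - 2 / ((n : ℝ) + 1) ≤ -(1 / 30) := by
    have e : 1 - n * ω - 2 / ((n : ℝ) + 1) = ((n - 1) - n * (n + 1) * ω) / ((n : ℝ) + 1) := by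
      field_simp
      ring
    rw [e, div_le_iff₀ hn1]
    have h5 : (n : ℝ) * (n + 1) * (33 / 200) ≤ n * (n + 1) * ω :=
      mul_le_mul_of_nonneg_left (by linarith) (by positivity)
    nlinarith
  rw [abs_of_neg (by linarith)]
  linarith

/-- Solutions near the lowest single-mode state are determined by `ω` and by the entries with
indices `2` and `3`; the equations with these two indices are not needed. -/
theorem eq_of_solves_off_kernel {ω : ℝ} {x y : SeqL1} (hω : |ω - 1 / 6| < 1 / 1000)
    (hx : ‖x - unit 0‖ < 1 / 2000) (hy : ‖y - unit 0‖ < 1 / 2000)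
    (hxs : ∀ n : ℕ, n ≠ 2 → n ≠ 3 → (1 - n * ω) * x n = cubic x n)
    (hys : ∀ n : ℕ, n ≠ 2 → n ≠ 3 → (1 - n * ω) * y n = cubic y n)
    (h2 : x 2 = y 2) (h3 : x 3 = y 3) : x = y := by
  set P := x - y with hP
  have hxy : x = y + P := by rw [hP]; abel
  have hPnorm : ‖P‖ ≤ 1 / 1000 := by
    have : P = (x - unit 0) - (y - unit 0) := by rw [hP]; abel
    rw [this]
    exact (norm_sub_le _ _).trans (by linarith)
  set r := cubic (y + P) - cubic y - cubicDeriv (unit 0) P with hr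
  have hrn : ‖r‖ ≤ 16 * (1 / 1000) * ‖P‖ :=
    norm_cubic_add_sub_le (norm_unit 0).le (by linarith) hPnorm (by norm_num)
  have hPr : ‖P‖ ≤ 30 * ‖r‖ := by
    refine norm_le_mul_of_abs_le fun n => ?_
    by_cases hn2 : n = 2
    · subst hn2
      rw [hP, sub_apply', h2, sub_self, abs_zero]; positivity
    by_cases hn3 : n = 3
    · subst hn3
      rw [hP, sub_apply', h3, sub_self, abs_zero]; positivity
    have h4 : r n = eigenvalue ω n * P n := by
      rw [← linear_sub_cubicDeriv, hr, sub_apply', sub_apply', ← hxy, ← hxs n hn2 hn3,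
        ← hys n hn2 hn3, hP, sub_apply']
      ring
    rw [h4, abs_mul]
    nlinarith [le_abs_eigenvalue hω hn2 hn3, abs_nonneg (P n)]
  -- The two bounds combine to `‖P‖ ≤ 30·(16/1000)·‖P‖`, a factor below 1.
  have : ‖P‖ = 0 := by nlinarith [norm_nonneg P]
  exact sub_eq_zero.1 (norm_eq_zero.1 this)

/-- No quadratic resonance: two indices from `{2, 3}` have sums 4, 5, 6 and differences at most 1,
so together with mode 0 they never feed equations 2 and 3. -/
theorem tri_unit_zero_pair_apply (ε μ : ℝ) {n : ℕ} (hn : n = 2 ∨ n = 3) :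
    fullKernel.tri (unit 0) (ε • unit 2 + μ • unit 3) (ε • unit 2 + μ • unit 3) n = 0 ∧
    fullKernel.tri (ε • unit 2 + μ • unit 3) (unit 0) (ε • unit 2 + μ • unit 3) n = 0 ∧
    fullKernel.tri (ε • unit 2 + μ • unit 3) (ε • unit 2 + μ • unit 3) (unit 0) n = 0 := by
  rcases hn with rfl | rfl <;>
  simp [fullKernel.tri_unit, unit_apply]

set_option maxHeartbeats 800000 in
/-- Near `ω = 1/6`, a solution close to the lowest single-mode state is quadratically close to its
linear approximation. -/
theorem Solves.quadratic_estimate {ω : ℝ} {x : SeqL1} (hω : |ω - 1 / 6| < 1 / 1000)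
    (hx : Solves 1 ω x) (hx0 : ‖x - unit 0‖ ≤ 1 / 1000) :
    ‖x - unit 0 - x 2 • unit 2 - x 3 • unit 3‖ ≤ 4000 * (x 2 ^ 2 + x 3 ^ 2) ∧
    ((x 2 ≠ 0 ∨ x 3 ≠ 0) → |ω - 1 / 6| ≤ 36000 * (x 2 ^ 2 + x 3 ^ 2)) := by
  set a := x - unit 0 with ha
  set v := x 2 • unit 2 + x 3 • unit 3 with hv
  set w := a - v with hw
  set ρ := |x 2| + |x 3| with hρ
  have hρ0 : 0 ≤ ρ := by positivity
  have hρsq : ρ ^ 2 ≤ 2 * (x 2 ^ 2 + x 3 ^ 2) := by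
    rw [← sq_abs (x 2), ← sq_abs (x 3)]
    nlinarith [sq_nonneg (|x 2| - |x 3|)]
  have hvn : ‖v‖ ≤ ρ := by
    refine (norm_add_le _ _).trans (le_of_eq ?_)
    rw [norm_smul, norm_smul, norm_unit, norm_unit, mul_one, mul_one]
    rfl
  have hav : a = v + w := by rw [hw]; abel
  have hxa : x = unit 0 + a := by rw [ha]; abel
  set Q := cubic (unit 0 + a) - cubic (unit 0) - cubicDeriv (unit 0) a with hQ
  have hQn : ‖Q‖ ≤ 16 * ‖a‖ * ‖a‖ :=
    norm_cubic_add_sub_le (norm_unit 0).le (by simp) le_rfl (by linarith)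
  have hQeq : ∀ n, eigenvalue ω n * a n = Q n := fun n => by
    have h0 := solves_unit 0 ω n
    have h1 := hx n
    rw [← linear_sub_cubicDeriv, hQ, ← hxa]
    simp only [sub_apply', ← h1, ← h0, ha]
    push_cast
    ring
  have ha2 : a 2 = x 2 := by simp [ha, unit_apply]
  have ha3 : a 3 = x 3 := by simp [ha, unit_apply]
  have hwQ : ‖w‖ ≤ 30 * ‖Q‖ := by
    refine norm_le_mul_of_abs_le fun n => ?_
    by_cases hn2 : n = 2
    · subst hn2
      simp [hw, hv, ha2, unit_apply]
    by_cases hn3 : n = 3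
    · subst hn3
      simp [hw, hv, ha3, unit_apply]
    have h4 : w n = a n := by simp [hw, hv, unit_apply, hn2, hn3]
    rw [h4, ← hQeq n, abs_mul]
    nlinarith [le_abs_eigenvalue hω hn2 hn3, abs_nonneg (a n)]
  -- From `‖a‖ ≤ ρ + 30·16·‖a‖²` and `‖a‖ ≤ 1/1000`, the quadratic term is absorbed on the left.
  have han : ‖a‖ ≤ 2 * ρ := by
    have h1 : ‖a‖ ≤ ‖v‖ + ‖w‖ := by
      calc ‖a‖ = ‖v + w‖ := by rw [← hav]
        _ ≤ _ := norm_add_le _ _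
    nlinarith [norm_nonneg a]
  have hwn : ‖w‖ ≤ 1920 * ρ ^ 2 := by nlinarith [norm_nonneg a]
  have hwx : x - unit 0 - x 2 • unit 2 - x 3 • unit 3 = w := by rw [hw, hv, ha]; abel
  refine ⟨?_, fun hne => ?_⟩
  · have : a - x 2 • unit 2 - x 3 • unit 3 = w := hwx
    rw [this]
    have : 0 ≤ x 2 ^ 2 + x 3 ^ 2 := by positivity
    linarith
  have hρpos : 0 < ρ := by
    rcases hne with h | h
    · have := abs_pos.2 h; positivity
    · have := abs_pos.2 h; positivity
  -- The purely quadratic part in the kernel component `v` has no entries 2 and 3. Each remaining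
  -- term contains the quadratically small `w`, or is cubic in `a`.
  have hQ23 : ∀ n, n = 2 ∨ n = 3 → |Q n| ≤ 20000 * ρ ^ 3 := by
    intro n hn
    obtain ⟨z1, z2, z3⟩ := tri_unit_zero_pair_apply (x 2) (x 3) hn
    have hid : Q = fullKernel.tri (unit 0) w a + fullKernel.tri (unit 0) v w +
        (fullKernel.tri w (unit 0) a + fullKernel.tri v (unit 0) w) +
        (fullKernel.tri w a (unit 0) + fullKernel.tri v w (unit 0)) + fullKernel.tri a a a +
        (fullKernel.tri (unit 0) v v + fullKernel.tri v (unit 0) v +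
          fullKernel.tri v v (unit 0)) := by
      rw [hQ, hav]
      simp only [cubic, cubicDeriv, map_add, add_apply]
      abel
    set R := fullKernel.tri (unit 0) w a + fullKernel.tri (unit 0) v w +
        (fullKernel.tri w (unit 0) a + fullKernel.tri v (unit 0) w) +
        (fullKernel.tri w a (unit 0) + fullKernel.tri v w (unit 0)) + fullKernel.tri a a a with hR
    have hQR : Q n = R n := by
      rw [hid]
      simp only [add_apply', hv, z1, z2, z3]
      ring
    rw [hQR]
    refine (R.abs_apply_le n).trans ?_
    have hw0 := norm_nonneg w
    have ha0 := norm_nonneg a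
    have hv0 := norm_nonneg v
    have t1 := fullKernel.norm_tri_le (unit 0) w a
    have t2 := fullKernel.norm_tri_le (unit 0) v w
    have t3 := fullKernel.norm_tri_le w (unit 0) a
    have t4 := fullKernel.norm_tri_le v (unit 0) w
    have t5 := fullKernel.norm_tri_le w a (unit 0)
    have t6 := fullKernel.norm_tri_le v w (unit 0)
    have t7 := fullKernel.norm_tri_le a a a
    simp only [norm_unit, one_mul, mul_one] at t1 t2 t3 t4 t5 t6
    have p1 : ‖w‖ * ‖a‖ ≤ 1920 * ρ ^ 2 * (2 * ρ) := mul_le_mul hwn han ha0 (by positivity)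
    have p2 : ‖v‖ * ‖w‖ ≤ ρ * (1920 * ρ ^ 2) := mul_le_mul hvn hwn hw0 hρ0
    have p3 : ‖a‖ * ‖a‖ * ‖a‖ ≤ 2 * ρ * (2 * ρ) * (2 * ρ) :=
      mul_le_mul (mul_le_mul han han ha0 (by positivity)) han ha0 (by positivity)
    have hsum : ‖R‖ ≤ 3 * (‖w‖ * ‖a‖) + 3 * (‖v‖ * ‖w‖) + ‖a‖ * ‖a‖ * ‖a‖ := by
      have g := norm_add_le
        (fullKernel.tri (unit 0) w a + fullKernel.tri (unit 0) v w +
        (fullKernel.tri w (unit 0) a + fullKernel.tri v (unit 0) w) +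
        (fullKernel.tri w a (unit 0) + fullKernel.tri v w (unit 0))) (fullKernel.tri a a a)
      have g0 := norm_add₃_le (a := fullKernel.tri (unit 0) w a + fullKernel.tri (unit 0) v w)
        (b := fullKernel.tri w (unit 0) a + fullKernel.tri v (unit 0) w)
        (c := fullKernel.tri w a (unit 0) + fullKernel.tri v w (unit 0))
      have g1 := norm_add_le (fullKernel.tri (unit 0) w a) (fullKernel.tri (unit 0) v w)
      have g2 := norm_add_le (fullKernel.tri w (unit 0) a) (fullKernel.tri v (unit 0) w)
      have g3 := norm_add_le (fullKernel.tri w a (unit 0)) (fullKernel.tri v w (unit 0))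
      linarith
    have : 0 ≤ ρ ^ 3 := by positivity
    linarith
  have e2 : |ω - 1 / 6| * |x 2| ≤ 10000 * ρ ^ 3 := by
    have h1 : Q 2 = -2 * ((ω - 1 / 6) * x 2) := by
      rw [← hQeq 2, ha2, eigenvalue]
      norm_num
      ring
    have h2 := hQ23 2 (Or.inl rfl)
    rw [h1, abs_mul, abs_mul, abs_neg, abs_of_pos (by norm_num : (0 : ℝ) < 2)] at h2
    linarith
  have e3 : |ω - 1 / 6| * |x 3| ≤ 8000 * ρ ^ 3 := by
    have h1 : Q 3 = -3 * ((ω - 1 / 6) * x 3) := by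
      rw [← hQeq 3, ha3, eigenvalue]
      norm_num
      ring
    have h2 := hQ23 3 (Or.inr rfl)
    rw [h1, abs_mul, abs_mul, abs_neg, abs_of_pos (by norm_num : (0 : ℝ) < 3)] at h2
    have : 0 ≤ ρ ^ 3 := by positivity
    linarith
  -- The eigenvalues with indices 2 and 3 are `-2Ω` and `-3Ω`, so equations 2 and 3 bound `Ω` times
  -- the amplitudes. Division by `ρ > 0` needs a nonzero amplitude.
  have h5 : |ω - 1 / 6| * ρ ≤ 18000 * ρ ^ 2 * ρ := by
    rw [hρ, mul_add, ← hρ]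
    linarith
  have h6 := le_of_mul_le_mul_right h5 hρpos
  linarith

end ConformalFlow

/-! ### Analytic implicit functions; here `ω` as a smoothness order means analyticity, and `ω - 1/6`
is a separate parameter. -/

namespace ConformalFlow

open Filter Topology SeqL1
open scoped ContDiff

set_option maxSynthPendingDepth 4

/-- The analytic implicit function theorem, with an error estimate for approximate solutions. -/
theorem exists_analytic_implicit {P Y Z : Type*} [NormedAddCommGroup P] [NormedSpace ℝ P]
    [CompleteSpace P] [NormedAddCommGroup Y] [NormedSpace ℝ Y] [CompleteSpace Y]
    [NormedAddCommGroup Z] [NormedSpace ℝ Z] [CompleteSpace Z]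
    {f : P × Y → Z} {p₀ : P} {y₀ : Y} (hf : ContDiffAt ℝ ω f (p₀, y₀)) (h0 : f (p₀, y₀) = 0)
    (D : Y ≃L[ℝ] Z) (hD : ∀ h, fderiv ℝ f (p₀, y₀) (0, h) = D h) :
    ∃ X : P → Y, ∃ r > 0, ∃ L > 0, X p₀ = y₀ ∧ ContDiffOn ℝ ω X (Metric.ball p₀ r) ∧
      (∀ p ∈ Metric.ball p₀ r, f (p, X p) = 0) ∧
      ∀ p ∈ Metric.ball p₀ r, ∀ y ∈ Metric.ball y₀ r, ‖y - X p‖ ≤ L * ‖f (p, y)‖ := by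
  have hDeq : (fderiv ℝ f (p₀, y₀)).comp (ContinuousLinearMap.inr ℝ P Y) = (D : Y →L[ℝ] Z) := by
    ext h
    exact hD h
  have hinv : ((fderiv ℝ f (p₀, y₀)).comp (ContinuousLinearMap.inr ℝ P Y)).IsInvertible := by
    rw [hDeq]
    exact ⟨D, rfl⟩
  have hω : (ω : WithTop ℕ∞) ≠ 0 := by simp
  set X := hf.implicitFunction hω hinv with hX
  have hX0 : X p₀ = y₀ := hf.implicitFunction_apply_self hω hinv
  have hXc : ContDiffAt ℝ ω X p₀ := hf.contDiffAt_implicitFunction hω hinv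
  have e1 : ∀ᶠ p in 𝓝 p₀, ContDiffAt ℝ ω X p := hXc.eventually (by simp)
  have e2 : ∀ᶠ p in 𝓝 p₀, f (p, X p) = 0 := by
    have := hf.eventually_apply_implicitFunction hω hinv
    rwa [h0] at this
  obtain ⟨c, hc, hcD⟩ : ∃ c > 0, ∀ h, c * ‖h‖ ≤ ‖D h‖ := by
    refine ⟨(‖(D.symm : Z →L[ℝ] Y)‖ + 1)⁻¹, by positivity, fun h => ?_⟩
    rw [inv_mul_le_iff₀ (by positivity)]
    calc ‖h‖ = ‖(D.symm : Z →L[ℝ] Y) (D h)‖ := by simp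
      _ ≤ ‖(D.symm : Z →L[ℝ] Y)‖ * ‖D h‖ := ContinuousLinearMap.le_opNorm _ _
      _ ≤ _ := by gcongr; linarith
  -- Strict differentiability makes `f (p, y) - f (p, X p)` equal to `D (y - X p)` up to half of the
  -- lower bound of `D`. Besides local uniqueness of zeros this gives the quantitative estimate.
  have hs := (hf.hasStrictFDerivAt hω).isLittleO
  have e3 := hs.def (half_pos hc)
  rw [nhds_prod_eq] at e3
  obtain ⟨s, hs1, hs2⟩ := (eventually_prod_self_iff (r := fun u v =>
    ‖f u - f v - fderiv ℝ f (p₀, y₀) (u - v)‖ ≤ c / 2 * ‖u - v‖)).1 e3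
  obtain ⟨r₁, hr₁, hball⟩ := Metric.mem_nhds_iff.1 hs1
  have e4 : ∀ᶠ p in 𝓝 p₀, X p ∈ Metric.ball y₀ r₁ := by
    have := hXc.continuousAt.eventually_mem (Metric.ball_mem_nhds (X p₀) hr₁)
    rwa [hX0] at this
  obtain ⟨r₂, hr₂, hall⟩ := Metric.eventually_nhds_iff_ball.1 (e1.and (e2.and e4))
  refine ⟨X, min r₁ r₂, lt_min hr₁ hr₂, 2 / c, by positivity, hX0, fun p hp => ?_, fun p hp => ?_,
    fun p hp y hy => ?_⟩
  · exact (hall p (Metric.ball_subset_ball (min_le_right _ _) hp)).1.contDiffWithinAt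
  · exact (hall p (Metric.ball_subset_ball (min_le_right _ _) hp)).2.1
  · have hp2 := hall p (Metric.ball_subset_ball (min_le_right _ _) hp)
    have hp1 : p ∈ Metric.ball p₀ r₁ := Metric.ball_subset_ball (min_le_left _ _) hp
    have hy1 : y ∈ Metric.ball y₀ r₁ := Metric.ball_subset_ball (min_le_left _ _) hy
    have m1 : (p, y) ∈ s := hball (by rw [← ball_prod_same]; exact ⟨hp1, hy1⟩)
    have m2 : (p, X p) ∈ s := hball (by rw [← ball_prod_same]; exact ⟨hp1, hp2.2.2⟩)
    have h1 := hs2 (p, y) m1 (p, X p) m2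
    have h2 : ((p, y) : P × Y) - (p, X p) = (0, y - X p) := by simp
    rw [h2, hD, hp2.2.1, sub_zero, Prod.norm_mk, norm_zero, max_eq_right (norm_nonneg _)] at h1
    have h3 := hcD (y - X p)
    have h4 : ‖D (y - X p)‖ ≤ ‖f (p, y)‖ + ‖f (p, y) - D (y - X p)‖ := by
      have := norm_sub_le (f (p, y)) (f (p, y) - D (y - X p))
      rwa [sub_sub_cancel] at this
    rw [div_mul_eq_mul_div, le_div_iff₀ hc]
    linarith

/-! ### The scaled system -/

/-- The power of the amplitude of mode `2` that divides the entry with index `n`. -/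
def evenExp (n : ℕ) : ℕ := if 3 ∣ n then 0 else 1

/-- The power of the amplitude of mode `3` that divides the entry with index `n`. -/
def oddExp (n : ℕ) : ℕ := n % 2

/-- Excess powers of the amplitude of mode `2` in a product of three entries. -/
def evenExcess (j k l : ℕ) : ℕ := evenExp j + evenExp k + evenExp l - evenExp (k + l - j)

/-- Half of the excess powers of the amplitude of mode `3` in a product of three entries. -/
def oddExcess (j k l : ℕ) : ℕ := (oddExp j + oddExp k + oddExp l - oddExp (k + l - j)) / 2

/-- The part of the interaction with given excess powers of the amplitudes. -/
noncomputable def scaledKernel (a b : ℕ) : Kernel where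
  coef j k l := if evenExcess j k l = a ∧ oddExcess j k l = b then fullKernel.coef j k l else 0
  abs_le j k l := by
    split_ifs
    · exact fullKernel.abs_le j k l
    · simp
  vanish j k l h := by rw [fullKernel.vanish _ _ _ h, ite_self]

/-- If 3 divides `j`, `k` and `l`, it divides `n`; the excess is therefore never negative, and the
truncated subtraction in its definition is exact. -/
theorem evenExp_add {j k l n : ℕ} (h : k + l = n + j) :
    evenExp j + evenExp k + evenExp l = evenExp n + evenExcess j k l ∧ evenExcess j k l < 4 := by
  have h1 : k + l - j = n := by omega
  simp only [evenExcess, h1, evenExp]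
  split_ifs <;> omega

/-- Parity of `j + k + l` and of `n` agree, so the excess is even. This is why only the square of
`μ` appears in the scaled system. -/
theorem oddExp_add {j k l n : ℕ} (h : k + l = n + j) :
    oddExp j + oddExp k + oddExp l = oddExp n + 2 * oddExcess j k l ∧ oddExcess j k l < 2 := by
  have h1 : k + l - j = n := by omega
  simp only [oddExcess, h1, oddExp]
  omega

/-- Multiplication of the entry with index `n` by the appropriate powers of the amplitudes. -/
noncomputable def amplitude (ε μ : ℝ) : SeqL1 →L[ℝ] SeqL1 :=
  ∑ a ∈ Finset.range 2, ∑ b ∈ Finset.range 2,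
    (ε ^ a * μ ^ b) • restr {n | evenExp n = a ∧ oddExp n = b}

theorem amplitude_apply (ε μ : ℝ) (x : SeqL1) (n : ℕ) :
    amplitude ε μ x n = ε ^ evenExp n * μ ^ oddExp n * x n := by
  have h : ∀ a b, restr {n | evenExp n = a ∧ oddExp n = b} x n =
      if evenExp n = a ∧ oddExp n = b then x n else 0 := by
    intro a b
    split_ifs with h
    · exact restr_apply_mem h x
    · exact restr_apply_notMem h x
  have h2 : evenExp n = 0 ∨ evenExp n = 1 := by unfold evenExp; split_ifs <;> simp
  have h3 : oddExp n = 0 ∨ oddExp n = 1 := by unfold oddExp; omega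
  simp only [amplitude, Finset.sum_range_succ, Finset.sum_range_zero, zero_add,
    add_apply, smul_apply, add_apply', smul_apply', h]
  rcases h2 with h2 | h2 <;> rcases h3 with h3 | h3 <;> simp [h2, h3]

/-- The cubic nonlinearity in the scaled variables. -/
noncomputable def scaledCubic (ε ν : ℝ) (x : SeqL1) : SeqL1 :=
  ∑ a ∈ Finset.range 4, ∑ b ∈ Finset.range 2, (ε ^ a * ν ^ b) • (scaledKernel a b).tri x x x

theorem SeqL1.sum_apply' {ι : Type*} (s : Finset ι) (f : ι → SeqL1) (n : ℕ) :
    ((∑ i ∈ s, f i : SeqL1) : ℕ → ℝ) n = ∑ i ∈ s, f i n :=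
  map_sum (coord n) f s

/-- The powers belonging to index `n` factor out of every product. In particular equations 2 and 3
are divisible by `ε` and `μ`, also where these vanish. -/
theorem cubic_amplitude_apply (ε μ : ℝ) (x : SeqL1) (n : ℕ) :
    cubic (amplitude ε μ x) n = ε ^ evenExp n * μ ^ oddExp n * scaledCubic ε (μ ^ 2) x n := by
  refine (fullKernel.hasSum_tri_apply _ _ _ n).unique ?_
  have h := (hasSum_sum (s := Finset.range 4) fun a _ => hasSum_sum (s := Finset.range 2) fun b _ =>
    ((scaledKernel a b).hasSum_tri_apply x x x n).mul_left (ε ^ a * (μ ^ 2) ^ b)).mul_left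
      (ε ^ evenExp n * μ ^ oddExp n)
  have hv : scaledCubic ε (μ ^ 2) x n = ∑ a ∈ Finset.range 4, ∑ b ∈ Finset.range 2,
      ε ^ a * (μ ^ 2) ^ b * (scaledKernel a b).tri x x x n := by
    simp only [scaledCubic, SeqL1.sum_apply', smul_apply']
  rw [hv]
  refine h.congr_fun fun j => ?_
  have hswap : ∀ g : ℕ → ℕ → ℕ → ℝ,
      ∑ a ∈ Finset.range 4, ∑ b ∈ Finset.range 2, ε ^ a * (μ ^ 2) ^ b *
        ∑ k ∈ Finset.range (n + j + 1), g a b k =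
      ∑ k ∈ Finset.range (n + j + 1), ∑ a ∈ Finset.range 4, ∑ b ∈ Finset.range 2,
        ε ^ a * (μ ^ 2) ^ b * g a b k := by
    intro g
    simp only [Finset.mul_sum]
    rw [Finset.sum_comm]
    simp only [Finset.sum_range_succ, Finset.sum_range_zero, zero_add, Finset.sum_add_distrib]
    ring
  rw [hswap, Finset.mul_sum]
  refine Finset.sum_congr rfl fun k hk => ?_
  rw [Finset.mem_range] at hk
  obtain ⟨l, hl⟩ : ∃ l, n + j - k = l := ⟨_, rfl⟩
  have hkl : k + l = n + j := by omega
  rw [hl]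
  obtain ⟨h1, h2⟩ := evenExp_add hkl
  obtain ⟨h3, h4⟩ := oddExp_add hkl
  have hsum : ∑ a ∈ Finset.range 4, ∑ b ∈ Finset.range 2, ε ^ a * (μ ^ 2) ^ b *
      ((scaledKernel a b).coef j k l * x j * x k * x l) =
      ε ^ evenExcess j k l * (μ ^ 2) ^ oddExcess j k l *
        (fullKernel.coef j k l * x j * x k * x l) := by
    rw [Finset.sum_eq_single_of_mem _ (Finset.mem_range.2 h2),
      Finset.sum_eq_single_of_mem _ (Finset.mem_range.2 h4)]
    · simp [scaledKernel]
    · intro b _ hb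
      simp [scaledKernel, hb.symm]
    · intro a _ ha
      refine Finset.sum_eq_zero fun b _ => ?_
      simp [scaledKernel, ha.symm]
  rw [hsum, amplitude_apply, amplitude_apply, amplitude_apply]
  have e1 : ε ^ evenExp j * ε ^ evenExp k * ε ^ evenExp l =
      ε ^ evenExp n * ε ^ evenExcess j k l := by rw [← pow_add, ← pow_add, h1, pow_add]
  have e2 : μ ^ oddExp j * μ ^ oddExp k * μ ^ oddExp l =
      μ ^ oddExp n * (μ ^ 2) ^ oddExcess j k l := by
    rw [← pow_add, ← pow_add, h3, pow_add, pow_mul]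
  linear_combination (fullKernel.coef j k l * x j * x k * x l) *
    (ε ^ evenExp j * ε ^ evenExp k * ε ^ evenExp l * e2 +
      μ ^ oddExp n * (μ ^ 2) ^ oddExcess j k l * e1)

/-- The total number of amplitudes that divide the entry with index `n`. -/
def level (n : ℕ) : ℕ := evenExp n + oddExp n

/-- At vanishing amplitudes only products without excess survive, and for those the level of `n` is
the sum of the three levels. The form is thus graded by the level, which takes only the values 0, 1,
2. -/
theorem tri_zero_apply_eq_zero {x y z : SeqL1} {a b c n : ℕ} (hx : ∀ m, level m < a → x m = 0)
    (hy : ∀ m, level m < b → y m = 0) (hz : ∀ m, level m < c → z m = 0)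
    (hn : level n < a + b + c) : (scaledKernel 0 0).tri x y z n = 0 := by
  refine (scaledKernel 0 0).tri_apply_eq_zero fun j k l hjkl hj hk hl => ?_
  have h1 : a ≤ level j := not_lt.1 fun h => hj (hx j h)
  have h2 : b ≤ level k := not_lt.1 fun h => hk (hy k h)
  have h3 : c ≤ level l := not_lt.1 fun h => hl (hz l h)
  obtain ⟨h4, -⟩ := evenExp_add hjkl
  obtain ⟨h5, -⟩ := oddExp_add hjkl
  refine if_neg fun h => ?_
  unfold level at *
  omega

/-! ### The base point and the linearized reduced system. -/

/-- The solution of the scaled system at vanishing amplitudes. -/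
noncomputable def base : SeqL1 :=
  unit 0 + (-6 : ℝ) • unit 1 + unit 2 + unit 3 + (-2 : ℝ) • unit 5

/-- The derivative of the scaled nonlinearity at vanishing amplitudes. -/
noncomputable def scaledDeriv (e : SeqL1) : SeqL1 →L[ℝ] SeqL1 :=
  ((scaledKernel 0 0).tri.flip e).flip e + ((scaledKernel 0 0).tri e).flip e +
    (scaledKernel 0 0).tri e e

theorem scaledDeriv_apply (e h : SeqL1) : scaledDeriv e h = (scaledKernel 0 0).tri h e e +
    (scaledKernel 0 0).tri e h e + (scaledKernel 0 0).tri e e h := rfl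

theorem abs_inv_succ_le (n : ℕ) : |1 / ((n : ℝ) + 1)| ≤ 1 := by
  rw [abs_of_pos (by positivity), div_le_one (by positivity)]
  linarith [Nat.cast_nonneg (α := ℝ) n]

theorem abs_div_succ_le (n : ℕ) : |(n : ℝ) / ((n : ℝ) + 1)| ≤ 1 := by
  rw [abs_of_nonneg (by positivity), div_le_one (by positivity)]
  linarith

/-- Division of the entry with index `n` by `n + 1`. -/
noncomputable def divSucc : SeqL1 →L[ℝ] SeqL1 := diag (fun n => 1 / ((n : ℝ) + 1)) 1 abs_inv_succ_le

/-- Multiplication of the entry with index `n` by `n / (n + 1)`. -/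
noncomputable def mulDivSucc : SeqL1 →L[ℝ] SeqL1 :=
  diag (fun n => (n : ℝ) / ((n : ℝ) + 1)) 1 abs_div_succ_le

/-- The residual of the scaled system. The parameters are the amplitude of mode `2`, the square of
the amplitude of mode `3`, and `ω - 1/6`. -/
noncomputable def residual (p : ℝ × ℝ × ℝ) (x : SeqL1) : SeqL1 :=
  divSucc x - (1 / 6 + p.2.2) • mulDivSucc x - divSucc (scaledCubic p.1 p.2.1 x)

theorem residual_apply (p : ℝ × ℝ × ℝ) (x : SeqL1) (n : ℕ) : residual p x n =
    ((1 - n * (1 / 6 + p.2.2)) * x n - scaledCubic p.1 p.2.1 x n) / ((n : ℝ) + 1) := by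
  simp only [residual, divSucc, mulDivSucc, sub_apply', smul_apply', diag_apply]
  field_simp

theorem contDiff_residual :
    ContDiff ℝ ω fun q : (ℝ × ℝ × ℝ) × SeqL1 => residual q.1 q.2 := by
  have h1 : ContDiff ℝ ω fun q : (ℝ × ℝ × ℝ) × SeqL1 => 1 / 6 + q.1.2.2 := by fun_prop
  have h2 : ∀ a b : ℕ, ContDiff ℝ ω fun q : (ℝ × ℝ × ℝ) × SeqL1 => q.1.1 ^ a * q.1.2.1 ^ b :=
    fun a b => by fun_prop
  unfold residual scaledCubic
  refine ContDiff.sub (ContDiff.sub (divSucc.contDiff.comp contDiff_snd) ?_)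
    (divSucc.contDiff.comp ?_)
  · exact h1.smul (mulDivSucc.contDiff.comp contDiff_snd)
  refine ContDiff.sum fun a _ => ContDiff.sum fun b _ => ?_
  refine (h2 a b).smul ?_
  exact (((scaledKernel a b).tri.contDiff.comp contDiff_snd).clm_apply contDiff_snd).clm_apply
    contDiff_snd

theorem scaledCubic_zero_left (ν : ℝ) (x : SeqL1) : scaledCubic 0 ν x =
    (scaledKernel 0 0).tri x x x + ν • (scaledKernel 0 1).tri x x x := by
  simp [scaledCubic, Finset.sum_range_succ]

/-- Along a line in the state variable, and along a line in the parameters `(ν, Ω)` at `ε = 0`, the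
residual is such a polynomial; its derivative is the coefficient of `t`. -/
theorem hasDerivAt_cubic_polynomial {X : Type*} [NormedAddCommGroup X] [NormedSpace ℝ X]
    (a b c d : X) : HasDerivAt (fun t : ℝ => a + t • b + t ^ 2 • c + t ^ 3 • d) b 0 := by
  have h1 : HasDerivAt (fun t : ℝ => t • b) b 0 := by
    simpa using (hasDerivAt_id (0 : ℝ)).smul_const b
  have h2 : HasDerivAt (fun t : ℝ => t ^ 2 • c) 0 0 := by
    simpa using (hasDerivAt_pow 2 (0 : ℝ)).smul_const c
  have h3 : HasDerivAt (fun t : ℝ => t ^ 3 • d) 0 0 := by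
    simpa using (hasDerivAt_pow 3 (0 : ℝ)).smul_const d
  exact (((h1.const_add a).add h2).add h3).congr_deriv (by simp)

theorem fderiv_residual_state (h : SeqL1) :
    fderiv ℝ (fun q : (ℝ × ℝ × ℝ) × SeqL1 => residual q.1 q.2) (0, base) (0, h) =
      divSucc h - (1 / 6 : ℝ) • mulDivSucc h - divSucc (scaledDeriv base h) := by
  have h1 := ((contDiff_residual.differentiable (by simp) (0, base)).hasFDerivAt).hasLineDerivAt
    (0, h)
  refine HasDerivAt.unique h1 ?_
  convert hasDerivAt_cubic_polynomial (residual 0 base) _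
    (-divSucc ((scaledKernel 0 0).tri h h base + (scaledKernel 0 0).tri h base h +
      (scaledKernel 0 0).tri base h h)) (-divSucc ((scaledKernel 0 0).tri h h h)) using 1
  funext t
  have e : ((0, base) : (ℝ × ℝ × ℝ) × SeqL1) + t • (0, h) = (0, base + t • h) := by simp
  rw [e]
  simp only [residual, Prod.fst_zero, Prod.snd_zero, scaledCubic_zero_left, zero_smul, add_zero,
    scaledDeriv_apply, map_add, map_smul, add_apply, smul_apply]
  module

/-- The direction of `ε` is left out: `ε` is a parameter or zero on every branch, and is never
solved for. -/
theorem fderiv_residual_parameter (ν W : ℝ) :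
    fderiv ℝ (fun q : (ℝ × ℝ × ℝ) × SeqL1 => residual q.1 q.2) (0, base) ((0, ν, W), 0) =
      -(W • mulDivSucc base) - ν • divSucc ((scaledKernel 0 1).tri base base base) := by
  have h1 := ((contDiff_residual.differentiable (by simp) (0, base)).hasFDerivAt).hasLineDerivAt
    ((0, ν, W), 0)
  refine HasDerivAt.unique h1 ?_
  convert hasDerivAt_cubic_polynomial (residual 0 base) _ 0 0 using 1
  funext t
  have e : ((0, base) : (ℝ × ℝ × ℝ) × SeqL1) + t • ((0, ν, W), 0) = ((0, t * ν, t * W), base) := by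
    simp
  rw [e]
  simp only [residual, Prod.fst_zero, Prod.snd_zero, scaledCubic_zero_left, zero_smul, add_zero,
    map_add, map_smul, smul_zero]
  module

/-- The scaled system without the equations with indices `2` and `3`, which are replaced by the
normalization of the entries with these indices. -/
noncomputable def reducedSystem (q : (ℝ × ℝ × ℝ) × SeqL1) : SeqL1 :=
  restr {2, 3} (q.2 - (unit 2 + unit 3)) + restr {2, 3}ᶜ (residual q.1 q.2)

theorem contDiff_reducedSystem : ContDiff ℝ ω reducedSystem := by
  unfold reducedSystem
  exact ((restr {2, 3}).contDiff.comp (contDiff_snd.sub contDiff_const)).add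
    ((restr {2, 3}ᶜ).contDiff.comp contDiff_residual)

theorem fderiv_reducedSystem (v : (ℝ × ℝ × ℝ) × SeqL1) :
    fderiv ℝ reducedSystem (0, base) v = restr {2, 3} v.2 + restr {2, 3}ᶜ
      (fderiv ℝ (fun q : (ℝ × ℝ × ℝ) × SeqL1 => residual q.1 q.2) (0, base) v) := by
  have h1 := (contDiff_residual.differentiable (by simp) (0, base)).hasFDerivAt
  have h2 : HasFDerivAt (fun q : (ℝ × ℝ × ℝ) × SeqL1 => q.2 - (unit 2 + unit 3))
      (ContinuousLinearMap.snd ℝ _ _) (0, base) := hasFDerivAt_snd.sub_const _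
  have h3 := ((restr {2, 3}).hasFDerivAt.comp _ h2).add ((restr {2, 3}ᶜ).hasFDerivAt.comp _ h1)
  have h4 : HasFDerivAt reducedSystem _ (0, base) := h3
  rw [h4.fderiv]
  rfl

theorem base_apply_of_level_eq_zero {m : ℕ} (hm : level m = 0) : (base - unit 0) m = 0 := by
  have h : m ≠ 1 ∧ m ≠ 2 ∧ m ≠ 3 ∧ m ≠ 5 := by
    refine ⟨?_, ?_, ?_, ?_⟩ <;> rintro rfl <;> simp [level, evenExp, oddExp] at hm
  simp [base, unit_apply, h]

theorem scaledKernel_coef_zero (n j k l : ℕ) (h : k + l = n + j)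
    (h1 : evenExcess j k l = 0 ∧ oddExcess j k l = 0) :
    (scaledKernel 0 0).coef j k l = interaction n j k l / ((n : ℝ) + 1) := by
  simp only [scaledKernel, h1, and_self, if_true]
  exact fullKernel_coef_eq n j k l h

theorem scaledDeriv_unit_zero_apply (h : SeqL1) (n : ℕ) :
    scaledDeriv (unit 0) h n = (if n = 0 then 3 else 2 / ((n : ℝ) + 1)) * h n := by
  have e1 : evenExcess 0 n 0 = 0 ∧ oddExcess 0 n 0 = 0 := by
    simp [evenExcess, oddExcess, evenExp, oddExp]
  have e2 : evenExcess 0 0 n = 0 ∧ oddExcess 0 0 n = 0 := by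
    simp [evenExcess, oddExcess, evenExp, oddExp]
  simp only [scaledDeriv_apply, add_apply', Kernel.tri_mid_unit_unit_apply,
    Kernel.tri_unit_mid_apply, Kernel.tri_unit_unit_apply, Nat.zero_le, if_true, Nat.add_zero,
    Nat.sub_zero, Nat.le_zero, Nat.zero_sub]
  rw [scaledKernel_coef_zero n 0 n 0 rfl e1, scaledKernel_coef_zero n 0 0 n (by omega) e2]
  split_ifs with hn
  · subst hn
    rw [scaledKernel_coef_zero 0 0 0 0 rfl e2]
    simp [interaction]
    ring
  · simp only [interaction, Nat.min_zero, Nat.zero_min]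
    push_cast
    ring

/-- The derivative at the base point differs from the one at the single-mode state by an operator
that raises the level. -/
theorem scaledDeriv_base_sub_apply {h : SeqL1} {i n : ℕ} (hh : ∀ m, level m < i → h m = 0)
    (hn : level n < i + 1) : scaledDeriv base h n = scaledDeriv (unit 0) h n := by
  set b := base - unit 0 with hb
  have hb1 : ∀ m, level m < 1 → b m = 0 := fun m hm =>
    base_apply_of_level_eq_zero (Nat.lt_one_iff.1 hm)
  have h0 : ∀ (x : SeqL1) m, level m < 0 → x m = 0 := fun _ m hm => absurd hm (Nat.not_lt_zero _)
  have e : base = unit 0 + b := by rw [hb]; abel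
  rw [e, scaledDeriv_apply, scaledDeriv_apply]
  simp only [map_add, add_apply, add_apply']
  rw [tri_zero_apply_eq_zero hh (h0 (unit 0)) hb1 (by omega),
    tri_zero_apply_eq_zero hh hb1 (h0 (unit 0)) (by omega),
    tri_zero_apply_eq_zero hh hb1 hb1 (by omega),
    tri_zero_apply_eq_zero (h0 (unit 0)) hh hb1 (by omega),
    tri_zero_apply_eq_zero hb1 hh (h0 (unit 0)) (by omega),
    tri_zero_apply_eq_zero hb1 hh hb1 (by omega),
    tri_zero_apply_eq_zero (h0 (unit 0)) hb1 hh (by omega),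
    tri_zero_apply_eq_zero hb1 (h0 (unit 0)) hh (by omega),
    tri_zero_apply_eq_zero hb1 hb1 hh (by omega)]
  ring

/-- The diagonal part of the linearized reduced system. -/
noncomputable def diagCoeff (n : ℕ) : ℝ :=
  if n = 2 ∨ n = 3 then 1 else eigenvalue (1 / 6) n / ((n : ℝ) + 1)

theorem diagCoeff_bounds (n : ℕ) : |diagCoeff n| ≤ 2 ∧ |(diagCoeff n)⁻¹| ≤ 200 := by
  unfold diagCoeff
  split_ifs with h
  · norm_num
  push Not at h
  unfold eigenvalue
  split_ifs with h0
  · subst h0; norm_num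
  by_cases h1 : n = 1
  · subst h1; norm_num [abs_div, abs_of_neg, abs_of_pos]
  have h4 : (4 : ℝ) ≤ n := by exact_mod_cast (by omega : 4 ≤ n)
  have hn1 : (0 : ℝ) < (n : ℝ) + 1 := by positivity
  -- The quotient tends to `-1/6`: dividing equation `n` by `n + 1` makes the unbounded factor `1 -
  -- nω` bounded without losing a bounded inverse.
  have e : (1 - n * (1 / 6) - 2 / ((n : ℝ) + 1)) / ((n : ℝ) + 1) =
      -((n - 2) * (n - 3) / (6 * ((n : ℝ) + 1) ^ 2)) := by
    field_simp
    ring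
  have hpos : 0 < ((n : ℝ) - 2) * (n - 3) / (6 * ((n : ℝ) + 1) ^ 2) :=
    div_pos (mul_pos (by linarith) (by linarith)) (by positivity)
  rw [e, abs_neg, abs_inv, abs_neg, abs_of_pos hpos]
  constructor
  · rw [div_le_iff₀ (by positivity)]
    nlinarith
  · rw [inv_div, div_le_iff₀ (mul_pos (by linarith) (by linarith))]
    nlinarith

theorem diagCoeff_ne_zero (n : ℕ) : diagCoeff n ≠ 0 := fun h => by
  unfold diagCoeff at h
  split_ifs at h with h1
  · norm_num at h
  push Not at h1
  rw [div_eq_zero_iff] at h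
  have hn1 : (0 : ℝ) < (n : ℝ) + 1 := by positivity
  rcases h with h | h
  · have := @le_abs_eigenvalue (1 / 6) (by norm_num) n h1.1 h1.2
    rw [h] at this
    norm_num at this
  · linarith

/-- The linearized reduced system is invertible. -/
theorem exists_reducedSystem_equiv : ∃ D : SeqL1 ≃L[ℝ] SeqL1,
    ∀ h, fderiv ℝ reducedSystem (0, base) (0, h) = D h := by
  set Dg := diag diagCoeff 2 fun n => (diagCoeff_bounds n).1 with hDg
  set Di := diag (fun n => (diagCoeff n)⁻¹) 200 fun n => (diagCoeff_bounds n).2 with hDi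
  set D : SeqL1 →L[ℝ] SeqL1 :=
    (fderiv ℝ reducedSystem (0, base)).comp (ContinuousLinearMap.inr ℝ (ℝ × ℝ × ℝ) SeqL1) with hD
  have hDapp : ∀ h n, D h n = diagCoeff n * h n -
      if n = 2 ∨ n = 3 then 0 else
        (scaledDeriv base h n - scaledDeriv (unit 0) h n) / ((n : ℝ) + 1) := by
    intro h n
    have e : D h = restr {2, 3} h + restr {2, 3}ᶜ
        (divSucc h - (1 / 6 : ℝ) • mulDivSucc h - divSucc (scaledDeriv base h)) := by
      rw [← fderiv_residual_state]
      exact fderiv_reducedSystem (0, h)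
    rw [e, add_apply']
    by_cases hn : n = 2 ∨ n = 3
    · have h1 : n ∈ ({2, 3} : Set ℕ) := hn
      rw [restr_apply_mem h1, restr_apply_notMem (Set.notMem_compl_iff.2 h1),
        if_pos hn, diagCoeff, if_pos hn]
      ring
    · have h1 : n ∈ ({2, 3} : Set ℕ)ᶜ := hn
      rw [restr_apply_notMem h1, restr_apply_mem h1, if_neg hn, diagCoeff, if_neg hn,
        scaledDeriv_unit_zero_apply]
      simp only [divSucc, mulDivSucc, sub_apply', smul_apply', diag_apply, eigenvalue]
      split_ifs with h0
      · subst h0; norm_num; ring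
      · ring
  have hDgDi : Dg * Di = 1 := by
    ext x n
    change Dg (Di x) n = x n
    rw [hDg, hDi, diag_apply, diag_apply, mul_inv_cancel_left₀ (diagCoeff_ne_zero n)]
  have hDiDg : Di * Dg = 1 := by
    ext x n
    change Di (Dg x) n = x n
    rw [hDg, hDi, diag_apply, diag_apply, inv_mul_cancel_left₀ (diagCoeff_ne_zero n)]
  -- `D = Dg (1 + N)`, where `N` raises the level by one, because the base point differs from `e_0`
  -- only at positive levels.
  set N := Di * (D - Dg) with hN
  have hraise : ∀ (i : ℕ) (h : SeqL1), (∀ m, level m < i → h m = 0) →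
      ∀ m, level m < i + 1 → N h m = 0 := by
    intro i h hh m hm
    change Di (D h - Dg h) m = 0
    rw [hDi, diag_apply, sub_apply', hDapp, hDg, diag_apply, scaledDeriv_base_sub_apply hh hm]
    simp
  -- Every level is at most 2, so three applications of `N` give zero.
  have hnil : IsNilpotent N := by
    refine ⟨3, ?_⟩
    ext x n
    have h0 : ∀ m, level m < 0 → x m = 0 := fun m hm => absurd hm (Nat.not_lt_zero _)
    have h3 := hraise _ _ (hraise _ _ (hraise _ _ h0)) n (by
      unfold level evenExp oddExp
      split_ifs <;> omega)
    rw [pow_three]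
    exact h3
  have hunit : IsUnit D := by
    have h1 : D = Dg * (1 + N) := by
      rw [hN, mul_add, ← mul_assoc, hDgDi]
      simp
    rw [h1]
    exact (isUnit_iff_exists.2 ⟨Di, hDgDi, hDiDg⟩).mul hnil.isUnit_one_add
  obtain ⟨u, hu⟩ := hunit
  refine ⟨ContinuousLinearEquiv.unitsEquiv ℝ SeqL1 u, fun h => ?_⟩
  have : (ContinuousLinearEquiv.unitsEquiv ℝ SeqL1 u) h = (u : SeqL1 →L[ℝ] SeqL1) h := by simp
  rw [this, hu]
  rfl

/-- The integer entries of the base point. -/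
def baseEntry : ℕ → ℤ
  | 0 => 1
  | 1 => -6
  | 2 => 1
  | 3 => 1
  | 5 => -2
  | _ => 0

theorem base_apply (n : ℕ) : base n = baseEntry n := by
  simp only [base, add_apply', smul_apply', unit_apply]
  rcases Nat.lt_or_ge n 6 with h | h
  · interval_cases n <;> norm_num [baseEntry]
  · have : baseEntry n = 0 := by
      unfold baseEntry
      split <;> omega
    rw [this]
    simp [show n ≠ 0 by omega, show n ≠ 1 by omega, show n ≠ 2 by omega, show n ≠ 3 by omega,
      show n ≠ 5 by omega]

theorem baseEntry_eq_zero {n : ℕ} (h : 6 ≤ n) : baseEntry n = 0 := by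
  unfold baseEntry
  split <;> omega

/-- The value of a scaled nonlinearity at the base point, multiplied by `n + 1`. -/
def baseCubic (a b n : ℕ) : ℤ :=
  ∑ j ∈ Finset.range 6, ∑ k ∈ Finset.range (n + j + 1),
    if evenExcess j k (n + j - k) = a ∧ oddExcess j k (n + j - k) = b then
      (min (min n j) (min k (n + j - k)) + 1 : ℕ) * baseEntry j * baseEntry k *
        baseEntry (n + j - k) else 0

theorem tri_base_apply (a b n : ℕ) :
    (scaledKernel a b).tri base base base n = baseCubic a b n / ((n : ℝ) + 1) := by
  have h1 := (scaledKernel a b).hasSum_tri_apply base base base n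
  have h2 : ∀ j ∉ Finset.range 6, ∑ k ∈ Finset.range (n + j + 1),
      (scaledKernel a b).coef j k (n + j - k) * base j * base k * base (n + j - k) = 0 := by
    intro j hj
    rw [Finset.mem_range, not_lt] at hj
    simp [base_apply j, baseEntry_eq_zero hj]
  rw [h1.unique (hasSum_sum_of_ne_finset_zero h2), baseCubic]
  push_cast
  rw [Finset.sum_div]
  refine Finset.sum_congr rfl fun j _ => ?_
  rw [Finset.sum_div]
  refine Finset.sum_congr rfl fun k hk => ?_
  have hkl : k + (n + j - k) = n + j := by rw [Finset.mem_range] at hk; omega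
  simp only [scaledKernel, base_apply]
  split_ifs
  · rw [fullKernel_coef_eq n j k _ hkl, interaction]
    push_cast
    ring
  · simp

/-- The entries 1 and 5 of the base point are those of level 2 which the modes 2 and 3 generate
through `3 - 2` and `3 + 2`. The equations reduce to integer identities. -/
theorem reducedSystem_base : reducedSystem (0, base) = 0 := by
  ext n
  rw [reducedSystem, add_apply', zero_apply']
  by_cases hn : n = 2 ∨ n = 3
  · have h1 : n ∈ ({2, 3} : Set ℕ) := hn
    rw [restr_apply_mem h1, restr_apply_notMem (Set.notMem_compl_iff.2 h1), sub_apply', add_apply',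
      unit_apply, unit_apply, base_apply]
    rcases hn with rfl | rfl <;> norm_num [baseEntry]
  · have h1 : n ∈ ({2, 3} : Set ℕ)ᶜ := hn
    rw [restr_apply_notMem h1, restr_apply_mem h1, zero_add, residual_apply]
    simp only [Prod.fst_zero, Prod.snd_zero, scaledCubic_zero_left, zero_smul, add_zero,
      tri_base_apply, base_apply]
    push Not at hn
    -- Indices in the support are at most 5, so `n = k + l - j ≤ 10` for every nonzero product.
    rcases Nat.lt_or_ge n 11 with h | h
    · have hz : (6 - n : ℤ) * (n + 1) * baseEntry n = 6 * baseCubic 0 0 n := by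
        obtain ⟨h2, h3⟩ := hn
        interval_cases n <;> first | exact absurd rfl h2 | exact absurd rfl h3 | decide +kernel
      have hz' : ((6 - n) * (n + 1) * baseEntry n : ℝ) = 6 * baseCubic 0 0 n := by exact_mod_cast hz
      have hn1 : (n : ℝ) + 1 ≠ 0 := by positivity
      field_simp
      linear_combination hz'
    · have hz : baseCubic 0 0 n = 0 := by
        refine Finset.sum_eq_zero fun j _ => Finset.sum_eq_zero fun k hk => ?_
        rw [Finset.mem_range] at hk
        rcases Nat.lt_or_ge k 6 with h5 | h5
        · rw [baseEntry_eq_zero (n := n + j - k) (by omega)]; simp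
        · rw [baseEntry_eq_zero h5]; simp
      rw [hz, baseEntry_eq_zero (by omega)]
      simp

/-- The terms linear in `ν`. Entries 2 and 3 enter the bifurcation equations directly; entries 0 and
6 enter through the response of the state in these components. -/
theorem tri_one_base_apply : (scaledKernel 0 1).tri base base base 0 = 2 ∧
    (scaledKernel 0 1).tri base base base 2 = -10 / 3 ∧
    (scaledKernel 0 1).tri base base base 3 = 1 ∧
    (scaledKernel 0 1).tri base base base 6 = 1 / 7 := by
  have h0 : baseCubic 0 1 0 = 2 := by decide +kernel
  have h2 : baseCubic 0 1 2 = -10 := by decide +kernel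
  have h3 : baseCubic 0 1 3 = 4 := by decide +kernel
  have h6 : baseCubic 0 1 6 = 1 := by decide +kernel
  rw [tri_base_apply, tri_base_apply, tri_base_apply, tri_base_apply, h0, h2, h3, h6]
  norm_num

/-- By the grading, an entry of level 1 sees at most one factor of level 1. The entries 1 and 5 of
the base point and products of two of its modes 2, 3 drop out. -/
theorem scaledDeriv_base_apply_of_level_eq_one (h : SeqL1) {n : ℕ} (hn : level n = 1) :
    scaledDeriv base h n = scaledDeriv (unit 0) h n +
      ((scaledKernel 0 0).tri h (unit 0) (unit 2) n + (scaledKernel 0 0).tri h (unit 0) (unit 3) n +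
      (scaledKernel 0 0).tri h (unit 2) (unit 0) n + (scaledKernel 0 0).tri h (unit 3) (unit 0) n +
      (scaledKernel 0 0).tri (unit 0) h (unit 2) n + (scaledKernel 0 0).tri (unit 0) h (unit 3) n +
      (scaledKernel 0 0).tri (unit 2) h (unit 0) n + (scaledKernel 0 0).tri (unit 3) h (unit 0) n +
      (scaledKernel 0 0).tri (unit 0) (unit 2) h n + (scaledKernel 0 0).tri (unit 0) (unit 3) h n +
      (scaledKernel 0 0).tri (unit 2) (unit 0) h n +
      (scaledKernel 0 0).tri (unit 3) (unit 0) h n) := by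
  have h0 : ∀ (x : SeqL1) m, level m < 0 → x m = 0 := fun _ m hm => absurd hm (Nat.not_lt_zero _)
  set b : SeqL1 := (-6 : ℝ) • unit 1 + (-2 : ℝ) • unit 5 with hb
  have hb2 : ∀ m, level m < 2 → b m = 0 := fun m hm => by
    have : m ≠ 1 ∧ m ≠ 5 := by
      constructor <;> rintro rfl <;> simp [level, evenExp, oddExp] at hm
    simp [hb, unit_apply, this]
  set e : SeqL1 := unit 2 + unit 3 with he
  have he1 : ∀ m, level m < 1 → e m = 0 := fun m hm => by
    have : m ≠ 2 ∧ m ≠ 3 := by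
      constructor <;> rintro rfl <;> simp [level, evenExp, oddExp] at hm
    simp [he, unit_apply, this]
  have hbase : base = unit 0 + e + b := by rw [base, he, hb]; abel
  have zb1 : ∀ x y, (scaledKernel 0 0).tri b x y n = 0 := fun x y =>
    tri_zero_apply_eq_zero hb2 (h0 x) (h0 y) (by omega)
  have zb2 : ∀ x y, (scaledKernel 0 0).tri x b y n = 0 := fun x y =>
    tri_zero_apply_eq_zero (h0 x) hb2 (h0 y) (by omega)
  have zb3 : ∀ x y, (scaledKernel 0 0).tri x y b n = 0 := fun x y =>
    tri_zero_apply_eq_zero (h0 x) (h0 y) hb2 (by omega)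
  have ze1 : ∀ x, (scaledKernel 0 0).tri x e e n = 0 := fun x =>
    tri_zero_apply_eq_zero (h0 x) he1 he1 (by omega)
  have ze2 : ∀ x, (scaledKernel 0 0).tri e x e n = 0 := fun x =>
    tri_zero_apply_eq_zero he1 (h0 x) he1 (by omega)
  have ze3 : ∀ x, (scaledKernel 0 0).tri e e x n = 0 := fun x =>
    tri_zero_apply_eq_zero he1 he1 (h0 x) (by omega)
  rw [hbase, scaledDeriv_apply, scaledDeriv_apply]
  simp only [map_add, add_apply, add_apply', zb1, zb2, zb3, ze1, ze2, ze3]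
  simp only [he, map_add, add_apply, add_apply']
  ring

theorem scaledDeriv_base_apply_two (h : SeqL1) :
    scaledDeriv base h 2 = 4 / 3 * h 0 + 2 / 3 * h 2 := by
  rw [scaledDeriv_base_apply_of_level_eq_one h (by simp [level, evenExp, oddExp]),
    scaledDeriv_unit_zero_apply]
  simp only [Kernel.tri_mid_unit_unit_apply, Kernel.tri_unit_mid_apply,
    Kernel.tri_unit_unit_apply]
  norm_num [scaledKernel, fullKernel, evenExcess, oddExcess, evenExp, oddExp, interaction]
  ring

theorem scaledDeriv_base_apply_three (h : SeqL1) :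
    scaledDeriv base h 3 = h 0 + 1 / 2 * h 3 + 1 / 2 * h 6 := by
  rw [scaledDeriv_base_apply_of_level_eq_one h (by simp [level, evenExp, oddExp]),
    scaledDeriv_unit_zero_apply]
  simp only [Kernel.tri_mid_unit_unit_apply, Kernel.tri_unit_mid_apply,
    Kernel.tri_unit_unit_apply]
  norm_num [scaledKernel, fullKernel, evenExcess, oddExcess, evenExp, oddExp, interaction]
  ring

theorem scaledDeriv_base_apply_level_zero (h : SeqL1) {n : ℕ} (hn : level n = 0) :
    scaledDeriv base h n = (if n = 0 then 3 else 2 / ((n : ℝ) + 1)) * h n := by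
  rw [← scaledDeriv_unit_zero_apply]
  exact scaledDeriv_base_sub_apply (i := 0) (fun m hm => absurd hm (Nat.not_lt_zero _)) (by omega)

/-- The family of solutions of all equations except those with indices `2` and `3`, with the two
remaining residuals divided by the amplitudes. -/
theorem exists_reduced_family : ∃ X : ℝ × ℝ × ℝ → SeqL1, ∃ r > 0,
    X 0 = base ∧ ContDiffOn ℝ ω X (Metric.ball 0 r) ∧
    (∀ p ∈ Metric.ball (0 : ℝ × ℝ × ℝ) r, X p 2 = 1 ∧ X p 3 = 1 ∧
      ∀ n, n ≠ 2 → n ≠ 3 → residual p (X p) n = 0) ∧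
    residual 0 base 2 = 0 ∧ residual 0 base 3 = 0 ∧
    (∀ a b : ℝ, fderiv ℝ (fun p => residual p (X p) 2) 0 (0, a, b) =
      14 / 9 * a - 2 / 3 * b) ∧
    (∀ a b : ℝ, fderiv ℝ (fun p => residual p (X p) 3) 0 (0, a, b) =
      1 / 16 * a - 3 / 4 * b) := by
  obtain ⟨D, hD⟩ := exists_reducedSystem_equiv
  obtain ⟨X, r, hr, L, hL, hX0, hXc, hXs, -⟩ :=
    exists_analytic_implicit contDiff_reducedSystem.contDiffAt reducedSystem_base D hD
  have hb3 : baseCubic 0 0 3 = 2 := by decide +kernel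
  have hb2 : baseCubic 0 0 2 = 2 := by decide +kernel
  have hXd : DifferentiableAt ℝ X 0 :=
    (hXc.contDiffAt (Metric.ball_mem_nhds _ hr)).differentiableAt (by simp)
  have hpair : HasFDerivAt (fun p => (p, X p))
      ((ContinuousLinearMap.id ℝ (ℝ × ℝ × ℝ)).prod (fderiv ℝ X 0)) 0 :=
    (hasFDerivAt_id (𝕜 := ℝ) (0 : ℝ × ℝ × ℝ)).prodMk hXd.hasFDerivAt
  set R := fun q : (ℝ × ℝ × ℝ) × SeqL1 => residual q.1 q.2 with hR
  have hRd : HasFDerivAt R (fderiv ℝ R (0, base)) (0, X 0) := by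
    rw [hX0]
    exact (contDiff_residual.differentiable (by simp) (0, base)).hasFDerivAt
  have hSd : HasFDerivAt reducedSystem (fderiv ℝ reducedSystem (0, base)) (0, X 0) := by
    rw [hX0]
    exact (contDiff_reducedSystem.differentiable (by simp) (0, base)).hasFDerivAt
  have hcomp : HasFDerivAt (R ∘ fun p => (p, X p)) ((fderiv ℝ R (0, base)).comp
      ((ContinuousLinearMap.id ℝ _).prod (fderiv ℝ X 0))) 0 := HasFDerivAt.comp (g := R) 0 hRd hpair
  have hScomp : HasFDerivAt (reducedSystem ∘ fun p => (p, X p))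
      ((fderiv ℝ reducedSystem (0, base)).comp
        ((ContinuousLinearMap.id ℝ _).prod (fderiv ℝ X 0))) 0 :=
    HasFDerivAt.comp (g := reducedSystem) 0 hSd hpair
  -- The composition vanishes near 0, so its derivative is zero; this gives the linear equations for
  -- the derivative of `X`.
  have hSzero : HasFDerivAt (reducedSystem ∘ fun p => (p, X p))
      (0 : (ℝ × ℝ × ℝ) →L[ℝ] SeqL1) 0 := by
    refine (hasFDerivAt_const (0 : SeqL1) (0 : ℝ × ℝ × ℝ)).congr_of_eventuallyEq ?_
    filter_upwards [Metric.ball_mem_nhds (0 : ℝ × ℝ × ℝ) hr] with p hp using hXs p hp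
  have huniq := hScomp.unique hSzero
  have hRform : ∀ (a b : ℝ) (h : SeqL1), fderiv ℝ R (0, base) ((0, a, b), h) =
      -(b • mulDivSucc base) - a • divSucc ((scaledKernel 0 1).tri base base base) +
      (divSucc h - (1 / 6 : ℝ) • mulDivSucc h - divSucc (scaledDeriv base h)) := by
    intro a b h
    rw [← fderiv_residual_state, ← fderiv_residual_parameter, ← map_add, Prod.mk_add_mk,
      add_zero, zero_add]
  have hRcoord : ∀ (a b : ℝ) (h : SeqL1) (n : ℕ), fderiv ℝ R (0, base) ((0, a, b), h) n =
      (-(b * n * base n) - a * (scaledKernel 0 1).tri base base base n +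
        ((1 - n / 6) * h n - scaledDeriv base h n)) / ((n : ℝ) + 1) := by
    intro a b h n
    rw [hRform]
    simp only [divSucc, mulDivSucc, add_apply', sub_apply', neg_apply', smul_apply', diag_apply]
    ring
  obtain ⟨t0, t2, t3, t6⟩ := tri_one_base_apply
  -- Only the components 0, 2, 3, 6 of the response occur in the linearized equations 2 and 3.
  have hderiv : ∀ a b : ℝ, ∃ h : SeqL1, h 2 = 0 ∧ h 3 = 0 ∧ h 0 = -a ∧ h 6 = -(a / 2) ∧
      ∀ n, fderiv ℝ (fun p => residual p (X p) n) 0 (0, a, b) =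
        fderiv ℝ R (0, base) ((0, a, b), h) n := by
    intro a b
    refine ⟨fderiv ℝ X 0 (0, a, b), ?_⟩
    set h := fderiv ℝ X 0 (0, a, b) with hh
    have hz : fderiv ℝ reducedSystem (0, base) ((0, a, b), h) = 0 :=
      DFunLike.congr_fun huniq (0, a, b)
    rw [fderiv_reducedSystem] at hz
    have hz23 : ∀ n, n = 2 ∨ n = 3 → h n = 0 := fun n hn => by
      have h1 : n ∈ ({2, 3} : Set ℕ) := hn
      have h2 := congrArg (fun x : SeqL1 => x n) hz
      simp only [add_apply', zero_apply'] at h2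
      rwa [restr_apply_mem h1, restr_apply_notMem (Set.notMem_compl_iff.2 h1), add_zero] at h2
    have hz0 : ∀ n, n ≠ 2 → n ≠ 3 → fderiv ℝ R (0, base) ((0, a, b), h) n = 0 := fun n hn2 hn3 => by
      have h1 : n ∈ ({2, 3} : Set ℕ)ᶜ := by simp [hn2, hn3]
      have h2 := congrArg (fun x : SeqL1 => x n) hz
      simp only [add_apply', zero_apply'] at h2
      rwa [restr_apply_notMem h1, restr_apply_mem h1, zero_add] at h2
    refine ⟨hz23 2 (Or.inl rfl), hz23 3 (Or.inr rfl), ?_, ?_, fun n => ?_⟩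
    · have h1 := hz0 0 (by norm_num) (by norm_num)
      rw [hRcoord, scaledDeriv_base_apply_level_zero h (by simp [level, evenExp, oddExp]), t0] at h1
      norm_num at h1
      linarith
    · have h1 := hz0 6 (by norm_num) (by norm_num)
      rw [hRcoord, scaledDeriv_base_apply_level_zero h (by simp [level, evenExp, oddExp]), t6,
        base_apply, baseEntry_eq_zero le_rfl] at h1
      norm_num at h1
      linarith
    · have h1 : HasFDerivAt (fun p => residual p (X p) n) ((coord n).comp
          ((fderiv ℝ R (0, base)).comp ((ContinuousLinearMap.id ℝ _).prod (fderiv ℝ X 0)))) 0 :=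
        HasFDerivAt.comp (g := coord n) 0 (coord n).hasFDerivAt hcomp
      rw [h1.fderiv]
      rfl
  have e2 : base 2 = 1 := by rw [base_apply]; simp [baseEntry]
  have e3 : base 3 = 1 := by rw [base_apply]; simp [baseEntry]
  refine ⟨X, r, hr, hX0, hXc, fun p hp => ?_, ?_, ?_, fun a b => ?_, fun a b => ?_⟩
  · have hz := hXs p hp
    rw [reducedSystem] at hz
    have hn2 : ∀ n, n = 2 ∨ n = 3 → X p n = (unit 2 + unit 3 : SeqL1) n := fun n hn => by
      have h1 : n ∈ ({2, 3} : Set ℕ) := hn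
      have h2 := congrArg (fun x : SeqL1 => x n) hz
      simp only [add_apply', zero_apply'] at h2
      rw [restr_apply_mem h1, restr_apply_notMem (Set.notMem_compl_iff.2 h1), add_zero] at h2
      exact sub_eq_zero.1 h2
    refine ⟨?_, ?_, fun n hn2 hn3 => ?_⟩
    · rw [hn2 2 (Or.inl rfl)]; simp [unit_apply]
    · rw [hn2 3 (Or.inr rfl)]; simp [unit_apply]
    · have h1 : n ∈ ({2, 3} : Set ℕ)ᶜ := by simp [hn2, hn3]
      have h2 := congrArg (fun x : SeqL1 => x n) hz
      simp only [add_apply', zero_apply'] at h2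
      rwa [restr_apply_notMem h1, restr_apply_mem h1, zero_add] at h2
  · rw [residual_apply]
    simp only [Prod.fst_zero, Prod.snd_zero, scaledCubic_zero_left, zero_smul, add_zero,
      tri_base_apply, e2, hb2]
    norm_num
  · rw [residual_apply]
    simp only [Prod.fst_zero, Prod.snd_zero, scaledCubic_zero_left, zero_smul, add_zero,
      tri_base_apply, e3, hb3]
    norm_num
  · obtain ⟨h, h2, h3, h0, h6, hf⟩ := hderiv a b
    rw [hf, hRcoord, scaledDeriv_base_apply_two, t2, h0, h2, e2]
    norm_num
    ring
  · obtain ⟨h, h2, h3, h0, h6, hf⟩ := hderiv a b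
    rw [hf, hRcoord, scaledDeriv_base_apply_three, t3, h0, h3, h6, e3]
    norm_num
    ring

end ConformalFlow

namespace ConformalFlow

open Filter Topology SeqL1

set_option maxSynthPendingDepth 4

/-! ### An explicit family of solutions -/

theorem hasSum_moment_geometric {q : ℝ} (hq : |q| < 1) :
    HasSum (fun j : ℕ => q ^ j) (1 / (1 - q)) ∧
    HasSum (fun j : ℕ => (j : ℝ) * q ^ j) (q / (1 - q) ^ 2) ∧
    HasSum (fun j : ℕ => (j : ℝ) ^ 2 * q ^ j) (q * (1 + q) / (1 - q) ^ 3) ∧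
    HasSum (fun j : ℕ => (j : ℝ) ^ 3 * q ^ j) (q * (1 + 4 * q + q ^ 2) / (1 - q) ^ 4) ∧
    HasSum (fun j : ℕ => (j : ℝ) ^ 4 * q ^ j)
      (q * (1 + 11 * q + 11 * q ^ 2 + q ^ 3) / (1 - q) ^ 5) := by
  have h1 : 1 - q ≠ 0 := by linarith [(abs_lt.1 hq).2]
  have hs : ∀ i : ℕ, Summable fun j : ℕ => (j : ℝ) ^ i * q ^ j := fun i =>
    summable_pow_mul_geometric_of_norm_lt_one i hq
  have m0 : HasSum (fun j : ℕ => q ^ j) (1 / (1 - q)) := by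
    rw [one_div]; exact hasSum_geometric_of_abs_lt_one hq
  have m1 : HasSum (fun j : ℕ => (j : ℝ) * q ^ j) (q / (1 - q) ^ 2) :=
    hasSum_coe_mul_geometric_of_norm_lt_one hq
  -- Shifting the index by one in the moment `M` loses only a zero term and gives `M = q (M + R)`,
  -- with `R` a combination of lower moments.
  have step : ∀ (i : ℕ) (R : ℝ),
      HasSum (fun j : ℕ => (((j : ℝ) + 1) ^ (i + 1) - j ^ (i + 1)) * q ^ j) R →
      HasSum (fun j : ℕ => (j : ℝ) ^ (i + 1) * q ^ j) (q * R / (1 - q)) := by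
    intro i R hR
    obtain ⟨M, hM⟩ := hs (i + 1)
    have h2 := ((hM.add hR).mul_left q).unique (a₂ := M) (by
      have h3 := (hasSum_nat_add_iff' 1).2 hM
      simp only [Finset.range_one, Finset.sum_singleton, Nat.cast_zero, ne_eq, Nat.add_eq_zero_iff,
        one_ne_zero, and_false, not_false_eq_true, zero_pow, zero_mul, sub_zero] at h3
      refine h3.congr_fun fun j => ?_
      push_cast
      ring)
    have h4 : M = q * R / (1 - q) := by
      rw [eq_div_iff h1]
      linarith
    rwa [← h4]
  have m2 := step 1 _ (((m1.mul_left 2).add m0).congr_fun fun j => by ring)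
  have m3 := step 2 _ ((((m2.mul_left 3).add (m1.mul_left 3)).add m0).congr_fun fun j => by ring)
  have m4 := step 3 _ (((((m3.mul_left 4).add (m2.mul_left 6)).add (m1.mul_left 4)).add
    m0).congr_fun fun j => by ring)
  refine ⟨m0, m1, ?_, ?_, ?_⟩
  · convert m2 using 1
    field_simp
    ring
  · convert m3 using 1
    field_simp
    ring
  · convert m4 using 1
    field_simp
    ring

theorem sum_range_quadratic (b g : ℝ) (m : ℕ) :
    ∑ k ∈ Finset.range (m + 1), (b + g * k) * (b + g * (m - k)) =
      (m + 1) * (b ^ 2 + b * g * m + g ^ 2 * m * (m - 1) / 6) := by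
  have h1 : ∀ N : ℕ, ∑ k ∈ Finset.range N, (b + g * k) * (b + g * (m - k)) =
      N * b ^ 2 + N * b * g * m + g ^ 2 * m * (N * (N - 1) / 2) -
        g ^ 2 * ((N - 1) * N * (2 * N - 1) / 6) := by
    intro N
    induction N with
    | zero => simp
    | succ N ih => rw [Finset.sum_range_succ, ih]; push_cast; ring
  rw [h1]
  push_cast
  ring

/-- The value of the cubic nonlinearity on the sequence `(b + g n) pⁿ`, divided by `pⁿ`. -/
noncomputable def geometricCubic (q b g x : ℝ) : ℝ :=
  (b ^ 3 / (1 - q) ^ 2 + 4 * q * b ^ 2 * g / (1 - q) ^ 3 +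
      (2 * q + 5 * q ^ 2) * b * g ^ 2 / (1 - q) ^ 4 +
      (2 * q ^ 2 + 2 * q ^ 3) * g ^ 3 / (1 - q) ^ 5) +
    (b ^ 2 * g / (1 - q) ^ 2 + b * g ^ 2 * (19 * q - 1) / (6 * (1 - q) ^ 3) +
      g ^ 3 * (2 * q + 7 * q ^ 2) / (3 * (1 - q) ^ 4)) * x +
    (b * g ^ 2 / (6 * (1 - q) ^ 2) + q * g ^ 3 / (3 * (1 - q) ^ 3)) * x ^ 2

/-- The sum with all interaction coefficients replaced by 1. It is written as a difference of two
values of `geometricCubic`, so that the induction in `hasSum_geometric_cubic` telescopes. -/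
theorem hasSum_geometric_convolution {q : ℝ} (hq : |q| < 1) (b g : ℝ) (n : ℕ) :
    HasSum (fun j : ℕ => (b + g * j) * ((n + j + 1) *
      (b ^ 2 + b * g * (n + j) + g ^ 2 * (n + j) * (n + j - 1) / 6)) * q ^ j)
      ((n + 1) * geometricCubic q b g n - q * (n * geometricCubic q (b + g) g (n - 1))) := by
  obtain ⟨m0, m1, m2, m3, m4⟩ := hasSum_moment_geometric hq
  have h1 : 1 - q ≠ 0 := by linarith [(abs_lt.1 hq).2]
  set α := b ^ 2 + b * g * n + g ^ 2 * n * (n - 1) / 6 with hα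
  set β := b * g + g ^ 2 * (2 * n - 1) / 6 with hβ
  set γ := g ^ 2 / 6 with hγ
  have h := (((((m0.mul_left (b * (n + 1) * α)).add
    (m1.mul_left (b * (n + 1) * β + (g * (n + 1) + b) * α))).add
    (m2.mul_left (b * (n + 1) * γ + (g * (n + 1) + b) * β + g * α))).add
    (m3.mul_left ((g * (n + 1) + b) * γ + g * β))).add (m4.mul_left (g * γ)))
  refine (congrArg (HasSum _) ?_).mp (h.congr_fun fun j => ?_)
  · simp only [hα, hβ, hγ, geometricCubic]
    field_simp
    ring
  · simp only [hα, hβ, hγ]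
    ring

theorem interaction_zero_left (j k l : ℕ) : interaction 0 j k l = 1 := by simp [interaction]

/-- Induction on `n`: the coefficient minus 1 vanishes if one index is 0, and otherwise is the
coefficient with all four indices lowered by 1. Lowering the indices `j`, `k`, `l` replaces `b` by
`b + g` and gives the factor `p³`; hence `b` is generalized. -/
theorem hasSum_geometric_cubic {p : ℝ} (hp : |p ^ 2| < 1) (g : ℝ) (n : ℕ) : ∀ b : ℝ,
    HasSum (fun j : ℕ => ∑ k ∈ Finset.range (n + j + 1), interaction n j k (n + j - k) *
      ((b + g * j) * p ^ j) * ((b + g * k) * p ^ k) *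
        ((b + g * (n + j - k : ℕ)) * p ^ (n + j - k)))
      (p ^ n * ((n + 1) * geometricCubic (p ^ 2) b g n)) := by
  have hconv : ∀ (b : ℝ) (n j : ℕ), ∑ k ∈ Finset.range (n + j + 1),
      ((b + g * j) * p ^ j) * ((b + g * k) * p ^ k) *
        ((b + g * (n + j - k : ℕ)) * p ^ (n + j - k)) =
      p ^ n * ((b + g * j) * ((n + j + 1) *
      (b ^ 2 + b * g * (n + j) + g ^ 2 * (n + j) * (n + j - 1) / 6)) * (p ^ 2) ^ j) := by
    intro b n j
    have h1 := sum_range_quadratic b g (n + j)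
    push_cast at h1
    rw [← h1, Finset.mul_sum, Finset.sum_mul, Finset.mul_sum]
    refine Finset.sum_congr rfl fun k hk => ?_
    have hk' : k ≤ n + j := by rw [Finset.mem_range] at hk; omega
    have h2 : p ^ (n + j) = p ^ k * p ^ (n + j - k) := by rw [← pow_add]; congr 1; omega
    have h3 : p ^ n * (p ^ 2) ^ j = p ^ j * (p ^ k * p ^ (n + j - k)) := by
      rw [← h2, ← pow_mul, ← pow_add, ← pow_add]; congr 1; omega
    rw [Nat.cast_sub hk']
    push_cast
    linear_combination -(b + g * j) * (b + g * k) * (b + g * (n + j - k)) * h3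
  induction n with
  | zero =>
    intro b
    have h := (hasSum_geometric_convolution hp b g 0).mul_left (p ^ 0)
    simp only [Nat.cast_zero, zero_mul, mul_zero, sub_zero] at h
    simp only [Nat.cast_zero]
    refine h.congr_fun fun j => ?_
    have := hconv b 0 j
    simp only [Nat.cast_zero] at this
    rw [← this]
    simp only [interaction_zero_left, one_mul]
  | succ n ih =>
    intro b
    have h1 := (hasSum_geometric_convolution hp b g (n + 1)).mul_left (p ^ (n + 1))
    have h2 := (hasSum_nat_add_iff (f := fun j : ℕ => ∑ k ∈ Finset.range (n + 1 + j + 1),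
      (interaction (n + 1) j k (n + 1 + j - k) - 1) *
      ((b + g * j) * p ^ j) * ((b + g * k) * p ^ k) *
        ((b + g * (n + 1 + j - k : ℕ)) * p ^ (n + 1 + j - k))) 1
      (g := p ^ 3 * (p ^ n * ((n + 1) * geometricCubic (p ^ 2) (b + g) g n)))).1 ?_
    · refine (congrArg (HasSum _) ?_).mp ((h1.add h2).congr_fun fun j => ?_)
      · rw [Finset.range_one, Finset.sum_singleton, Finset.sum_eq_zero fun k _ => by
          simp [interaction]]
        push_cast
        rw [add_sub_cancel_right]
        ring
      · rw [← hconv, ← Finset.sum_add_distrib]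
        refine Finset.sum_congr rfl fun k _ => ?_
        ring
    · refine ((ih (b + g)).mul_left (p ^ 3)).congr_fun fun j => ?_
      rw [show n + 1 + (j + 1) + 1 = (n + j + 1) + 1 + 1 by ring, Finset.sum_range_succ,
        Finset.sum_range_succ', Finset.mul_sum]
      have e1 : interaction (n + 1) (j + 1) 0 (n + 1 + (j + 1) - 0) = 1 := by simp [interaction]
      have e2 : interaction (n + 1) (j + 1) (n + j + 1 + 1)
          (n + 1 + (j + 1) - (n + j + 1 + 1)) = 1 := by
        rw [show n + 1 + (j + 1) - (n + j + 1 + 1) = 0 by omega]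
        simp [interaction]
      rw [e1, e2]
      simp only [sub_self, zero_mul, add_zero]
      refine Finset.sum_congr rfl fun k hk => ?_
      rw [Finset.mem_range] at hk
      rw [show n + 1 + (j + 1) - (k + 1) = (n + j - k) + 1 by omega]
      have e3 : interaction (n + 1) (j + 1) (k + 1) (n + j - k + 1) - 1 =
          interaction n j k (n + j - k) := by
        simp [interaction, Nat.succ_min_succ]
      rw [e3]
      push_cast
      ring

/-- The coefficients for which the sequence `(b + g n) pⁿ`, `p² = q`, is a stationary state. -/
theorem exists_geometric_coefficients : ∃ b g w : ℝ → ℝ,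
    ContDiffAt ℝ 1 b 0 ∧ ContDiffAt ℝ 1 g 0 ∧ ContDiffAt ℝ 1 w 0 ∧
    b 0 = 1 ∧ g 0 = -1 ∧ w 0 = 1 / 6 ∧
    ∀ᶠ q in 𝓝 (0 : ℝ), ∀ x : ℝ,
      geometricCubic q (b q) (g q) x = (1 - x * w q) * (b q + g q * x) := by
  set s : ℝ → ℝ := fun q => √(1 - 14 * q + q ^ 2) with hs
  -- Comparing coefficients in `x`, with `b = B(1-q)` and `g = tB(1-q)²`, the constant term fixes
  -- `B` through `B²D = 1` and the quadratic term fixes `w`. The linear term requires `6q(1+q)t² +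
  -- (1+5q)t + 1 = 0`. This is its root with `t(0) = -1`, rationalized because the leading
  -- coefficient vanishes at `q = 0`.
  set t : ℝ → ℝ := fun q => -2 / (1 + 5 * q + s q) with ht
  set D : ℝ → ℝ := fun q => 1 + 4 * q * t q + (2 * q + 5 * q ^ 2) * t q ^ 2 +
    2 * q ^ 2 * (1 + q) * t q ^ 3 with hD
  set B : ℝ → ℝ := fun q => (√(D q))⁻¹ with hB
  have s0 : s 0 = 1 := by simp [hs]
  have t0 : t 0 = -1 := by simp only [ht, s0]; norm_num
  have D0 : D 0 = 1 := by simp [hD]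
  have B0 : B 0 = 1 := by simp [hB, D0]
  have cs : ContDiffAt ℝ 1 s 0 := by
    refine ContDiffAt.sqrt (by fun_prop) (by norm_num)
  have ct : ContDiffAt ℝ 1 t 0 := by
    refine ContDiffAt.div contDiffAt_const ?_ (by rw [s0]; norm_num)
    exact ContDiffAt.add (by fun_prop) cs
  have cD : ContDiffAt ℝ 1 D 0 := by fun_prop
  have cB : ContDiffAt ℝ 1 B 0 :=
    (cD.sqrt (by rw [D0]; norm_num)).inv (by rw [D0]; norm_num)
  refine ⟨fun q => B q * (1 - q), fun q => t q * B q * (1 - q) ^ 2,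
    fun q => -(t q * B q ^ 2 * (1 - q) / 6) * (1 + 2 * q * t q), by fun_prop, by fun_prop,
    by fun_prop, by simp [B0], by simp [B0, t0], by norm_num [B0, t0], ?_⟩
  have e1 : ∀ᶠ q in 𝓝 (0 : ℝ), 0 < D q :=
    cD.continuousAt.tendsto.eventually_const_lt (by rw [D0]; norm_num)
  have e2 : ∀ᶠ q in 𝓝 (0 : ℝ), 0 < 1 + 5 * q + s q :=
    (ContinuousAt.add (by fun_prop) cs.continuousAt).tendsto.eventually_const_lt (by simp [s0])
  have e3 : ∀ᶠ q in 𝓝 (0 : ℝ), 0 < 1 - 14 * q + q ^ 2 :=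
    Tendsto.eventually_const_lt (by norm_num) (ContinuousAt.tendsto (by fun_prop))
  have e4 : ∀ᶠ q in 𝓝 (0 : ℝ), 0 < 1 - q :=
    Tendsto.eventually_const_lt (by norm_num) (ContinuousAt.tendsto (by fun_prop))
  filter_upwards [e1, e2, e3, e4] with q h1 h2 h3 h4 x
  have hss : s q ^ 2 = 1 - 14 * q + q ^ 2 := Real.sq_sqrt h3.le
  have htq : 1 + (1 + 5 * q) * t q + 6 * q * (1 + q) * t q ^ 2 = 0 := by
    simp only [ht]
    have h2' := h2.ne'
    field_simp
    linear_combination hss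
  have hBD : B q ^ 2 * D q = 1 := by
    simp only [hB]
    rw [inv_pow, Real.sq_sqrt h1.le, inv_mul_cancel₀ h1.ne']
  simp only [hD] at hBD
  generalize t q = τ at *
  generalize B q = β at *
  have h4' := h4.ne'
  have hG : geometricCubic q (β * (1 - q)) (τ * β * (1 - q) ^ 2) x =
      β ^ 3 * (1 - q) * (1 + 4 * q * τ + (2 * q + 5 * q ^ 2) * τ ^ 2 +
        2 * q ^ 2 * (1 + q) * τ ^ 3) +
      β ^ 3 * τ * (1 - q) ^ 2 * (1 + τ * (19 * q - 1) / 6 + τ ^ 2 * (2 * q + 7 * q ^ 2) / 3) * x +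
      β ^ 3 * τ ^ 2 * (1 - q) ^ 3 * (1 + 2 * q * τ) / 6 * x ^ 2 := by
    simp only [geometricCubic]
    field_simp
    ring
  rw [hG]
  linear_combination (β * (1 - q) + x * τ * β * (1 - q) ^ 2) * hBD -
    x * β ^ 3 * τ * (1 - q) ^ 2 * (1 + 2 * q * τ) / 6 * htq

/-- The ratio is `-p` so that the entry with index 3 is positive when `b + 3g` is near `-2`. -/
theorem exists_geometric_solution (b g : ℝ) {p : ℝ} (hp0 : 0 < p) (hp1 : p < 1) :
    ∃ x : SeqL1, (∀ n, x n = (b + g * n) * (-p) ^ n) ∧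
      ‖x - unit 0‖ ≤ |b - 1| + (|b| + |g|) * (p / (1 - p) ^ 2) ∧
      ∀ lam w : ℝ, (∀ n : ℕ, geometricCubic (p ^ 2) b g n = (lam - n * w) * (b + g * n)) →
        Solves lam w x := by
  have hs0 : HasSum (fun n : ℕ => (n : ℝ) * p ^ n) (p / (1 - p) ^ 2) :=
    hasSum_coe_mul_geometric_of_norm_lt_one (by rwa [Real.norm_of_nonneg hp0.le])
  have hle : ∀ n : ℕ, n ≠ 0 → |(b + g * n) * (-p) ^ n| ≤ (|b| + |g|) * (n * p ^ n) := by
    intro n hn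
    have hn1 : (1 : ℝ) ≤ n := by exact_mod_cast Nat.one_le_iff_ne_zero.2 hn
    rw [abs_mul, abs_pow, abs_neg, abs_of_pos hp0, ← mul_assoc]
    gcongr
    calc |b + g * n| ≤ |b| + |g * n| := abs_add_le _ _
      _ = |b| + |g| * n := by rw [abs_mul, Nat.abs_cast]
      _ ≤ _ := by nlinarith [abs_nonneg b]
  have hb1 : HasSum (fun n : ℕ => if n = 0 then |b - 1| else 0) |b - 1| := hasSum_ite_eq 0 _
  have hb2 : HasSum (fun n : ℕ => if n = 0 then |b| else 0) |b| := hasSum_ite_eq 0 _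
  have hsum : Summable fun n : ℕ => |(b + g * n) * (-p) ^ n| := by
    refine Summable.of_nonneg_of_le (fun _ => abs_nonneg _) (fun n => ?_)
      (hb2.add (hs0.mul_left (|b| + |g|))).summable
    by_cases hn : n = 0
    · simp [hn]
    · simpa [hn] using hle n hn
  refine ⟨ofSummable _ hsum, fun n => rfl, ?_, fun lam w h n => ?_⟩
  · refine hasSum_le (fun n => ?_) (SeqL1.hasSum_abs _) (hb1.add (hs0.mul_left (|b| + |g|)))
    rw [sub_apply', ofSummable_apply, unit_apply]
    by_cases hn : n = 0
    · simp [hn]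
    · simpa [hn] using hle n hn
  · have hp2 : |(-p) ^ 2| < 1 := by
      rw [neg_sq, abs_of_pos (by positivity)]
      nlinarith
    have h1 := (hasSum_cubic (ofSummable _ hsum) n).unique (hasSum_geometric_cubic hp2 g n b)
    have hn : (n : ℝ) + 1 ≠ 0 := by positivity
    have h2 : cubic (ofSummable _ hsum) n = (-p) ^ n * geometricCubic ((-p) ^ 2) b g n :=
      mul_left_cancel₀ hn (by rw [h1]; ring)
    rw [h2, neg_sq, h, ofSummable_apply]
    ring

theorem abs_cubic_le {θ τ k : ℝ} (hθ : |θ| ≤ k) (hτ : |τ| ≤ k) (hk : k ≤ 1 / 2) :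
    |-4 * τ + τ ^ 2 + 12 * θ - 12 * θ ^ 2 + 4 * θ ^ 3| ≤ 24 * k := by
  have e : -4 * τ + τ ^ 2 + 12 * θ - 12 * θ ^ 2 + 4 * θ ^ 3 =
    (-4 + τ) * τ + (12 - 12 * θ + 4 * θ ^ 2) * θ := by ring
  have a1 : |-4 + τ| ≤ 5 := by
    have := abs_le.1 (hτ.trans hk)
    exact abs_le.2 ⟨by linarith, by linarith⟩
  have a2 : |12 - 12 * θ + 4 * θ ^ 2| ≤ 19 := by
    have := abs_le.1 (hθ.trans hk)
    exact abs_le.2 ⟨by nlinarith, by nlinarith⟩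
  rw [e]
  refine (abs_add_le _ _).trans ?_
  rw [abs_mul, abs_mul]
  have b1 := mul_le_mul a1 hτ (abs_nonneg _) (by norm_num)
  have b2 := mul_le_mul a2 hθ (abs_nonneg _) (by norm_num)
  linarith

/-- For every small negative amplitude of mode `2` there is a stationary state with positive
amplitude of mode `3`. -/
theorem exists_solution_of_neg_amplitude : ∃ K > 0, ∀ η > 0, ∃ δ > 0, ∀ ε : ℝ, -δ < ε → ε < 0 →
    ∃ (μ w : ℝ) (x : SeqL1), Solves 1 w x ∧ ‖x - unit 0‖ < η ∧ |w - 1 / 6| < η ∧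
      x 2 = ε ∧ x 3 = μ ∧ 0 < μ ∧ |μ ^ 2 + 4 * ε ^ 3| ≤ K * |ε| ^ 4 := by
  obtain ⟨b, g, w, cb, cg, cw, b0, g0, w0, hG⟩ := exists_geometric_coefficients
  have d2 : DifferentiableAt ℝ (fun q => b q + 2 * g q) 0 :=
    (cb.add (contDiffAt_const.mul cg)).differentiableAt (by simp)
  have d3 : DifferentiableAt ℝ (fun q => b q + 3 * g q) 0 :=
    (cb.add (contDiffAt_const.mul cg)).differentiableAt (by simp)
  obtain ⟨K₂, hK₂⟩ := d2.isBigO_sub.bound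
  obtain ⟨K₃, hK₃⟩ := d3.isBigO_sub.bound
  simp only [b0, g0, sub_zero, Real.norm_eq_abs] at hK₂ hK₃
  set K := max 1 (max K₂ K₃) with hK
  have hKpos : 0 < K := lt_of_lt_of_le one_pos (le_max_left _ _)
  have hKK₂ : K₂ ≤ K := (le_max_left _ _).trans (le_max_right _ _)
  have hKK₃ : K₃ ≤ K := (le_max_right _ _).trans (le_max_right _ _)
  refine ⟨384 * K, by positivity, fun η hη => ?_⟩
  have hcont : ContinuousAt (fun q => |b q - 1| + (|b q| + |g q|) * (√q / (1 - √q) ^ 2)) 0 := by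
    have := cb.continuousAt
    have := cg.continuousAt
    have h1 : ContinuousAt (fun q => √q / (1 - √q) ^ 2) 0 :=
      ContinuousAt.div (by fun_prop) (by fun_prop) (by simp)
    fun_prop
  have e1 : ∀ᶠ q in 𝓝 (0 : ℝ), |b q - 1| + (|b q| + |g q|) * (√q / (1 - √q) ^ 2) < η :=
    hcont.tendsto.eventually_lt_const (by simpa [b0] using hη)
  have e2 : ∀ᶠ q in 𝓝 (0 : ℝ), |w q - 1 / 6| < η := by
    have : ContinuousAt (fun q => |w q - 1 / 6|) 0 := (cw.continuousAt.sub_const _).abs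
    exact this.tendsto.eventually_lt_const (by simpa [w0] using hη)
  have e3 : ∀ᶠ q in 𝓝 (0 : ℝ), ContinuousAt (fun q => (b q + 2 * g q) * q) q := by
    filter_upwards [cb.eventually (by simp), cg.eventually (by simp)] with q h1 h2
    have := h1.continuousAt
    have := h2.continuousAt
    fun_prop
  obtain ⟨q₁, hq₁, hall⟩ := Metric.eventually_nhds_iff.1
    (e1.and (e2.and (e3.and (hG.and (hK₂.and hK₃)))))
  set Q := min (q₁ / 2) (min (1 / 2) (1 / (2 * K))) with hQ
  have hQpos : 0 < Q := lt_min (by linarith) (lt_min (by norm_num) (by positivity))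
  have hQ1 : Q ≤ q₁ / 2 := min_le_left _ _
  have hQ2 : Q ≤ 1 / 2 := (min_le_right _ _).trans (min_le_left _ _)
  have hQ3 : K * Q ≤ 1 / 2 := by
    have : Q ≤ 1 / (2 * K) := (min_le_right _ _).trans (min_le_right _ _)
    calc K * Q ≤ K * (1 / (2 * K)) := by gcongr
      _ = 1 / 2 := by field_simp
  have hin : ∀ q ∈ Set.Icc 0 Q, dist q 0 < q₁ := fun q hq => by
    rw [Real.dist_0_eq_abs, abs_of_nonneg hq.1]
    linarith [hq.2]
  have hbound : ∀ q ∈ Set.Icc 0 Q, |b q + 2 * g q + 1| ≤ K * q ∧ |b q + 3 * g q + 2| ≤ K * q := by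
    intro q hq
    obtain ⟨-, -, -, -, h2, h3⟩ := hall (hin q hq)
    rw [abs_of_nonneg hq.1] at h2 h3
    constructor
    · calc _ = |b q + 2 * g q - (1 + 2 * -1)| := by congr 1; ring
        _ ≤ K₂ * q := h2
        _ ≤ K * q := mul_le_mul_of_nonneg_right hKK₂ hq.1
    · calc _ = |b q + 3 * g q - (1 + 3 * -1)| := by congr 1; ring
        _ ≤ K₃ * q := h3
        _ ≤ K * q := mul_le_mul_of_nonneg_right hKK₃ hq.1
  have hQQ : (b Q + 2 * g Q) * Q ≤ -(Q / 2) := by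
    have h1 := (abs_le.1 (hbound Q ⟨hQpos.le, le_rfl⟩).1).2
    nlinarith
  refine ⟨Q / 2, by linarith, fun ε hε1 hε0 => ?_⟩
  -- The amplitude `ε = (b + 2g)q ≈ -q` is prescribed, and a matching `q` is found by continuity.
  have hivt := intermediate_value_Ioo' hQpos.le (f := fun q => (b q + 2 * g q) * q)
    (fun q hq => (hall (hin q hq)).2.2.1.continuousWithinAt)
  obtain ⟨q, hq, hqε⟩ := hivt (show ε ∈ Set.Ioo _ _ from ⟨by linarith, by simpa using hε0⟩)
  simp only at hqε
  have hq' : q ∈ Set.Icc 0 Q := ⟨hq.1.le, hq.2.le⟩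
  obtain ⟨f1, f2, -, f4, -⟩ := hall (hin q hq')
  obtain ⟨f5, f6⟩ := hbound q hq'
  have hpos : 0 < √q := Real.sqrt_pos.2 hq.1
  have hsq : √q ^ 2 = q := Real.sq_sqrt hq.1.le
  have hp1 : √q < 1 := by
    rw [Real.sqrt_lt' one_pos]
    linarith [hq.2]
  obtain ⟨x, hx, hxn, hxs⟩ := exists_geometric_solution (b q) (g q) hpos hp1
  have hKq : K * q ≤ 1 / 2 := (mul_le_mul_of_nonneg_left hq.2.le hKpos.le).trans hQ3
  obtain ⟨θ, hθ⟩ : ∃ θ, b q + 2 * g q + 1 = θ := ⟨_, rfl⟩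
  obtain ⟨τ, hτ⟩ : ∃ τ, b q + 3 * g q + 2 = τ := ⟨_, rfl⟩
  rw [hθ] at f5
  rw [hτ] at f6
  obtain ⟨t1, t2⟩ := abs_le.1 f5
  obtain ⟨t3, t4⟩ := abs_le.1 f6
  have hε : ε = -(1 - θ) * q := by rw [← hqε, ← hθ]; ring
  refine ⟨x 3, w q, x, hxs 1 (w q) fun n => ?_, hxn.trans_lt f1, f2, ?_, rfl, ?_, ?_⟩
  · rw [hsq]
    exact f4 n
  · rw [hx, neg_sq, hsq, ← hqε]
    push_cast
    ring
  · rw [hx]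
    have h3 : b q + g q * (3 : ℕ) < 0 := by push_cast; linarith
    have h4 : (-√q) ^ 3 < 0 := by
      have := pow_pos hpos 3
      linarith [show (-√q) ^ 3 = -(√q) ^ 3 by ring]
    exact mul_pos_of_neg_of_neg h3 h4
  -- Here `μ² = (2-τ)²q³` and `ε = -(1-θ)q` with `θ, τ = O(q)`. The leading terms `4q³` cancel,
  -- which leaves an error of order `q⁴`.
  · have h1 : x 3 ^ 2 + 4 * ε ^ 3 = q ^ 3 * (-4 * τ + τ ^ 2 + 12 * θ - 12 * θ ^ 2 + 4 * θ ^ 3) := by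
      have h2 : x 3 ^ 2 = (-2 + τ) ^ 2 * (√q ^ 2) ^ 3 := by
        rw [hx, ← hτ]
        push_cast
        ring
      rw [h2, hsq, hε]
      ring
    have hq0 := hq.1
    have h3 := abs_cubic_le f5 f6 hKq
    have h5 : q ≤ 2 * |ε| := by
      rw [abs_of_neg hε0, hε]
      nlinarith
    rw [h1, abs_mul, abs_of_pos (pow_pos hq0 3)]
    calc _ ≤ q ^ 3 * (24 * (K * q)) := by gcongr
      _ = 24 * K * q ^ 4 := by ring
      _ ≤ 24 * K * (2 * |ε|) ^ 4 := by gcongr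
      _ = _ := by ring

end ConformalFlow

/-! ### The three branches of the lowest eigenmode. -/

namespace ConformalFlow

open Filter Topology SeqL1
open scoped ContDiff

set_option maxSynthPendingDepth 4

theorem amplitude_zero_base : amplitude 0 0 base = unit 0 := by
  ext n
  rw [amplitude_apply, base_apply, unit_apply]
  rcases Nat.lt_or_ge n 6 with h | h
  · interval_cases n <;> norm_num [baseEntry, evenExp, oddExp]
  · rw [baseEntry_eq_zero h, if_neg (by omega)]
    simp

theorem _root_.ContDiffOn.amplitude {P : Type*} [NormedAddCommGroup P] [NormedSpace ℝ P] {s : Set P}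
    {a b : P → ℝ} {x : P → SeqL1} (ha : ContDiffOn ℝ ω a s) (hb : ContDiffOn ℝ ω b s)
    (hx : ContDiffOn ℝ ω x s) : ContDiffOn ℝ ω (fun p => amplitude (a p) (b p) (x p)) s := by
  have e : (fun p => ConformalFlow.amplitude (a p) (b p) (x p)) = fun p =>
      ∑ i ∈ Finset.range 2, ∑ j ∈ Finset.range 2,
        (a p ^ i * b p ^ j) • restr {n | evenExp n = i ∧ oddExp n = j} (x p) := by
    funext p
    simp only [ConformalFlow.amplitude, Finset.sum_range_succ, Finset.sum_range_zero, zero_add,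
      add_apply, smul_apply]
  rw [e]
  exact ContDiffOn.sum fun i _ => ContDiffOn.sum fun j _ => ((ha.pow i).mul (hb.pow j)).smul
    ((restr {n | evenExp n = i ∧ oddExp n = j}).contDiff.comp_contDiffOn hx)

/-- The family of solutions of all equations except those with indices `2` and `3`; its parameters
are the amplitudes of these modes and `ω - 1/6`. The functions `K₂` and `K₃` are the remaining
residuals divided by the amplitudes; they depend on the square of the amplitude of mode `3`. -/
theorem exists_state_family : ∃ (Y : ℝ × ℝ × ℝ → SeqL1) (K₂ K₃ : ℝ × ℝ × ℝ → ℝ), ∃ r > 0,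
    r < 1 / 2000 ∧ ContDiffOn ℝ ω Y (Metric.ball 0 r) ∧ ContDiffOn ℝ ω K₂ (Metric.ball 0 r) ∧
    ContDiffOn ℝ ω K₃ (Metric.ball 0 r) ∧ K₂ 0 = 0 ∧ K₃ 0 = 0 ∧
    (∀ a b : ℝ, fderiv ℝ K₂ 0 (0, a, b) = 14 / 9 * a - 2 / 3 * b) ∧
    (∀ a b : ℝ, fderiv ℝ K₃ 0 (0, a, b) = 1 / 16 * a - 3 / 4 * b) ∧
    ∀ ε μ Ω : ℝ, (ε, μ, Ω) ∈ Metric.ball (0 : ℝ × ℝ × ℝ) r →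
      ‖Y (ε, μ, Ω) - unit 0‖ < 1 / 2000 ∧ Y (ε, μ, Ω) 2 = ε ∧ Y (ε, μ, Ω) 3 = μ ∧
      (∀ n : ℕ, n ≠ 2 → n ≠ 3 →
        (1 - n * (1 / 6 + Ω)) * Y (ε, μ, Ω) n = cubic (Y (ε, μ, Ω)) n) ∧
      (1 - (2 : ℕ) * (1 / 6 + Ω)) * Y (ε, μ, Ω) 2 - cubic (Y (ε, μ, Ω)) 2 =
        3 * (ε * K₂ (ε, μ ^ 2, Ω)) ∧
      (1 - (3 : ℕ) * (1 / 6 + Ω)) * Y (ε, μ, Ω) 3 - cubic (Y (ε, μ, Ω)) 3 =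
        4 * (μ * K₃ (ε, μ ^ 2, Ω)) := by
  obtain ⟨X, r, hr, hX0, hXc, hXs, k2, k3, d2, d3⟩ := exists_reduced_family
  set σ : ℝ × ℝ × ℝ → ℝ × ℝ × ℝ := fun p => (p.1, p.2.1 ^ 2, p.2.2) with hσ
  set Y : ℝ × ℝ × ℝ → SeqL1 := fun p => amplitude p.1 p.2.1 (X (σ p)) with hY
  have hσc : ContDiff ℝ ω σ := by fun_prop
  have hσm : ∀ s ≤ 1, ∀ p ∈ Metric.ball (0 : ℝ × ℝ × ℝ) s, σ p ∈ Metric.ball 0 s := by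
    intro s hs p hp
    simp only [hσ, mem_ball_zero_iff, Prod.norm_def, sup_lt_iff, Real.norm_eq_abs] at hp ⊢
    refine ⟨hp.1, ?_, hp.2.2⟩
    rw [abs_pow]
    nlinarith [abs_nonneg p.2.1]
  have hYc : ContDiffOn ℝ ω Y (Metric.ball 0 (min r 1)) := by
    have h1 : ContDiffOn ℝ ω (fun p => X (σ p)) (Metric.ball 0 (min r 1)) :=
      hXc.comp hσc.contDiffOn fun p hp =>
        Metric.ball_subset_ball (min_le_left _ _) (hσm _ (min_le_right _ _) p hp)
    exact ContDiffOn.amplitude (by fun_prop) (by fun_prop) h1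
  have hY0 : Y 0 = unit 0 := by
    have : σ 0 = 0 := by simp [hσ]
    simp only [hY, this, hX0]
    exact amplitude_zero_base
  have hclose : ∀ᶠ p in 𝓝 (0 : ℝ × ℝ × ℝ), ‖Y p - unit 0‖ < 1 / 2000 := by
    have h1 : ContinuousAt Y 0 := (hYc.contDiffAt
      (Metric.ball_mem_nhds _ (lt_min hr one_pos))).continuousAt
    have h2 : ContinuousAt (fun p => ‖Y p - unit 0‖) 0 := (h1.sub_const _).norm
    exact h2.tendsto.eventually_lt_const (by simp [hY0])
  obtain ⟨r', hr', hball⟩ := Metric.eventually_nhds_iff_ball.1 hclose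
  have hpair : ContDiffOn ℝ ω (fun p => (p, X p)) (Metric.ball 0 r) := contDiffOn_id.prodMk hXc
  have hK : ∀ n : ℕ, ContDiffOn ℝ ω (fun p => residual p (X p) n) (Metric.ball 0 r) := fun n =>
    ContDiff.comp_contDiffOn (g := coord n) (f := fun p => residual p (X p)) (coord n).contDiff
      (ContDiff.comp_contDiffOn (g := fun q : (ℝ × ℝ × ℝ) × SeqL1 => residual q.1 q.2)
        (f := fun p => (p, X p)) contDiff_residual hpair)
  set R := min (min r 1) (min r' (1 / 3000)) with hR
  have hRr : R ≤ min r 1 := min_le_left _ _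
  have hRr' : R ≤ r' := (min_le_right _ _).trans (min_le_left _ _)
  have hR3 : R ≤ 1 / 3000 := (min_le_right _ _).trans (min_le_right _ _)
  have hRr0 : R ≤ r := hRr.trans (min_le_left _ _)
  refine ⟨Y, fun p => residual p (X p) 2, fun p => residual p (X p) 3, R,
    lt_min (lt_min hr one_pos) (lt_min hr' (by norm_num)), hR3.trans_lt (by norm_num),
    hYc.mono (Metric.ball_subset_ball hRr), (hK 2).mono (Metric.ball_subset_ball hRr0),
    (hK 3).mono (Metric.ball_subset_ball hRr0), by simpa only [hX0] using k2,
    by simpa only [hX0] using k3, d2, d3, fun ε μ Ω hp => ?_⟩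
  have hp' : (ε, μ ^ 2, Ω) ∈ Metric.ball (0 : ℝ × ℝ × ℝ) r :=
    Metric.ball_subset_ball hRr0 (hσm _ (hR3.trans (by norm_num)) _ hp)
  obtain ⟨x2, x3, hres⟩ := hXs _ hp'
  have hYe : Y (ε, μ, Ω) = amplitude ε μ (X (ε, μ ^ 2, Ω)) := rfl
  have hmain : ∀ n : ℕ, (1 - n * (1 / 6 + Ω)) * Y (ε, μ, Ω) n - cubic (Y (ε, μ, Ω)) n =
      (n + 1) * (ε ^ evenExp n * μ ^ oddExp n * residual (ε, μ ^ 2, Ω) (X (ε, μ ^ 2, Ω)) n) := by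
    intro n
    have hn : (n : ℝ) + 1 ≠ 0 := by positivity
    rw [hYe, cubic_amplitude_apply, amplitude_apply, residual_apply]
    field_simp
  refine ⟨hball _ (Metric.ball_subset_ball hRr' hp), ?_, ?_, fun n hn2 hn3 => ?_, ?_, ?_⟩
  · rw [hYe, amplitude_apply, x2]
    simp [evenExp, oddExp]
  · rw [hYe, amplitude_apply, x3]
    simp [evenExp, oddExp]
  · rw [← sub_eq_zero, hmain, hres n hn2 hn3]
    ring
  · rw [hmain, show evenExp 2 = 1 by rfl, show oddExp 2 = 0 by rfl]
    push_cast
    ring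
  · rw [hmain, show evenExp 3 = 0 by rfl, show oddExp 3 = 1 by rfl]
    push_cast
    ring

/-- The solutions near the single-mode state: `Ω₁`, `Ω₂`, `Ω₃` are the values of `ω - 1/6` on the
three branches, and `ν` is the square of the amplitude of mode `3` on the third one. -/
theorem exists_branch_functions : ∃ (Y : ℝ × ℝ × ℝ → SeqL1) (Ω₁ Ω₂ Ω₃ ν : ℝ → ℝ), ∃ r > 0, ∃ s > 0,
    r < 1 / 2000 ∧ s ≤ r ∧ ContDiffOn ℝ ω Y (Metric.ball 0 r) ∧
    (∀ f ∈ [Ω₁, Ω₂, Ω₃, ν], ContDiffOn ℝ ω f (Metric.ball 0 s) ∧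
      ∀ t ∈ Metric.ball (0 : ℝ) s, |f t| < r) ∧
    (∀ ε μ Ω : ℝ, |ε| < r → |μ| < r → |Ω| < r →
      ‖Y (ε, μ, Ω) - unit 0‖ < 1 / 2000 ∧ Y (ε, μ, Ω) 2 = ε ∧ Y (ε, μ, Ω) 3 = μ) ∧
    (∀ μ, |μ| < s → Solves 1 (1 / 6 + Ω₁ (μ ^ 2)) (Y (0, μ, Ω₁ (μ ^ 2)))) ∧
    (∀ ε, |ε| < s → Solves 1 (1 / 6 + Ω₂ ε) (Y (ε, 0, Ω₂ ε))) ∧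
    (∀ ε μ, |ε| < s → |μ| < s → μ ^ 2 = ν ε → Solves 1 (1 / 6 + Ω₃ ε) (Y (ε, μ, Ω₃ ε))) ∧
    ∀ (w : ℝ) (x : SeqL1), |w - 1 / 6| < s → ‖x - unit 0‖ < s → Solves 1 w x →
      x = Y (x 2, x 3, w - 1 / 6) ∧ (x 2 = 0 → x 3 ≠ 0 → w - 1 / 6 = Ω₁ (x 3 ^ 2)) ∧
      (x 2 ≠ 0 → x 3 = 0 → w - 1 / 6 = Ω₂ (x 2)) ∧
      (x 2 ≠ 0 → x 3 ≠ 0 → x 3 ^ 2 = ν (x 2) ∧ w - 1 / 6 = Ω₃ (x 2)) := by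
  obtain ⟨Y, K₂, K₃, r, hr, hr1, hYc, hK₂, hK₃, z2, z3, d2, d3, hY⟩ := exists_state_family
  have hr0 : Metric.ball (0 : ℝ × ℝ × ℝ) r ∈ 𝓝 0 := Metric.ball_mem_nhds _ hr
  have c2 := hK₂.contDiffAt hr0
  have c3 := hK₃.contDiffAt hr0
  have f2 : HasFDerivAt K₂ (fderiv ℝ K₂ 0) 0 := (c2.differentiableAt (by simp)).hasFDerivAt
  have f3 : HasFDerivAt K₃ (fderiv ℝ K₃ 0) 0 := (c3.differentiableAt (by simp)).hasFDerivAt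
  have o0 : (0 : ℝ × ℝ × ℝ) = ((0 : ℝ), (0 : ℝ), (0 : ℝ)) := rfl
  have oo : (0 : ℝ × ℝ) = ((0 : ℝ), (0 : ℝ)) := rfl
  -- Branch `ε = 0`: equation 2 holds trivially and `K₃(0, ν, Ω) = 0` is solved for `Ω`.
  obtain ⟨Ω₁, r₁, hr₁, L₁, -, hΩ₁, cΩ₁, sΩ₁, uΩ₁⟩ := exists_analytic_implicit
    (f := fun q : ℝ × ℝ => K₃ (0, q.1, q.2)) (p₀ := 0) (y₀ := 0)
    (ContDiffAt.comp (g := K₃) (f := fun q : ℝ × ℝ => ((0 : ℝ), q.1, q.2)) ((0 : ℝ), (0 : ℝ)) c3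
      (by fun_prop)) z3
    (ContinuousLinearEquiv.unitsEquivAut ℝ (Units.mk0 (-3 / 4 : ℝ) (by norm_num))) fun h => by
      have h1 : HasFDerivAt (fun q : ℝ × ℝ => K₃ (0, q.1, q.2))
          ((fderiv ℝ K₃ 0).comp (ContinuousLinearMap.inr ℝ ℝ (ℝ × ℝ))) (0, 0) :=
        HasFDerivAt.comp (g := K₃) (f := ContinuousLinearMap.inr ℝ ℝ (ℝ × ℝ)) ((0 : ℝ), (0 : ℝ)) f3
          (ContinuousLinearMap.hasFDerivAt _)
      rw [h1.fderiv, ContinuousLinearMap.comp_apply, ContinuousLinearMap.inr_apply, d3,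
        ContinuousLinearEquiv.unitsEquivAut_apply, Units.val_mk0]
      ring
  -- Branch `μ = 0`: equation 3 holds trivially and `K₂(ε, 0, Ω) = 0` is solved for `Ω`.
  obtain ⟨Ω₂, r₂, hr₂, L₂, -, hΩ₂, cΩ₂, sΩ₂, uΩ₂⟩ := exists_analytic_implicit
    (f := fun q : ℝ × ℝ => K₂ (q.1, 0, q.2)) (p₀ := 0) (y₀ := 0)
    (ContDiffAt.comp (g := K₂) (f := fun q : ℝ × ℝ => (q.1, (0 : ℝ), q.2)) ((0 : ℝ), (0 : ℝ)) c2
      (by fun_prop)) z2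
    (ContinuousLinearEquiv.unitsEquivAut ℝ (Units.mk0 (-2 / 3 : ℝ) (by norm_num))) fun h => by
      set T : ℝ × ℝ →L[ℝ] ℝ × ℝ × ℝ := (ContinuousLinearMap.fst ℝ ℝ ℝ).prod
        ((0 : ℝ × ℝ →L[ℝ] ℝ).prod (ContinuousLinearMap.snd ℝ ℝ ℝ)) with hT
      have h1 : HasFDerivAt (fun q : ℝ × ℝ => K₂ (q.1, 0, q.2)) ((fderiv ℝ K₂ 0).comp T) (0, 0) :=
        HasFDerivAt.comp (g := K₂) (f := T) ((0 : ℝ), (0 : ℝ)) f2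
          (ContinuousLinearMap.hasFDerivAt _)
      have h2 : T (0, h) = (0, 0, h) := rfl
      rw [h1.fderiv, ContinuousLinearMap.comp_apply, h2, d2,
        ContinuousLinearEquiv.unitsEquivAut_apply, Units.val_mk0]
      ring
  -- Both amplitudes nonzero: `K₂ = K₃ = 0` is solved for `(ν, Ω)`. The Jacobian has determinant
  -- `-9/8`, and its explicit inverse is supplied. No sign of `ν` is imposed at this point.
  obtain ⟨F, r₃, hr₃, L₃, -, hF, cF, sF, uF⟩ := exists_analytic_implicit
    (f := fun q : ℝ × ℝ × ℝ => (K₂ q, K₃ q)) (p₀ := 0) (y₀ := 0)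
    (c2.prodMk c3) (Prod.ext z2 z3)
    (ContinuousLinearEquiv.equivOfInverse
      (((14 / 9 : ℝ) • ContinuousLinearMap.fst ℝ ℝ ℝ -
        (2 / 3 : ℝ) • ContinuousLinearMap.snd ℝ ℝ ℝ).prod
        ((1 / 16 : ℝ) • ContinuousLinearMap.fst ℝ ℝ ℝ -
          (3 / 4 : ℝ) • ContinuousLinearMap.snd ℝ ℝ ℝ))
      (((2 / 3 : ℝ) • ContinuousLinearMap.fst ℝ ℝ ℝ -
        (16 / 27 : ℝ) • ContinuousLinearMap.snd ℝ ℝ ℝ).prod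
        ((1 / 18 : ℝ) • ContinuousLinearMap.fst ℝ ℝ ℝ -
          (112 / 81 : ℝ) • ContinuousLinearMap.snd ℝ ℝ ℝ))
      (fun v => by ext <;> simp <;> ring) (fun v => by ext <;> simp <;> ring)) fun h => by
      have h1 : HasFDerivAt (fun q : ℝ × ℝ × ℝ => (K₂ q, K₃ q))
          ((fderiv ℝ K₂ 0).prod (fderiv ℝ K₃ 0)) (0, 0) := f2.prodMk f3
      rw [h1.fderiv]
      obtain ⟨a, b⟩ := h
      refine Prod.ext ?_ ?_
      · exact d2 a b
      · exact d3 a b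
  have small : ∀ (f : ℝ → ℝ), ContinuousAt f 0 → f 0 = 0 → ∀ᶠ t in 𝓝 (0 : ℝ), |f t| < r :=
    fun f hf h0 => hf.abs.tendsto.eventually_lt_const (by simpa [h0] using hr)
  have cF1 : ContDiffOn ℝ ω (fun t => (F t).1) (Metric.ball 0 r₃) := contDiff_fst.comp_contDiffOn cF
  have cF2 : ContDiffOn ℝ ω (fun t => (F t).2) (Metric.ball 0 r₃) := contDiff_snd.comp_contDiffOn cF
  obtain ⟨s', hs', hall⟩ := Metric.eventually_nhds_iff_ball.1
    ((small Ω₁ (cΩ₁.contDiffAt (Metric.ball_mem_nhds _ hr₁)).continuousAt hΩ₁).and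
    ((small Ω₂ (cΩ₂.contDiffAt (Metric.ball_mem_nhds _ hr₂)).continuousAt hΩ₂).and
    ((small _ (cF2.contDiffAt (Metric.ball_mem_nhds _ hr₃)).continuousAt (by simp [hF])).and
    (small _ (cF1.contDiffAt (Metric.ball_mem_nhds _ hr₃)).continuousAt (by simp [hF])))))
  set s := min (min r s') (min r₁ (min r₂ r₃)) with hs
  have hspos : 0 < s := lt_min (lt_min hr hs') (lt_min hr₁ (lt_min hr₂ hr₃))
  have l0 : s ≤ r := (min_le_left _ _).trans (min_le_left _ _)
  have l' : s ≤ s' := (min_le_left _ _).trans (min_le_right _ _)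
  have l1 : s ≤ r₁ := (min_le_right _ _).trans (min_le_left _ _)
  have l2 : s ≤ r₂ := (min_le_right _ _).trans ((min_le_right _ _).trans (min_le_left _ _))
  have l3 : s ≤ r₃ := (min_le_right _ _).trans ((min_le_right _ _).trans (min_le_right _ _))
  have hsq : ∀ μ : ℝ, |μ| < s → |μ ^ 2| < s := fun μ hμ => by
    rw [abs_pow]
    nlinarith [abs_nonneg μ]
  have m1 : ∀ {t ρ : ℝ}, |t| < ρ → t ∈ Metric.ball (0 : ℝ) ρ := fun h => by
    simpa [mem_ball_zero_iff] using h
  have m3 : ∀ {a b c ρ : ℝ}, |a| < ρ → |b| < ρ → |c| < ρ →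
      (a, b, c) ∈ Metric.ball (0 : ℝ × ℝ × ℝ) ρ := fun h1 h2 h3 => by
    simp only [mem_ball_zero_iff, Prod.norm_def, sup_lt_iff, Real.norm_eq_abs]
    exact ⟨h1, h2, h3⟩
  have hsolves : ∀ ε μ Ω : ℝ, |ε| < r → |μ| < r → |Ω| < r → ε * K₂ (ε, μ ^ 2, Ω) = 0 →
      μ * K₃ (ε, μ ^ 2, Ω) = 0 → Solves 1 (1 / 6 + Ω) (Y (ε, μ, Ω)) := by
    intro ε μ Ω h1 h2 h3 hk2 hk3 n
    obtain ⟨-, -, -, e, e2, e3⟩ := hY ε μ Ω (m3 h1 h2 h3)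
    by_cases hn2 : n = 2
    · subst hn2
      rw [hk2, mul_zero] at e2
      exact sub_eq_zero.1 e2
    by_cases hn3 : n = 3
    · subst hn3
      rw [hk3, mul_zero] at e3
      exact sub_eq_zero.1 e3
    exact e n hn2 hn3
  have z : |(0 : ℝ)| < r := by simpa using hr
  refine ⟨Y, Ω₁, Ω₂, fun t => (F t).2, fun t => (F t).1, r, hr, s, hspos, hr1, l0, hYc, ?_,
    fun ε μ Ω h1 h2 h3 => ?_, fun μ hμ => ?_, fun ε hε => ?_, fun ε μ hε hμ hμν => ?_,
    fun w x hw hx hsol => ?_⟩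
  · intro f hf
    have hall' := fun t ht => hall t (Metric.ball_subset_ball l' ht)
    simp only [List.mem_cons, List.not_mem_nil, or_false] at hf
    rcases hf with rfl | rfl | rfl | rfl
    · exact ⟨cΩ₁.mono (Metric.ball_subset_ball l1), fun t ht => (hall' t ht).1⟩
    · exact ⟨cΩ₂.mono (Metric.ball_subset_ball l2), fun t ht => (hall' t ht).2.1⟩
    · exact ⟨cF2.mono (Metric.ball_subset_ball l3), fun t ht => (hall' t ht).2.2.1⟩
    · exact ⟨cF1.mono (Metric.ball_subset_ball l3), fun t ht => (hall' t ht).2.2.2⟩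
  · obtain ⟨a1, a2, a3, -⟩ := hY ε μ Ω (m3 h1 h2 h3)
    exact ⟨a1, a2, a3⟩
  · have h := hsq μ hμ
    refine hsolves _ _ _ z (hμ.trans_le l0) (hall _ (m1 (h.trans_le l'))).1 (zero_mul _) ?_
    rw [sΩ₁ _ (m1 (h.trans_le l1)), mul_zero]
  · refine hsolves _ _ _ (hε.trans_le l0) z (hall _ (m1 (hε.trans_le l'))).2.1 ?_ (zero_mul _)
    rw [zero_pow two_ne_zero, sΩ₂ _ (m1 (hε.trans_le l2)), mul_zero]
  · have h := sF ε (m1 (hε.trans_le l3))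
    have h2 : K₂ (ε, μ ^ 2, (F ε).2) = 0 := by rw [hμν]; exact congrArg Prod.fst h
    have h3 : K₃ (ε, μ ^ 2, (F ε).2) = 0 := by rw [hμν]; exact congrArg Prod.snd h
    refine hsolves _ _ _ (hε.trans_le l0) (hμ.trans_le l0)
      (hall _ (m1 (hε.trans_le l'))).2.2.1 ?_ ?_
    · rw [h2, mul_zero]
    · rw [h3, mul_zero]
  · have hx2 : |x 2| < s := by
      have := (x - unit 0).abs_apply_le 2
      rw [sub_apply', unit_apply, if_neg (by norm_num), sub_zero] at this
      exact this.trans_lt hx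
    have hx3 : |x 3| < s := by
      have := (x - unit 0).abs_apply_le 3
      rw [sub_apply', unit_apply, if_neg (by norm_num), sub_zero] at this
      exact this.trans_lt hx
    obtain ⟨a1, a2, a3, e, e2, e3⟩ := hY (x 2) (x 3) (w - 1 / 6)
      (m3 (hx2.trans_le l0) (hx3.trans_le l0) (hw.trans_le l0))
    have hw' : 1 / 6 + (w - 1 / 6) = w := by ring
    rw [hw'] at e e2 e3
    -- The exact solution and the family member share `ω` and the two kernel amplitudes and satisfy
    -- the same equations off the kernel.
    have hxY : x = Y (x 2, x 3, w - 1 / 6) := eq_of_solves_off_kernel (by linarith)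
      (by linarith) a1 (fun n _ _ => hsol n) e a2.symm a3.symm
    rw [← hxY, hsol 2, sub_self] at e2
    rw [← hxY, hsol 3, sub_self] at e3
    have k2 : x 2 ≠ 0 → K₂ (x 2, x 3 ^ 2, w - 1 / 6) = 0 := fun h => by
      have := mul_left_cancel₀ (three_ne_zero' ℝ) ((mul_zero _).trans e2)
      exact (mul_eq_zero.1 this.symm).resolve_left h
    have k3 : x 3 ≠ 0 → K₃ (x 2, x 3 ^ 2, w - 1 / 6) = 0 := fun h => by
      have := mul_left_cancel₀ (four_ne_zero' ℝ) ((mul_zero _).trans e3)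
      exact (mul_eq_zero.1 this.symm).resolve_left h
    refine ⟨hxY, fun h2 h3 => ?_, fun h2 h3 => ?_, fun h2 h3 => ?_⟩
    · have h := uΩ₁ (x 3 ^ 2) (m1 ((hsq _ hx3).trans_le l1)) (w - 1 / 6) (m1 (hw.trans_le l1))
      have h' := k3 h3
      rw [h2] at h'
      simp only [h', norm_zero, mul_zero] at h
      exact sub_eq_zero.1 (norm_le_zero_iff.1 h)
    · have h := uΩ₂ (x 2) (m1 (hx2.trans_le l2)) (w - 1 / 6) (m1 (hw.trans_le l2))
      have h' := k2 h2
      rw [h3, zero_pow two_ne_zero] at h'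
      simp only [h', norm_zero, mul_zero] at h
      exact sub_eq_zero.1 (norm_le_zero_iff.1 h)
    · have h := uF (x 2) (m1 (hx2.trans_le l3)) (x 3 ^ 2, w - 1 / 6) (by
        simp only [mem_ball_zero_iff, Prod.norm_def, sup_lt_iff, Real.norm_eq_abs]
        exact ⟨(hsq _ hx3).trans_le l3, hw.trans_le l3⟩)
      simp only [k2 h2, k3 h3, Prod.mk_zero_zero, norm_zero, mul_zero] at h
      have h' := sub_eq_zero.1 (norm_le_zero_iff.1 h)
      exact ⟨congrArg Prod.fst h', congrArg Prod.snd h'⟩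

/-- A one-sided bound by a power for an analytic function is two-sided. -/
theorem analyticAt_isBigO_pow_of_left {f : ℝ → ℝ} (hf : AnalyticAt ℝ f 0) {N : ℕ}
    (h : f =O[𝓝[<] 0] fun t => t ^ N) : f =O[𝓝 0] fun t => t ^ N := by
  by_cases hz : ∀ᶠ t in 𝓝 0, f t = 0
  · exact (Asymptotics.isBigO_zero _ _).congr' (hz.mono fun t ht => ht.symm) EventuallyEq.rfl
  -- A nonzero analytic function behaves like a fixed power `tⁿ` on both sides; the bound from the
  -- left alone forces `n ≥ N`.
  obtain ⟨n, g, hg, hg0, hfg⟩ := hf.exists_eventuallyEq_pow_smul_nonzero_iff.2 hz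
  simp only [sub_zero, smul_eq_mul] at hfg
  have hgc := hg.continuousAt
  rcases Nat.lt_or_ge n N with hn | hn
  · exfalso
    obtain ⟨C, hC⟩ := h.bound
    have h1 : ∀ᶠ t in 𝓝[<] (0 : ℝ), ‖g t‖ ≤ C * ‖t ^ (N - n)‖ := by
      filter_upwards [hC, hfg.filter_mono nhdsWithin_le_nhds, self_mem_nhdsWithin] with t h2 h3 h4
      have ht : 0 < ‖t ^ n‖ := norm_pos_iff.2 (pow_ne_zero _ (ne_of_lt h4))
      rw [h3, norm_mul, ← Nat.sub_add_cancel hn.le, pow_add, norm_mul] at h2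
      refine le_of_mul_le_mul_left ?_ ht
      linarith
    have h2 : Tendsto (fun t : ℝ => C * ‖t ^ (N - n)‖) (𝓝[<] 0) (𝓝 (C * ‖(0 : ℝ) ^ (N - n)‖)) :=
      (ContinuousAt.tendsto (by fun_prop)).mono_left nhdsWithin_le_nhds
    rw [zero_pow (by omega), norm_zero, mul_zero] at h2
    have h3 := le_of_tendsto_of_tendsto (hgc.norm.tendsto.mono_left nhdsWithin_le_nhds) h2 h1
    exact hg0 (norm_le_zero_iff.1 h3)
  · refine EventuallyEq.trans_isBigO (show f =ᶠ[𝓝 0] fun t => t ^ n * g t from hfg) ?_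
    have h1 : (fun t : ℝ => t ^ n) =O[𝓝 0] fun t => t ^ N := by
      refine Asymptotics.IsBigO.of_bound 1 ?_
      filter_upwards [Metric.ball_mem_nhds (0 : ℝ) one_pos] with t ht
      rw [mem_ball_zero_iff] at ht
      rw [norm_pow, norm_pow, one_mul]
      exact pow_le_pow_of_le_one (norm_nonneg _) ht.le hn
    have h2 : g =O[𝓝 0] fun _ => (1 : ℝ) := hgc.isBigO_one ℝ
    simpa using h1.mul h2

/-- Factor the difference of squares `ν - 4|ε|³` and divide by `√ν + 2|ε|^{3/2} ≥ |ε|^{3/2}`. This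
would give `|ε|^{5/2}`; the weaker power 2 suffices for the statement. -/
theorem abs_sqrt_sub_le {ε ν K : ℝ} (hε : ε < 0) (hε1 : -1 < ε) (hK : 0 ≤ K) (hν : 0 ≤ ν)
    (h : |ν + 4 * ε ^ 3| ≤ K * |ε| ^ 4) : |√ν - 2 * |ε| ^ (3 / 2 : ℝ)| ≤ K * ε ^ 2 := by
  set e := |ε| with he
  have he0 : 0 < e := abs_pos.2 hε.ne
  have he1 : e ≤ 1 := by rw [he, abs_of_neg hε]; linarith
  have hεe : ε = -e := by rw [he, abs_of_neg hε]; ring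
  set a := e ^ (3 / 2 : ℝ) with ha
  have ha0 : 0 < a := Real.rpow_pos_of_pos he0 _
  have ha2 : a ^ 2 = e ^ 3 := by
    rw [ha, ← Real.rpow_natCast, ← Real.rpow_mul he0.le, ← Real.rpow_natCast]
    norm_num
  have hea : e ^ 2 ≤ a := by
    rw [ha, ← Real.rpow_natCast]
    exact Real.rpow_le_rpow_of_exponent_ge he0 he1 (by norm_num)
  have hm : √ν ^ 2 = ν := Real.sq_sqrt hν
  have hm0 : 0 ≤ √ν := Real.sqrt_nonneg _
  have h1 : ν + 4 * ε ^ 3 = (√ν - 2 * a) * (√ν + 2 * a) := by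
    rw [hεe]
    linear_combination -hm + 4 * ha2
  rw [h1, abs_mul, abs_of_pos (show 0 < √ν + 2 * a by positivity)] at h
  have h2 : |√ν - 2 * a| * a ≤ K * e ^ 2 * a := by
    calc |√ν - 2 * a| * a ≤ |√ν - 2 * a| * (√ν + 2 * a) := by gcongr; linarith
      _ ≤ K * e ^ 4 := h
      _ = K * e ^ 2 * e ^ 2 := by ring
      _ ≤ K * e ^ 2 * a := by gcongr
  rw [hεe, neg_sq]
  exact le_of_mul_le_mul_right h2 ha0

theorem norm_alternate_sub_le (x : SeqL1) : ‖alternate x - unit 0‖ ≤ ‖x - unit 0‖ := by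
  refine norm_le_of_abs_le fun n => ?_
  rw [sub_apply', sub_apply', alternate_apply, unit_apply]
  by_cases hn : n = 0
  · simp [hn]
  · simp [hn, abs_mul]

theorem alternate_alternate (x : SeqL1) : alternate (alternate x) = x := by
  ext n
  rw [alternate_apply, alternate_apply, ← mul_assoc, ← mul_pow]
  simp

/-- This excludes the third branch for `ε > 0`, since there `μ² = ν` would be negative. -/
theorem neg_of_abs_add_le {ε ν K : ℝ} (hε : 0 < ε) (hK : K * ε < 4)
    (h : |ν + 4 * ε ^ 3| ≤ K * |ε| ^ 4) : ν < 0 := by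
  rw [abs_of_pos hε] at h
  have h1 := (abs_le.1 h).2
  have h2 : 0 < ε ^ 3 := pow_pos hε 3
  nlinarith

theorem pos_lt_of_abs_add_le {ε ν K δ : ℝ} (hε : ε < 0) (hεδ : -δ < ε) (hK : 0 ≤ K)
    (hδ : (4 + K) * δ < 1) (hδ1 : δ < 1) (h : |ν + 4 * ε ^ 3| ≤ K * |ε| ^ 4) :
    0 < ν ∧ ν < δ ^ 2 := by
  set e := |ε| with he
  have he0 : 0 < e := abs_pos.2 hε.ne
  have hed : e < δ := by rw [he, abs_of_neg hε]; linarith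
  have hεe : ε = -e := by rw [he, abs_of_neg hε]; ring
  obtain ⟨h1, h2⟩ := abs_le.1 h
  have e4 : e ^ 4 = e * e ^ 3 := by ring
  have e3 : ε ^ 3 = -e ^ 3 := by rw [hεe]; ring
  have he3 : 0 < e ^ 3 := pow_pos he0 3
  have hKe : K * e ≤ K * δ := by gcongr
  rw [e3, e4] at h1 h2
  have hKe3 : K * (e * e ^ 3) = K * e * e ^ 3 := by ring
  rw [hKe3] at h1 h2
  have hδ0 : 0 < δ := he0.trans hed
  have hle : K * e * e ^ 3 ≤ K * e ^ 3 := by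
    have : K * e ≤ K := by nlinarith
    gcongr
  constructor
  · nlinarith
  · have h5 : e ^ 3 ≤ δ * δ ^ 2 := by
      rw [← pow_succ']
      gcongr
    calc ν ≤ (4 + K) * e ^ 3 := by linarith
      _ ≤ (4 + K) * (δ * δ ^ 2) := by gcongr
      _ = ((4 + K) * δ) * δ ^ 2 := by ring
      _ < 1 * δ ^ 2 := by gcongr
      _ = δ ^ 2 := one_mul _

/-- The three branches as families of summable sequences. -/
theorem exists_branches : ∃ (W : Fin 3 → ℝ × ℝ → ℝ) (a : Fin 3 → ℝ × ℝ → SeqL1) (m : ℝ → ℝ),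
    ∃ δ > 0, ∃ C : ℝ,
    (∀ i, ContDiffOn ℝ ((⊤ : ℕ∞) : WithTop ℕ∞) (W i) (Metric.ball 0 δ) ∧
      ContDiffOn ℝ ((⊤ : ℕ∞) : WithTop ℕ∞) (a i) (Metric.ball 0 δ)) ∧
    ContDiffOn ℝ ((⊤ : ℕ∞) : WithTop ℕ∞) m (Set.Ioo (-δ) 0) ∧
    (∀ ε ∈ Set.Ioo (-δ) 0,
      0 < m ε ∧ m ε < δ ∧ |m ε - 2 * |ε| ^ (3 / 2 : ℝ)| ≤ C * ε ^ 2) ∧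
    (∀ i, ∀ x ∈ branchCurve m δ i, |W i x - 1 / 6| < 1 / 1000 ∧ Solves 1 (W i x) (a i x) ∧
      a i x 2 = x.1 ∧ a i x 3 = x.2 ∧
      |W i x - 1 / 6| + ‖a i x - unit 0 - x.1 • unit 2 - x.2 • unit 3‖ ≤
        C * (x.1 ^ 2 + x.2 ^ 2)) ∧
    ∃ η > 0, ∀ (w : ℝ) (x : SeqL1), |w - 1 / 6| < η → ‖x - unit 0‖ < η → Solves 1 w x →
      x = unit 0 ∨ (∃ i, ∃ z ∈ branchCurve m δ i, w = W i z ∧ x = a i z) ∨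
      ∃ z ∈ branchCurve m δ 2, w = W 2 z ∧ x = alternate (a 2 z) := by
  obtain ⟨Y, Ω₁, Ω₂, Ω₃, ν, r, hr, s, hs, hr1, hsr, hYc, hfun, hY, S1, S2, S3, huniq⟩ :=
    exists_branch_functions
  obtain ⟨cΩ₁, bΩ₁⟩ := hfun Ω₁ (by simp)
  obtain ⟨cΩ₂, bΩ₂⟩ := hfun Ω₂ (by simp)
  obtain ⟨cΩ₃, bΩ₃⟩ := hfun Ω₃ (by simp)
  obtain ⟨cν, -⟩ := hfun ν (by simp)
  obtain ⟨K, hK, hex⟩ := exists_solution_of_neg_amplitude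
  obtain ⟨δ₁, hδ₁, hex⟩ := hex s hs
  -- For `ε < 0` the explicit solution has both amplitudes nonzero, so by uniqueness it lies on the
  -- third branch and its `μ²` is `ν(ε)`.
  have hleft : (fun ε => ν ε + 4 * ε ^ 3) =O[𝓝[<] 0] fun ε => ε ^ 4 := by
    refine Asymptotics.IsBigO.of_bound K ?_
    filter_upwards [Ioo_mem_nhdsLT (show -δ₁ < 0 by linarith)] with ε hε
    obtain ⟨μ, w, x, hsol, hx, hw, h2, h3, hμ, hest⟩ := hex ε hε.1 hε.2
    obtain ⟨-, -, -, h⟩ := huniq w x hw hx hsol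
    rw [h2, h3] at h
    rw [← (h hε.2.ne hμ.ne').1, Real.norm_eq_abs, Real.norm_eq_abs, abs_pow]
    exact hest
  have han : AnalyticAt ℝ (fun ε => ν ε + 4 * ε ^ 3) 0 := by
    have h1 : ContDiffAt ℝ ω ν 0 := cν.contDiffAt (Metric.ball_mem_nhds _ hs)
    have h2 : ContDiffAt ℝ ω (fun ε => ν ε + 4 * ε ^ 3) 0 := by fun_prop
    exact h2.analyticAt
  obtain ⟨K', hK'pos, hK'⟩ := (analyticAt_isBigO_pow_of_left han hleft).exists_pos
  obtain ⟨δ₂, hδ₂, hest⟩ := Metric.eventually_nhds_iff_ball.1 hK'.bound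
  simp only [mem_ball_zero_iff, Real.norm_eq_abs, abs_pow] at hest
  -- The last term gives `(4 + K')δ < 1`. It ensures `0 < ν < δ²` for `ε < 0`, hence `√ν < δ`, and
  -- `ν < 0` for `ε > 0`.
  set δ := min (min s δ₂) (1 / (5 + K')) with hδ
  have hδpos : 0 < δ := lt_min (lt_min hs hδ₂) (by positivity)
  have hδs : δ ≤ s := (min_le_left _ _).trans (min_le_left _ _)
  have hδ₂' : δ ≤ δ₂ := (min_le_left _ _).trans (min_le_right _ _)
  have hδK : (5 + K') * δ ≤ 1 := by
    have : δ ≤ 1 / (5 + K') := min_le_right _ _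
    rw [le_div_iff₀ (by positivity)] at this
    linarith
  have hδK4 : (4 + K') * δ < 1 := by linarith
  have hδ1 : δ < 1 := by nlinarith
  have hνneg : ∀ ε, -δ < ε → ε < 0 → |ν ε + 4 * ε ^ 3| ≤ K' * |ε| ^ 4 ∧ 0 < ν ε ∧ ν ε < δ ^ 2 := by
    intro ε h1 h2
    have h3 := hest ε (by rw [abs_of_neg h2]; linarith)
    exact ⟨h3, pos_lt_of_abs_add_le h2 h1 hK'pos.le hδK4 hδ1 h3⟩
  have hmδ : ∀ ε, -δ < ε → ε < 0 → √(ν ε) < δ := fun ε h1 h2 =>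
    (Real.sqrt_lt' hδpos).2 (hνneg ε h1 h2).2.2
  set O : Fin 3 → ℝ × ℝ → ℝ := ![fun x => Ω₁ (x.2 ^ 2), fun x => Ω₂ x.1, fun x => Ω₃ x.1] with hO
  have hball : ∀ x ∈ Metric.ball (0 : ℝ × ℝ) δ, |x.1| < δ ∧ |x.2| < δ ∧ |x.2 ^ 2| < δ := by
    intro x hx
    simp only [mem_ball_zero_iff, Prod.norm_def, sup_lt_iff, Real.norm_eq_abs] at hx
    refine ⟨hx.1, hx.2, ?_⟩
    rw [abs_pow]
    nlinarith [abs_nonneg x.2, hx.2]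
  have hm : ∀ {t : ℝ}, |t| < δ → t ∈ Metric.ball (0 : ℝ) s := fun h => by
    simpa [mem_ball_zero_iff] using h.trans_le hδs
  have hOc : ∀ i, ContDiffOn ℝ ω (O i) (Metric.ball 0 δ) ∧ ∀ x ∈ Metric.ball 0 δ, |O i x| < r := by
    intro i
    fin_cases i
    · exact ⟨ContDiffOn.comp (g := Ω₁) (f := fun x : ℝ × ℝ => x.2 ^ 2) cΩ₁ (by fun_prop)
        fun x hx => hm (hball x hx).2.2, fun x hx => bΩ₁ _ (hm (hball x hx).2.2)⟩
    · exact ⟨ContDiffOn.comp (g := Ω₂) (f := fun x : ℝ × ℝ => x.1) cΩ₂ (by fun_prop)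
        fun x hx => hm (hball x hx).1, fun x hx => bΩ₂ _ (hm (hball x hx).1)⟩
    · exact ⟨ContDiffOn.comp (g := Ω₃) (f := fun x : ℝ × ℝ => x.1) cΩ₃ (by fun_prop)
        fun x hx => hm (hball x hx).1, fun x hx => bΩ₃ _ (hm (hball x hx).1)⟩
  have hcurve : ∀ i, ∀ x ∈ branchCurve (fun ε => √(ν ε)) δ i, x ∈ Metric.ball (0 : ℝ × ℝ) δ ∧
      (x.1 ≠ 0 ∨ x.2 ≠ 0) ∧ Solves 1 (1 / 6 + O i x) (Y (x.1, x.2, O i x)) := by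
    rintro i ⟨ε, μ⟩ hx
    simp only [mem_ball_zero_iff, Prod.norm_def, sup_lt_iff, Real.norm_eq_abs]
    fin_cases i
    · obtain ⟨h1, h2, h3⟩ := hx
      simp only at h1 h2 h3
      subst h1
      exact ⟨⟨by simpa using hδpos, h3⟩, Or.inr h2, S1 μ (h3.trans_le hδs)⟩
    · obtain ⟨h1, h2, h3⟩ := hx
      simp only at h1 h2 h3
      subst h1
      exact ⟨⟨h3, by simpa using hδpos⟩, Or.inl h2, S2 ε (h3.trans_le hδs)⟩
    · obtain ⟨h1, h2, h3⟩ := hx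
      simp only at h1 h2 h3
      have h4 : |ε| < δ := by rw [abs_of_neg h2]; linarith
      have h5 : |μ| < δ := by rw [h3, abs_of_nonneg (Real.sqrt_nonneg _)]; exact hmδ ε h1 h2
      refine ⟨⟨h4, h5⟩, Or.inl h2.ne, S3 ε μ (h4.trans_le hδs) (h5.trans_le hδs) ?_⟩
      rw [h3, Real.sq_sqrt (hνneg ε h1 h2).2.1.le]
  refine ⟨fun i x => 1 / 6 + O i x, fun i x => Y (x.1, x.2, O i x), fun ε => √(ν ε), δ, hδpos,
    40000 + K', fun i => ⟨?_, ?_⟩, ?_, fun ε hε => ⟨?_, hmδ ε hε.1 hε.2, ?_⟩, fun i x hx => ?_,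
    δ, hδpos, fun w x hw hx hsol => ?_⟩
  · exact ((contDiffOn_const.add (hOc i).1)).of_le le_top
  · refine ContDiffOn.of_le ?_ (n := ω) le_top
    refine ContDiffOn.comp (g := Y) (f := fun x : ℝ × ℝ => (x.1, x.2, O i x)) hYc
      (contDiffOn_fst.prodMk (contDiffOn_snd.prodMk (hOc i).1)) fun x hx => ?_
    obtain ⟨h1, h2, -⟩ := hball x hx
    simp only [mem_ball_zero_iff, Prod.norm_def, sup_lt_iff, Real.norm_eq_abs]
    exact ⟨h1.trans_le (hδs.trans hsr), h2.trans_le (hδs.trans hsr), (hOc i).2 x hx⟩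
  · refine ContDiffOn.of_le ?_ (n := ω) le_top
    refine ContDiffOn.sqrt (cν.mono fun ε hε => hm ?_) fun ε hε => (hνneg ε hε.1 hε.2).2.1.ne'
    rw [abs_of_neg hε.2]
    linarith [hε.1]
  · exact Real.sqrt_pos.2 (hνneg ε hε.1 hε.2).2.1
  · obtain ⟨h1, h2, -⟩ := hνneg ε hε.1 hε.2
    have := abs_sqrt_sub_le hε.2 (by linarith [hε.1]) hK'pos.le h2.le h1
    nlinarith [sq_nonneg ε]
  · obtain ⟨h1, h2, h3⟩ := hcurve i x hx
    obtain ⟨h4, h5, -⟩ := hball x h1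
    have h6 := (hOc i).2 x h1
    obtain ⟨h7, h8, h9⟩ := hY x.1 x.2 (O i x) (h4.trans_le (hδs.trans hsr))
      (h5.trans_le (hδs.trans hsr)) h6
    have h10 : |1 / 6 + O i x - 1 / 6| < 1 / 1000 := by
      rw [add_sub_cancel_left]
      linarith
    obtain ⟨q1, q2⟩ := h3.quadratic_estimate h10 (by linarith)
    rw [h8, h9] at q1 q2
    have q3 := q2 h2
    refine ⟨h10, h3, h8, h9, ?_⟩
    have : 0 ≤ K' * (x.1 ^ 2 + x.2 ^ 2) := by positivity
    linarith
  · obtain ⟨hxY, u1, u2, u3⟩ := huniq w x (hw.trans_le hδs) (hx.trans_le hδs) hsol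
    have hcoord : ∀ n : ℕ, n ≠ 0 → |x n| < δ := fun n hn => by
      have := (x - unit 0).abs_apply_le n
      rw [sub_apply', unit_apply, if_neg hn, sub_zero] at this
      exact this.trans_lt hx
    have h2 := hcoord 2 (by norm_num)
    have h3 := hcoord 3 (by norm_num)
    have hweq : ∀ {Ω : ℝ}, w - 1 / 6 = Ω → w = 1 / 6 + Ω := fun h => by linarith
    by_cases z2 : x 2 = 0
    · by_cases z3 : x 3 = 0
      · left
        have hsu : Solves 1 w (unit 0) := by simpa using solves_unit 0 w
        refine eq_of_solves_off_kernel (by linarith) (by linarith) (by simp) (fun n _ _ => hsol n)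
          (fun n _ _ => hsu n) ?_ ?_
        · rw [z2, unit_apply, if_neg (by norm_num)]
        · rw [z3, unit_apply, if_neg (by norm_num)]
      · exact Or.inr (Or.inl ⟨0, (0, x 3), ⟨rfl, z3, h3⟩, hweq (u1 z2 z3),
          hxY.trans (congrArg Y (Prod.ext z2 (Prod.ext rfl (u1 z2 z3))))⟩)
    · by_cases z3 : x 3 = 0
      · exact Or.inr (Or.inl ⟨1, (x 2, 0), ⟨rfl, z2, h2⟩, hweq (u2 z2 z3),
          hxY.trans (congrArg Y (Prod.ext rfl (Prod.ext z3 (u2 z2 z3))))⟩)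
      obtain ⟨e1, e2⟩ := u3 z2 z3
      obtain ⟨l1, l2⟩ := abs_lt.1 h2
      have hneg : x 2 < 0 := by
        by_contra hpos
        have h4 : 0 < x 2 := lt_of_le_of_ne (not_lt.1 hpos) (Ne.symm z2)
        have h5 : ν (x 2) < 0 :=
          neg_of_abs_add_le h4 (by nlinarith) (hest (x 2) (h2.trans_le hδ₂'))
        nlinarith [sq_nonneg (x 3)]
      rcases lt_or_gt_of_ne z3 with h3neg | h3pos
      -- For `μ < 0` the reflected solution has `μ > 0` and the same `ε` and `ω`, so it is the third
      -- branch itself.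
      · have hyx := (norm_alternate_sub_le x).trans_lt hx
        obtain ⟨hyY, -⟩ := huniq w _ (hw.trans_le hδs) (hyx.trans_le hδs) hsol.alternate
        have y2 : alternate x 2 = x 2 := by rw [alternate_apply]; ring
        have y3 : alternate x 3 = -x 3 := by rw [alternate_apply]; ring
        refine Or.inr (Or.inr ⟨(x 2, -x 3), ⟨l1, hneg, ?_⟩, hweq e2, ?_⟩)
        · change -x 3 = √(ν (x 2))
          rw [← e1, ← neg_sq, Real.sqrt_sq (by linarith)]
        · refine (alternate_alternate x).symm.trans ?_
          exact congrArg alternate (hyY.trans (congrArg Y (Prod.ext y2 (Prod.ext y3 e2))))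
      · refine Or.inr (Or.inl ⟨2, (x 2, x 3), ⟨l1, hneg, ?_⟩, hweq e2,
          hxY.trans (congrArg Y (Prod.ext rfl (Prod.ext rfl e2)))⟩)
        change x 3 = √(ν (x 2))
        rw [← e1, Real.sqrt_sq h3pos.le]

end ConformalFlow

/-! ### Transfer to the second eigenmode, and assembly. -/

namespace ConformalFlow

open SeqL1

set_option maxSynthPendingDepth 4

theorem zLift_mode_apply (k n : ℕ) : zLift (mode k) n = mode (2 * k + 1) n := by
  rw [zLift_apply, mode_apply, mode_apply]
  split_ifs <;> first | rfl | omega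

theorem zLift_error_le (A : SeqL2) (ε μ e : ℝ)
    (h : ∀ n, |A n - mode 0 n - ε * mode 2 n - μ * mode 3 n| ≤ e) (he : 0 ≤ e) (n : ℕ) :
    |zLift A n - mode 1 n - ε * mode 5 n - μ * mode 7 n| ≤ e := by
  have h1 := zLift_mode_apply 0 n
  have h2 := zLift_mode_apply 2 n
  have h3 := zLift_mode_apply 3 n
  norm_num at h1 h2 h3
  rw [← h1, ← h2, ← h3]
  simp only [zLift_apply]
  split_ifs
  · exact h _
  · simpa using he

/-- Stationary states near the second single-mode state arise from the lowest one. -/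
theorem IsStationary.exists_zLift_eq : ∃ η > 0, ∀ (w : ℝ) (B : SeqL2), |w - 1 / 12| < η →
    ‖B - mode 1‖ < η → IsStationary (1 + w) w B →
    ∃ A, B = zLift A ∧ IsStationary 1 (2 * w) A := by
  obtain ⟨C, hC, η, hη, hnorm⟩ := norm_le_norm_toL2_of_solves 1
  -- The last radius makes the `ℓ¹` distance to `e_1` smaller than `1/10000`, as the vanishing of
  -- the even entries requires.
  refine ⟨min (min η (1 / 2000)) (1 / (20000 * C)),
    lt_min (lt_min hη (by norm_num)) (by positivity), fun w B hw hB hst => ?_⟩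
  rw [lt_min_iff, lt_min_iff] at hw hB
  have hw12 := abs_lt.1 hw.1.2
  obtain ⟨x, rfl⟩ := hst.exists_toL2
  have hx : Solves (1 + w) w x := hst.solves
  rw [← toL2_unit, ← map_sub] at hB
  have h1 := hnorm w x (by linarith) (by simpa using hx) hB.1.1
  have h2 : ‖x - unit 1‖ < 1 / 10000 := by
    have h3 := hB.2
    rw [lt_div_iff₀ (by positivity)] at h3
    rw [lt_div_iff₀ (by norm_num)]
    nlinarith
  obtain ⟨y, rfl⟩ := exists_oddLift_eq fun n hn => hx.apply_even_eq_zero hw.1.2 h2 hn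
  refine ⟨toL2 y, toL2_oddLift y, Solves.isStationary (by linarith) (solves_oddLift_iff.1 ?_)⟩
  rwa [mul_div_cancel_left₀ w two_ne_zero]

theorem exists_branchTriples :
    ∃ (W : Fin 3 → ℝ × ℝ → ℝ) (A : Fin 3 → ℝ × ℝ → SeqL2) (m : ℝ → ℝ),
      IsBranchTriple 0 (1 / 6) 2 3 W A m ∧
      IsBranchTriple 1 (1 / 12) 5 7 (fun i x => W i x / 2) (fun i x => zLift (A i x)) m := by
  obtain ⟨W, a, m, δ, hδ, C, hsmooth, hmc, hm, hcurve, η, hη, huniq⟩ := exists_branches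
  obtain ⟨C₀, hC₀, η₀, hη₀, hnorm⟩ := norm_le_norm_toL2_of_solves 0
  have hA : ∀ i, ContDiffOn ℝ ((⊤ : ℕ∞) : WithTop ℕ∞) (fun x => toL2 (a i x)) (Metric.ball 0 δ) :=
    fun i => toL2.contDiff.comp_contDiffOn (hsmooth i).2
  have hWne : ∀ i, ∀ x ∈ branchCurve m δ i, W i x ≠ 0 := fun i x hx h => by
    have := (hcurve i x hx).1
    rw [h] at this
    norm_num [abs_of_neg] at this
  have herr : ∀ i, ∀ x ∈ branchCurve m δ i, ∀ n,
      |toL2 (a i x) n - mode 0 n - x.1 * mode 2 n - x.2 * mode 3 n| ≤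
        ‖a i x - unit 0 - x.1 • unit 2 - x.2 • unit 3‖ := fun i x _ n => by
    have := (a i x - unit 0 - x.1 • unit 2 - x.2 • unit 3).abs_apply_le n
    simpa only [sub_apply', smul_apply', unit_apply, mode_apply, toL2_apply] using this
  set η₁ := min (min η (1 / 1000)) (min η₀ (η / C₀)) with hη₁
  have hη₁pos : 0 < η₁ :=
    lt_min (lt_min hη (by norm_num)) (lt_min hη₀ (div_pos hη hC₀))
  have huniq₀ : ∀ (w : ℝ) (B : SeqL2), |w - 1 / 6| < η₁ → ‖B - mode 0‖ < η₁ →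
      IsStationary 1 w B → B = mode 0 ∨
      (∃ i, ∃ x ∈ branchCurve m δ i, w = W i x ∧ B = toL2 (a i x)) ∨
      ∃ x ∈ branchCurve m δ 2, w = W 2 x ∧ B = reflect 0 (toL2 (a 2 x)) := by
    intro w B hw hB hst
    rw [hη₁, lt_min_iff, lt_min_iff, lt_min_iff] at hw hB
    have hw6 := abs_lt.1 hw.1.2
    obtain ⟨x, rfl⟩ := hst.exists_toL2
    have hx : Solves 1 w x := hst.solves
    rw [← toL2_unit, ← map_sub] at hB
    have h1 := hnorm w x (by linarith) (by simpa using hx) hB.2.1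
    have h2 : ‖x - unit 0‖ < η := by
      have h3 := hB.2.2
      rw [lt_div_iff₀ hC₀] at h3
      linarith
    rcases huniq w x hw.1.1 h2 hx with h | ⟨i, z, hz, h3, h4⟩ | ⟨z, hz, h3, h4⟩
    · exact Or.inl (by rw [h, toL2_unit])
    · exact Or.inr (Or.inl ⟨i, z, hz, h3, by rw [h4]⟩)
    · exact Or.inr (Or.inr ⟨z, hz, h3, by rw [h4, toL2_alternate]⟩)
  have hpow : (-1 : ℝ) ^ 3 = -1 := by norm_num
  refine ⟨W, fun i x => toL2 (a i x), m, ⟨δ, hδ, C, fun i => ⟨(hsmooth i).1, hA i⟩, hmc, hm,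
    fun i x hx => ?_, fun x hx => ?_, η₁, hη₁pos, fun w B hw hB hst => ?_⟩,
    δ, hδ, C, fun i => ⟨?_, ?_⟩, hmc, hm, fun i x hx => ?_, fun x hx => ?_, ?_⟩
  · obtain ⟨-, h1, h2, h3, h4⟩ := hcurve i x hx
    refine ⟨?_, by simpa using h2, by simpa using h3,
      fun n => (add_le_add_right (herr i x hx n) _).trans h4⟩
    simpa using h1.isStationary (hWne i x hx)
  · obtain ⟨-, h1, h2, h3, -⟩ := hcurve 2 x hx
    simp only [reflect_apply, toL2_apply, h2, h3]
    refine ⟨?_, by norm_num, by norm_num⟩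
    rw [← toL2_alternate]
    simpa using h1.alternate.isStationary (hWne 2 x hx)
  · exact huniq₀ w B hw hB (by simpa using hst)
  · exact (hsmooth i).1.div_const 2
  · exact zLiftL.contDiff.comp_contDiffOn (hA i)
  · obtain ⟨-, h1, h2, h3, h4⟩ := hcurve i x hx
    refine ⟨?_, by simpa [zLift_apply] using h2, by simpa [zLift_apply] using h3, fun n => ?_⟩
    · simp only [← toL2_oddLift]
      simpa using (solves_oddLift_iff.2 h1).isStationary (div_ne_zero (hWne i x hx) two_ne_zero)
    · have h5 := zLift_error_le _ _ _ _ (herr i x hx) (norm_nonneg _) n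
      have h6 : |W i x / 2 - 1 / 12| ≤ |W i x - 1 / 6| := by
        rw [show W i x / 2 - 1 / 12 = (W i x - 1 / 6) / 2 by ring, abs_div, abs_two]
        linarith [abs_nonneg (W i x - 1 / 6)]
      linarith
  · obtain ⟨-, h1, h2, h3, -⟩ := hcurve 2 x hx
    rw [reflect_one_zLift]
    refine ⟨?_, ?_, ?_⟩
    · rw [← toL2_alternate, ← toL2_oddLift]
      simpa using (solves_oddLift_iff.2 h1.alternate).isStationary
        (div_ne_zero (hWne 2 x hx) two_ne_zero)
    · simp [zLift_apply, reflect_apply, h2]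
    · simp [zLift_apply, reflect_apply, h3, hpow]
  · obtain ⟨η₂, hη₂, hlift⟩ := IsStationary.exists_zLift_eq
    -- Undoing the lift doubles the distance in `ω` and does not increase the `ℓ²` distance.
    refine ⟨min η₂ (η₁ / 2), lt_min hη₂ (by linarith), fun w B hw hB hst => ?_⟩
    rw [lt_min_iff] at hw hB
    obtain ⟨A, rfl, hA⟩ := hlift w B hw.1 hB.1 (by simpa using hst)
    have h2w : |2 * w - 1 / 6| < η₁ := by
      rw [show 2 * w - 1 / 6 = 2 * (w - 1 / 12) by ring, abs_mul, abs_two]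
      linarith [hw.2]
    have hA0 : ‖A - mode 0‖ < η₁ := by
      have := norm_sub_mode_zero_le A
      linarith [hB.2]
    have hdiv : ∀ {v : ℝ}, 2 * w = v → w = v / 2 := fun h => by linarith
    rcases huniq₀ (2 * w) A h2w hA0 hA with h | ⟨i, z, hz, h3, h4⟩ | ⟨z, hz, h3, h4⟩
    · exact Or.inl (by rw [h, zLift_mode_zero])
    · exact Or.inr (Or.inl ⟨i, z, hz, hdiv h3, by rw [h4]⟩)
    · exact Or.inr (Or.inr ⟨z, hz, hdiv h3, by rw [h4, reflect_one_zLift]⟩)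

end ConformalFlow

theorem mainTheorem6 :
    ∃ (W : Fin 3 → ℝ × ℝ → ℝ) (A : Fin 3 → ℝ × ℝ → ConformalFlow.SeqL2) (m : ℝ → ℝ),
      ConformalFlow.IsBranchTriple 0 (1 / 6) 2 3 W A m ∧
      ConformalFlow.IsBranchTriple 1 (1 / 12) 5 7
        (fun i x => W i x / 2) (fun i x => ConformalFlow.zLift (A i x)) m :=
  ConformalFlow.exists_branchTriples
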